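/- Let $(G,H,t,m)$ be a Lie crossed module: $G,H$ are (finite-dimensional, real) Lie groups with Lie algebras $\mathfrak g,\mathfrak h$, $t:H\to G$ is a smooth homomorphism and $m$ is a smooth action of $G$ on $H$ by automorphisms, such that $t(m(a)(A))=a\,t(A)\,a^{-1}$ and $m(t(A))(A')=AA'A^{-1}$ for $a\in G$, $A,A'\in H$. Let $\dot t:\mathfrak h\to\mathfrak g$ and $\dot m(a):\mathfrak h\to\mathfrak h$ be the differentials of $t$ and of $m(a)$ at $1_H$. All maps and forms are smooth. A $(G,H)$-cocycle is a triple of maps $f:\mathbb R^2\times\mathbb R\to G$, $g:\mathbb R\times\mathbb R^2\to G$, $W:\mathbb R^2\times\mathbb R^2\to H$ such that, for all real $x,x',x'',y,y',y''$, $$t(W(x',x;y',y))=g(x;y',y)^{-1}f(x',x;y')^{-1}g(x';y',y)f(x',x;y),$$ $$f(x'',x;y)=f(x'',x';y)f(x',x;y),\qquad g(x;y'',y)=g(x;y'',y')g(x;y',y),$$ $$W(x'',x;y',y)=W(x',x;y',y)\,m(f(x',x;y)^{-1})(W(x'',x';y',y)),$$ $$W(x',x;y'',y)=m(g(x;y',y)^{-1})(W(x',x;y'',y'))\,W(x',x;y',y).$$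 A $(G,H)$-connection doublet is a pair $(a,B)\in\Omega^1(\mathbb R^2,\mathfrak g)\times\Omega^2(\mathbb R^2,\mathfrak h)$ with $da+\tfrac12[a,a]-\dot t(B)=0$, where $[a,a](v,w)=[a(v),a(w)]-[a(w),a(v)]$; write $a=a_x\,dx+a_y\,dy$ and $B=B_{xy}\,dx\wedge dy$. Then there is a bijection between the set of $(G,H)$-cocycles and the set of $(G,H)$-connection doublets with the following properties. (1) The doublet $(a,B)$ corresponding to a cocycle $(f,g,W)$ is given by $$a_x(x,y)=-\partial_{x'}f(x',x;y)f(x',x;y)^{-1}\big|_{x'=x},\qquad a_y(x,y)=-\partial_{y'}g(x;y',y)g(x;y',y)^{-1}\big|_{y'=y},$$ $$B_{xy}(x,y)=-\partial_{x'}\big(\partial_{y'}W(x',x;y',y)W(x',x;y',y)^{-1}\big)\big|_{x'=x,y'=y}=-\partial_{y'}\big(W(x',x;y',y)^{-1}\partial_{x'}W(x',x;y',y)\big)\big|_{x'=x,y'=y}.$$ (2) The cocycle $(f,g,W)$ corresponding to a doublet $(a,B)$ is given by $f(x,x_0;y)=u_{|y,x_0}(x)$, $g(x;y,y_0)=v_{|x,y_0}(y)$,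 $W(x,x_0;y,y_0)=E_{|x_0,y_0}(x,y)$, where, for all $x_0,y_0\in\mathbb R$, the smooth maps $(y,x)\mapsto u_{|y,x_0}(x)\in G$, $(x,y)\mapsto v_{|x,y_0}(y)\in G$ and $(x,y)\mapsto E_{|x_0,y_0}(x,y)\in H$ are the unique smooth solutions of $$\partial_xu_{|y,x_0}(x)u_{|y,x_0}(x)^{-1}=-a_x(x,y),\quad u_{|y,x_0}(x_0)=1_G,$$ $$\partial_yv_{|x,y_0}(y)v_{|x,y_0}(y)^{-1}=-a_y(x,y),\quad v_{|x,y_0}(y_0)=1_G,$$ and of either of the two problems $$\partial_x\big(\partial_yE_{|x_0,y_0}(x,y)E_{|x_0,y_0}(x,y)^{-1}\big)=-\dot m\big(v_{|x_0,y_0}(y)^{-1}u_{|y,x_0}(x)^{-1}\big)(B_{xy}(x,y)),$$ $$\partial_y\big(E_{|x_0,y_0}(x,y)^{-1}\partial_xE_{|x_0,y_0}(x,y)\big)=-\dot m\big(u_{|y_0,x_0}(x)^{-1}v_{|x,y_0}(y)^{-1}\big)(B_{xy}(x,y)),$$ each with the initial conditions $E_{|x_0,y_0}(x_0,y)=E_{|x_0,y_0}(x,y_0)=1_H$.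 These last two problems are equivalent: any solution of one is a solution of the other. -/

import Mathlib

open scoped Manifold ContDiff

noncomputable section

/-- The Lie algebra `T₁G` of a group modelled on `V` is `V` itself as a normed space, through the
preferred chart at `1`. This is the identity map `V = T₁G`, used to regard `V`-valued forms as
`T₁G`-valued forms. -/
def toLieAlgebra {V : Type*} [NormedAddCommGroup V] [NormedSpace ℝ V]
    (G : Type*) [TopologicalSpace G] [ChartedSpace V G] [Group G] (Z : V) :
    GroupLieAlgebra 𝓘(ℝ, V) G :=
  Z

/-- The velocity `c'(s)` of a curve `c` at time `s`, right translated to the identity: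
`∂ₛ c(s) c(s)⁻¹`, an element of the Lie algebra `T₁G`. -/
def rightLogDeriv {V : Type*} [NormedAddCommGroup V] [NormedSpace ℝ V]
    {G : Type*} [TopologicalSpace G] [ChartedSpace V G] [Group G]
    (c : ℝ → G) (s : ℝ) : GroupLieAlgebra 𝓘(ℝ, V) G :=
  mfderiv 𝓘(ℝ, V) 𝓘(ℝ, V) (fun k : G => k * (c s)⁻¹) (c s) (mfderiv 𝓘(ℝ, ℝ) 𝓘(ℝ, V) c s (1 : ℝ))

/-- The velocity `c'(s)` of a curve `c` at time `s`, left translated to the identity: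
`c(s)⁻¹ ∂ₛ c(s)`, an element of the Lie algebra `T₁G`. -/
def leftLogDeriv {V : Type*} [NormedAddCommGroup V] [NormedSpace ℝ V]
    {G : Type*} [TopologicalSpace G] [ChartedSpace V G] [Group G]
    (c : ℝ → G) (s : ℝ) : GroupLieAlgebra 𝓘(ℝ, V) G :=
  mfderiv 𝓘(ℝ, V) 𝓘(ℝ, V) (fun k : G => (c s)⁻¹ * k) (c s) (mfderiv 𝓘(ℝ, ℝ) 𝓘(ℝ, V) c s (1 : ℝ))

/-- A Lie crossed module `(G, H, t, m)`: a smooth homomorphism `t : H → G` and a smooth action `m`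
of `G` on `H` by automorphisms, such that `t` is equivariant for conjugation on `G` and the
Peiffer identity holds. -/
structure LieCrossedModule (V U : Type*)
    [NormedAddCommGroup V] [NormedSpace ℝ V] [NormedAddCommGroup U] [NormedSpace ℝ U]
    (G H : Type*) [TopologicalSpace G] [ChartedSpace V G] [Group G] [LieGroup 𝓘(ℝ, V) ∞ G]
    [TopologicalSpace H] [ChartedSpace U H] [Group H] [LieGroup 𝓘(ℝ, U) ∞ H] where
  t : H →* G
  m : G →* MulAut H
  contMDiff_t : ContMDiff 𝓘(ℝ, U) 𝓘(ℝ, V) ∞ t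
  contMDiff_m : ContMDiff (𝓘(ℝ, V).prod 𝓘(ℝ, U)) 𝓘(ℝ, U) ∞ (fun p : G × H => m p.1 p.2)
  t_m : ∀ (a : G) (A : H), t (m a A) = a * t A * a⁻¹
  peiffer : ∀ A A' : H, m (t A) A' = A * A' * A⁻¹

namespace LieCrossedModule

variable {V U : Type*}
  [NormedAddCommGroup V] [NormedSpace ℝ V] [NormedAddCommGroup U] [NormedSpace ℝ U]
  {G H : Type*} [TopologicalSpace G] [ChartedSpace V G] [Group G] [LieGroup 𝓘(ℝ, V) ∞ G]
  [TopologicalSpace H] [ChartedSpace U H] [Group H] [LieGroup 𝓘(ℝ, U) ∞ H]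

/-- `ṫ : 𝔥 → 𝔤`, the differential of `t` at the identity. -/
def tDot (X : LieCrossedModule V U G H) (Z : GroupLieAlgebra 𝓘(ℝ, U) H) :
    GroupLieAlgebra 𝓘(ℝ, V) G :=
  mfderiv 𝓘(ℝ, U) 𝓘(ℝ, V) X.t (1 : H) Z

/-- `ṁ(a) : 𝔥 → 𝔥`, the differential of `m(a)` at the identity. -/
def mDot (X : LieCrossedModule V U G H) (a : G) (Z : GroupLieAlgebra 𝓘(ℝ, U) H) :
    GroupLieAlgebra 𝓘(ℝ, U) H :=
  mfderiv 𝓘(ℝ, U) 𝓘(ℝ, U) (X.m a) (1 : H) Z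

/-- A `(G, H)`-cocycle. The arguments are ordered as in `f(x', x; y)`, `g(x; y', y)` and
`W(x', x; y', y)`. -/
@[ext]
structure Cocycle (X : LieCrossedModule V U G H) where
  f : ℝ → ℝ → ℝ → G
  g : ℝ → ℝ → ℝ → G
  W : ℝ → ℝ → ℝ → ℝ → H
  contMDiff_f : ContMDiff 𝓘(ℝ, ℝ × ℝ × ℝ) 𝓘(ℝ, V) ∞ (fun p : ℝ × ℝ × ℝ => f p.1 p.2.1 p.2.2)
  contMDiff_g : ContMDiff 𝓘(ℝ, ℝ × ℝ × ℝ) 𝓘(ℝ, V) ∞ (fun p : ℝ × ℝ × ℝ => g p.1 p.2.1 p.2.2)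
  contMDiff_W : ContMDiff 𝓘(ℝ, ℝ × ℝ × ℝ × ℝ) 𝓘(ℝ, U) ∞
    (fun p : ℝ × ℝ × ℝ × ℝ => W p.1 p.2.1 p.2.2.1 p.2.2.2)
  target : ∀ x' x y' y,
    X.t (W x' x y' y) = (g x y' y)⁻¹ * (f x' x y')⁻¹ * g x' y' y * f x' x y
  f_comp : ∀ x'' x' x y, f x'' x y = f x'' x' y * f x' x y
  g_comp : ∀ x y'' y' y, g x y'' y = g x y'' y' * g x y' y
  W_comp_x : ∀ x'' x' x y' y,
    W x'' x y' y = W x' x y' y * X.m (f x' x y)⁻¹ (W x'' x' y' y)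
  W_comp_y : ∀ x' x y'' y' y,
    W x' x y'' y = X.m (g x y' y)⁻¹ (W x' x y'' y') * W x' x y' y

/-- A `(G, H)`-connection doublet: a smooth `𝔤`-valued `1`-form `a` and a smooth `𝔥`-valued `2`-form
`B` on `ℝ²` with `da + ½[a, a] - ṫ(B) = 0`, where `[a, a](v, w) = [a(v), a(w)] - [a(w), a(v)]`.
Here `𝔤 = T₁G` and `𝔥 = T₁H` are the model spaces `V` and `U` as normed spaces. -/
@[ext]
structure ConnectionDoublet (X : LieCrossedModule V U G H) where
  a : ℝ × ℝ → (ℝ × ℝ) [⋀^Fin 1]→L[ℝ] V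
  B : ℝ × ℝ → (ℝ × ℝ) [⋀^Fin 2]→L[ℝ] U
  contDiff_a : ContDiff ℝ ∞ a
  contDiff_B : ContDiff ℝ ∞ B
  fake_flat : ∀ p v w : ℝ × ℝ,
    toLieAlgebra G (extDeriv a p ![v, w])
      + (1 / 2 : ℝ) • (⁅toLieAlgebra G (a p ![v]), toLieAlgebra G (a p ![w])⁆
        - ⁅toLieAlgebra G (a p ![w]), toLieAlgebra G (a p ![v])⁆)
      - X.tDot (toLieAlgebra H (B p ![v, w])) = 0

namespace ConnectionDoublet

variable {X : LieCrossedModule V U G H}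

/-- The component `a_x(x, y)`. -/
def ax (D : X.ConnectionDoublet) (x y : ℝ) : GroupLieAlgebra 𝓘(ℝ, V) G :=
  toLieAlgebra G (D.a (x, y) ![(1, 0)])

/-- The component `a_y(x, y)`. -/
def ay (D : X.ConnectionDoublet) (x y : ℝ) : GroupLieAlgebra 𝓘(ℝ, V) G :=
  toLieAlgebra G (D.a (x, y) ![(0, 1)])

/-- The component `B_{xy}(x, y)`. -/
def Bxy (D : X.ConnectionDoublet) (x y : ℝ) : GroupLieAlgebra 𝓘(ℝ, U) H :=
  toLieAlgebra H (D.B (x, y) ![(1, 0), (0, 1)])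

/-- `u y x = u_{|y,x₀}(x)` is a smooth solution of
`∂ₓu_{|y,x₀}(x) u_{|y,x₀}(x)⁻¹ = -a_x(x, y)`, `u_{|y,x₀}(x₀) = 1`. -/
structure IsSolutionU (D : X.ConnectionDoublet) (x₀ : ℝ) (u : ℝ → ℝ → G) : Prop where
  smooth : ContMDiff 𝓘(ℝ, ℝ × ℝ) 𝓘(ℝ, V) ∞ (fun p : ℝ × ℝ => u p.1 p.2)
  ode : ∀ y x, rightLogDeriv (V := V) (u y) x = -D.ax x y
  init : ∀ y, u y x₀ = 1

/-- `v x y = v_{|x,y₀}(y)` is a smooth solution of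
`∂_y v_{|x,y₀}(y) v_{|x,y₀}(y)⁻¹ = -a_y(x, y)`, `v_{|x,y₀}(y₀) = 1`. -/
structure IsSolutionV (D : X.ConnectionDoublet) (y₀ : ℝ) (v : ℝ → ℝ → G) : Prop where
  smooth : ContMDiff 𝓘(ℝ, ℝ × ℝ) 𝓘(ℝ, V) ∞ (fun p : ℝ × ℝ => v p.1 p.2)
  ode : ∀ x y, rightLogDeriv (V := V) (v x) y = -D.ay x y
  init : ∀ x, v x y₀ = 1

/-- `E` is a smooth solution of the first form of the second order problem:
`∂ₓ(∂_y E(x,y) E(x,y)⁻¹) = -ṁ(v_{|x₀,y₀}(y)⁻¹ u_{|y,x₀}(x)⁻¹)(B_{xy}(x,y))`,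
`E(x₀,y) = E(x,y₀) = 1`. -/
structure IsSolutionE₁ (D : X.ConnectionDoublet) (x₀ y₀ : ℝ) (u v : ℝ → ℝ → G)
    (E : ℝ → ℝ → H) : Prop where
  smooth : ContMDiff 𝓘(ℝ, ℝ × ℝ) 𝓘(ℝ, U) ∞ (fun p : ℝ × ℝ => E p.1 p.2)
  ode : ∀ x y, deriv (fun ξ => rightLogDeriv (V := U) (fun η => E ξ η) y) x
    = -X.mDot ((v x₀ y)⁻¹ * (u y x)⁻¹) (D.Bxy x y)
  init_x : ∀ y, E x₀ y = 1
  init_y : ∀ x, E x y₀ = 1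

/-- `E` is a smooth solution of the second form of the second order problem:
`∂_y(E(x,y)⁻¹ ∂ₓE(x,y)) = -ṁ(u_{|y₀,x₀}(x)⁻¹ v_{|x,y₀}(y)⁻¹)(B_{xy}(x,y))`,
`E(x₀,y) = E(x,y₀) = 1`. -/
structure IsSolutionE₂ (D : X.ConnectionDoublet) (x₀ y₀ : ℝ) (u v : ℝ → ℝ → G)
    (E : ℝ → ℝ → H) : Prop where
  smooth : ContMDiff 𝓘(ℝ, ℝ × ℝ) 𝓘(ℝ, U) ∞ (fun p : ℝ × ℝ => E p.1 p.2)
  ode : ∀ x y, deriv (fun η => leftLogDeriv (V := U) (fun ξ => E ξ η) x) y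
    = -X.mDot ((u y₀ x)⁻¹ * (v x y)⁻¹) (D.Bxy x y)
  init_x : ∀ y, E x₀ y = 1
  init_y : ∀ x, E x y₀ = 1

end ConnectionDoublet

end LieCrossedModule

end

/-! A cocycle is determined by its infinitesimal part on the diagonal. Its composition laws move the
base point, and this turns `f`, `g` and `W` into solutions of differential equations whose
coefficients are `a_x`, `a_y` and `B_{xy}`. Hence the map `toDoublet`, given by differentiation on
the diagonal, is injective by uniqueness of solutions. It lands in doublets because of the target
law: the mixed second derivative of the holonomy around a rectangle, at the degenerate rectangle, is
minus the curvature of `a` (`mixedPartial_commutator`). The bracket term comes from the bilinear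
part of the multiplication in a chart, of which the Lie bracket is the antisymmetrisation
(`bracket_eq_chartMulBilin`).

For surjectivity, parallel transports `u`, `v` and a surface transport `E` over rectangles with a
corner at the origin are built from a doublet (`nonempty_transport`). The maps `t(E)` and the
holonomy of the rectangle have logarithmic derivatives with the same `x`-derivative, and this is
exactly the vanishing of the fake curvature; so they coincide. A general rectangle is assembled from
four rectangles at the origin (`toCocycle`). The cocycle laws are then algebra, and the Peiffer
identity is needed only for the composition law in `y`.

The `W` of a cocycle solves both second order problems, and each of them has at most one solution.
Since every doublet comes from a cocycle, both problems are solvable and equivalent.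

The analytic input is smooth dependence of solutions on parameters. It is obtained from the implicit
function theorem on the Banach space of continuous paths (`exists_smooth_local_solution`), carried
to the group through a chart, and globalised by gluing along overlapping intervals
(`exists_rlog_eq`). -/

noncomputable section

open scoped Manifold ContDiff
open Set Filter Topology

/-! ### Calculus on spaces of continuous functions -/

namespace ContinuousMap

variable {K : Type*} [TopologicalSpace K] [CompactSpace K]

/-- Pointwise application of a continuous family of continuous linear maps, as a bounded bilinear
map between spaces of continuous functions. -/
def pointwiseApply (K : Type*) [TopologicalSpace K] [CompactSpace K]
    (E F : Type*) [NormedAddCommGroup E] [NormedSpace ℝ E]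
    [NormedAddCommGroup F] [NormedSpace ℝ F] : C(K, E →L[ℝ] F) →L[ℝ] C(K, E) →L[ℝ] C(K, F) :=
  LinearMap.mkContinuous₂
    (LinearMap.mk₂ ℝ (fun (A : C(K, E →L[ℝ] F)) (z : C(K, E)) =>
      (⟨fun k => A k (z k), A.continuous.clm_apply z.continuous⟩ : C(K, F)))
      (fun _ _ _ => by ext; simp) (fun _ _ _ => by ext; simp)
      (fun _ _ _ => by ext; simp) (fun _ _ _ => by ext; simp)) 1
    (fun A z => by
      rw [ContinuousMap.norm_le _ (by positivity)]
      intro k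
      refine ((A k).le_opNorm (z k)).trans ?_
      rw [one_mul]
      gcongr
      · exact A.norm_coe_le_norm k
      · exact z.norm_coe_le_norm k)

@[simp]
lemma pointwiseApply_apply {E F : Type*} [NormedAddCommGroup E] [NormedSpace ℝ E]
    [NormedAddCommGroup F] [NormedSpace ℝ F] (A : C(K, E →L[ℝ] F)) (z : C(K, E)) (k : K) :
    pointwiseApply K E F A z k = A k (z k) :=
  rfl

/-- Postcomposition with a `C¹` map is differentiable on spaces of continuous functions. -/
lemma hasFDerivAt_postcomp {E F : Type*} [NormedAddCommGroup E] [NormedSpace ℝ E]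
    [NormedAddCommGroup F] [NormedSpace ℝ F] {f : C(E, F)} {f' : C(E, E →L[ℝ] F)}
    (hf : ∀ x, HasFDerivAt f (f' x) x) (z : C(K, E)) :
    HasFDerivAt (fun w : C(K, E) => f.comp w) (pointwiseApply K E F (f'.comp z)) z := by
  rw [hasFDerivAt_iff_isLittleO_nhds_zero, Asymptotics.isLittleO_iff]
  intro ε hε
  have hcont : ContinuousAt (fun w : C(K, E) => f'.comp w) z :=
    (ContinuousMap.continuous_postcomp f').continuousAt
  obtain ⟨δ, hδ, hball⟩ := (Metric.continuousAt_iff (α := C(K, E))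
    (β := C(K, E →L[ℝ] F))).1 hcont ε hε
  filter_upwards [Metric.ball_mem_nhds (0 : C(K, E)) hδ] with h hh
  rw [mem_ball_zero_iff] at hh
  rw [ContinuousMap.norm_le _ (by positivity)]
  intro k
  have hk : ‖h k‖ < δ := (h.norm_coe_le_norm k).trans_lt hh
  have key : ‖f (z k + h k) - f (z k) - f' (z k) (z k + h k - z k)‖
      ≤ ε * ‖z k + h k - z k‖ := by
    refine (convex_ball (z k) δ).norm_image_sub_le_of_norm_hasFDerivWithin_le'
      (f' := fun w => f' w) (fun w _ => (hf w).hasFDerivWithinAt) ?_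
      (Metric.mem_ball_self hδ) (by simpa using hk)
    intro w hw
    -- A point `w` near `z k` is a value of a translate of `z` by a constant, which is uniformly
    -- close to `z`. Continuity of postcomposition with `f'` thus gives a bound uniform in `k`,
    -- although `E` need not be locally compact.
    have h1 : dist (z + ContinuousMap.const K (w - z k)) z < δ := by
      rw [dist_eq_norm, add_sub_cancel_left]
      rw [mem_ball_iff_norm] at hw
      exact ((ContinuousMap.norm_le _ (norm_nonneg _)).2 (fun _ => le_rfl)).trans_lt hw
    have h2 := (ContinuousMap.dist_apply_le_dist k).trans (hball h1).le
    simpa [dist_eq_norm] using h2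
  have h3 : ‖h k‖ ≤ ‖h‖ := h.norm_coe_le_norm k
  simp only [add_sub_cancel_left] at key
  refine le_trans ?_ (key.trans (by gcongr))
  exact le_of_eq rfl

universe u v

/-- Postcomposition with a smooth map is smooth on spaces of continuous functions. -/
lemma contDiff_postcomp {E : Type u} {F : Type (max u v)} [NormedAddCommGroup E] [NormedSpace ℝ E]
    [NormedAddCommGroup F] [NormedSpace ℝ F] (f : C(E, F)) (hf : ContDiff ℝ ∞ f) :
    ContDiff ℝ ∞ (fun w : C(K, E) => f.comp w) := by
  rw [contDiff_infty]
  intro n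
  -- The derivative takes values in `E →L[ℝ] F`, so the target has to vary; the universe `max u v`
  -- is stable under this change.
  induction n generalizing F with
  | zero => exact contDiff_zero.2 (ContinuousMap.continuous_postcomp f)
  | succ n ih =>
    have hf' : ContDiff ℝ ∞ (fderiv ℝ f) := hf.fderiv_right (by simp)
    let f' : C(E, E →L[ℝ] F) := ⟨fderiv ℝ f, hf'.continuous⟩
    have h : ∀ x, HasFDerivAt f (f' x) x := fun x =>
      (hf.differentiable (by simp) x).hasFDerivAt
    refine (contDiff_succ_iff_hasFDerivAt (n := n)).2
      ⟨fun z => pointwiseApply K E F (f'.comp z), ?_, fun z => hasFDerivAt_postcomp h z⟩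
    exact (pointwiseApply K E F).contDiff.comp (ih f' hf')

lemma contDiff_eval {E : Type*} [NormedAddCommGroup E] [NormedSpace ℝ E] (k : K) :
    ContDiff ℝ ∞ (fun z : C(K, E) => z k) :=
  (ContinuousMap.evalCLM ℝ k : C(K, E) →L[ℝ] E).contDiff

/-- The primitive vanishing at `0` of a continuous function on `[0, 1]`, as a bounded operator. -/
def primitive (E : Type*) [NormedAddCommGroup E] [NormedSpace ℝ E] :
    C(unitInterval, E) →L[ℝ] C(unitInterval, E) :=
  LinearMap.mkContinuous
    { toFun := fun z => ⟨fun s => ∫ τ in (0 : ℝ)..s, Set.IccExtend zero_le_one z τ,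
        (intervalIntegral.continuous_primitive
          (fun _ _ => (z.continuous.Icc_extend').intervalIntegrable _ _) 0).comp
          continuous_subtype_val⟩
      map_add' := fun z w => by
        ext s
        exact intervalIntegral.integral_add ((z.continuous.Icc_extend').intervalIntegrable _ _)
          ((w.continuous.Icc_extend').intervalIntegrable _ _)
      map_smul' := fun c z => by
        ext s
        exact intervalIntegral.integral_smul c _ } 1
    (fun z => by
      rw [ContinuousMap.norm_le _ (by positivity)]
      intro s
      refine (intervalIntegral.norm_integral_le_of_norm_le_const (C := ‖z‖)
        (fun τ _ => z.norm_coe_le_norm _)).trans ?_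
      rw [one_mul, sub_zero, abs_of_nonneg s.2.1]
      exact mul_le_of_le_one_right (norm_nonneg _) s.2.2)

lemma primitive_apply {E : Type*} [NormedAddCommGroup E] [NormedSpace ℝ E]
    (z : C(unitInterval, E)) (s : unitInterval) :
    primitive E z s = ∫ τ in (0 : ℝ)..s, Set.IccExtend zero_le_one z τ :=
  rfl

end ContinuousMap

/-! ### Implicit functions and smooth dependence on parameters -/

/-- The implicit function of a smooth equation is smooth near the base point. -/
lemma ContDiffAt.eventually_contDiffAt_implicitFunction {E₁ E₂ F : Type*}
    [NormedAddCommGroup E₁] [NormedSpace ℝ E₁] [CompleteSpace E₁]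
    [NormedAddCommGroup E₂] [NormedSpace ℝ E₂] [CompleteSpace E₂]
    [NormedAddCommGroup F] [NormedSpace ℝ F] [CompleteSpace F]
    {f : E₁ × E₂ → F} {u : E₁ × E₂} (hf : ContDiff ℝ ∞ f)
    (hu : (fderiv ℝ f u ∘L .inr ℝ E₁ E₂).IsInvertible) :
    ∀ᶠ p in 𝓝 u.1, ContDiffAt ℝ ∞
      ((hf.contDiffAt (x := u)).implicitFunction (by simp) hu) p := by
  set ψ := (hf.contDiffAt (x := u)).implicitFunction (by simp) hu with hψ
  -- Being `C^∞` at one point only provides, for each finite order, a neighbourhood depending on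
  -- that order. Only order one is spread here; full smoothness at a nearby `p` comes from the
  -- implicit function theorem applied afresh at `(p, ψ p)`, whose implicit function agrees with `ψ`
  -- near `p` by uniqueness.
  have h1 : ∀ᶠ p in 𝓝 u.1, ContDiffAt ℝ 1 ψ p :=
    (((hf.contDiffAt (x := u)).contDiffAt_implicitFunction (by simp) hu).of_le
      (by simp)).eventually (by simp)
  have h2 : ∀ᶠ p in 𝓝 u.1, f (p, ψ p) = f u :=
    (hf.contDiffAt (x := u)).eventually_apply_implicitFunction (by simp) hu
  have h3 : ∀ᶠ p in 𝓝 u.1, (fderiv ℝ f (p, ψ p) ∘L .inr ℝ E₁ E₂).IsInvertible := by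
    have hc : ContinuousAt (fun p => fderiv ℝ f (p, ψ p) ∘L .inr ℝ E₁ E₂) u.1 := by
      have hψc : ContinuousAt ψ u.1 := h1.self_of_nhds.continuousAt
      have : ContinuousAt (fun p => fderiv ℝ f (p, ψ p)) u.1 :=
        ContinuousAt.comp (f := fun p => (p, ψ p)) (g := fderiv ℝ f)
          (hf.continuous_fderiv (by simp)).continuousAt (continuousAt_id.prodMk hψc)
      exact this.clm_comp continuousAt_const
    have h0 : ψ u.1 = u.2 := (hf.contDiffAt (x := u)).implicitFunction_apply_self (by simp) hu
    obtain ⟨e, he⟩ := hu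
    have := hc.eventually (p := fun A => A.IsInvertible) (by
      beta_reduce
      rw [h0, Prod.mk.eta, ← he]
      exact e.nhds)
    exact this
  filter_upwards [h1, h2.eventually_nhds, h3] with p hp1 hp2 hp3
  have hp0 := hp2.self_of_nhds
  have h4 := (hf.contDiffAt (x := (p, ψ p))).eventually_apply_eq_iff_implicitFunction
    (by simp) hp3
  have h5 : Tendsto (fun q => (q, ψ q)) (𝓝 p) (𝓝 (p, ψ p)) :=
    continuousAt_id.prodMk hp1.continuousAt
  refine ((hf.contDiffAt (x := (p, ψ p))).contDiffAt_implicitFunction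
    (by simp) hp3).congr_of_eventuallyEq ?_
  filter_upwards [h5.eventually h4, hp2] with q hq hq2
  exact (hq.1 (hq2.trans hp0.symm)).symm

universe u

/-- Smoothness of the integral `∫₀ˣ β(ξ, y) dξ` in its upper bound and in the parameter. -/
lemma contDiff_integral_parameter {F : Type u} [NormedAddCommGroup F] [NormedSpace ℝ F]
    {β : ℝ × ℝ → F} (hβ : ContDiff ℝ ∞ β) :
    ContDiff ℝ ∞ (fun p : ℝ × ℝ => ∫ ξ in (0 : ℝ)..p.1, β (ξ, p.2)) := by
  let b : C(ℝ × ℝ, F) := ⟨β, hβ.continuous⟩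
  -- The integral equals `x ∫₀¹ β(xs, y) ds`, and the path `s ↦ (xs, y)` depends linearly on `(x,
  -- y)`.
  let κ₁ : C(unitInterval, ℝ × ℝ) := ⟨fun s => (s, 0), by fun_prop⟩
  let κ₂ : C(unitInterval, ℝ × ℝ) := ContinuousMap.const _ (0, 1)
  have hk : ContDiff ℝ ∞ (fun p : ℝ × ℝ => p.1 • κ₁ + p.2 • κ₂) := by fun_prop
  have h1 : ContDiff ℝ ∞ (fun p : ℝ × ℝ => b.comp (p.1 • κ₁ + p.2 • κ₂)) :=
    (ContinuousMap.contDiff_postcomp.{0, u} b hβ).comp hk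
  have h2 : ContDiff ℝ ∞ (fun p : ℝ × ℝ =>
      p.1 • ContinuousMap.primitive F (b.comp (p.1 • κ₁ + p.2 • κ₂)) 1) :=
    contDiff_fst.smul ((ContinuousMap.contDiff_eval (1 : unitInterval)).comp
      ((ContinuousMap.primitive F).contDiff.comp h1))
  convert h2 using 2 with p
  rw [ContinuousMap.primitive_apply]
  have := intervalIntegral.smul_integral_comp_mul_left (fun ξ => β (ξ, p.2)) (a := 0) (b := 1) p.1
  rw [mul_zero, mul_one] at this
  rw [← this]
  congr 1
  refine intervalIntegral.integral_congr fun τ hτ => ?_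
  rw [uIcc_of_le zero_le_one] at hτ
  simp [IccExtend_of_mem zero_le_one _ hτ, b, κ₁, κ₂]

/-- Local solutions of a smooth ordinary differential equation depend smoothly on time and on a
parameter. -/
theorem exists_smooth_local_solution {E : Type u} [NormedAddCommGroup E] [NormedSpace ℝ E]
    [CompleteSpace E] {F : E × ℝ × ℝ → E} (hF : ContDiff ℝ ∞ F) (z₀ : E) (x₀ y₀ : ℝ) :
    ∃ ζ : ℝ × ℝ → E, ζ (x₀, y₀) = z₀ ∧ ∀ᶠ p in 𝓝 (x₀, y₀), ContDiffAt ℝ ∞ ζ p ∧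
      HasDerivAt (fun x => ζ (x, p.2)) (F (ζ p, p)) p.1 := by
  let b : C(E × ℝ × ℝ, E) := ⟨F, hF.continuous⟩
  let ι : C(unitInterval, E) →L[ℝ] C(unitInterval, E × ℝ × ℝ) :=
    (ContinuousLinearMap.inl ℝ E (ℝ × ℝ)).compLeftContinuous ℝ unitInterval
  let κ₀ : C(unitInterval, E × ℝ × ℝ) := ContinuousMap.const _ (0, x₀, 0)
  let κ₁ : C(unitInterval, E × ℝ × ℝ) := ⟨fun s => (0, s, 0), by fun_prop⟩
  let κ₂ : C(unitInterval, E × ℝ × ℝ) := ContinuousMap.const _ (0, 0, 1)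
  let curve : (ℝ × ℝ) × C(unitInterval, E) → C(unitInterval, E × ℝ × ℝ) :=
    fun q => ι q.2 + κ₀ + q.1.1 • κ₁ + q.1.2 • κ₂
  have hcurve : ContDiff ℝ ∞ curve := by
    have : ContDiff ℝ ∞ (fun q : (ℝ × ℝ) × C(unitInterval, E) => ι q.2) :=
      ι.contDiff.comp contDiff_snd
    fun_prop
  have curve_apply : ∀ (ε y : ℝ) (z : C(unitInterval, E)) (s : unitInterval),
      curve ((ε, y), z) s = (z s, x₀ + ε * s, y) := by
    intro ε y z s
    simp [curve, ι, κ₀, κ₁, κ₂]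
  -- With time rescaled to `x₀ + εs`, `s ∈ [0, 1]`, the integral equation lives on a fixed interval
  -- and `ε` becomes a parameter. Its solutions are the zeros of `Ψ`.
  let Ψ : (ℝ × ℝ) × C(unitInterval, E) → C(unitInterval, E) := fun q =>
    q.2 - ContinuousMap.const _ z₀ - q.1.1 • ContinuousMap.primitive E (b.comp (curve q))
  have hΨ : ContDiff ℝ ∞ Ψ := by
    have h1 : ContDiff ℝ ∞ (fun q => ContinuousMap.primitive E (b.comp (curve q))) :=
      (ContinuousMap.primitive E).contDiff.comp
        ((ContinuousMap.contDiff_postcomp.{u, u} b hF).comp hcurve)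
    fun_prop
  have Ψ_eq : ∀ (ε y : ℝ) (z : C(unitInterval, E)), Ψ ((ε, y), z) = 0 ↔ ∀ s : unitInterval,
      z s = z₀ + ε • ∫ τ in (0 : ℝ)..s, F (IccExtend zero_le_one z τ, x₀ + ε * τ, y) := by
    intro ε y z
    rw [ContinuousMap.ext_iff]
    refine forall_congr' fun s => ?_
    have : ContinuousMap.primitive E (b.comp (curve ((ε, y), z))) s
        = ∫ τ in (0 : ℝ)..s, F (IccExtend zero_le_one z τ, x₀ + ε * τ, y) := by
      rw [ContinuousMap.primitive_apply]
      refine intervalIntegral.integral_congr fun τ hτ => ?_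
      rw [uIcc_of_le s.2.1] at hτ
      have hτ' : τ ∈ Icc (0 : ℝ) 1 := ⟨hτ.1, hτ.2.trans s.2.2⟩
      simp only [IccExtend_of_mem zero_le_one _ hτ', ContinuousMap.comp_apply, curve_apply]
      rfl
    simp only [Ψ, ContinuousMap.sub_apply, ContinuousMap.const_apply, ContinuousMap.smul_apply,
      this, ContinuousMap.zero_apply]
    rw [sub_sub, sub_eq_zero]
  set u : (ℝ × ℝ) × C(unitInterval, E) := ((0, y₀), ContinuousMap.const _ z₀) with hu_def
  have hΨu : Ψ u = 0 := by simp [Ψ, u]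
  -- At `ε = 0` the integral drops out and `Ψ` is a translation in the path variable, so its partial
  -- derivative is the identity.
  have hu : (fderiv ℝ Ψ u ∘L .inr ℝ (ℝ × ℝ) C(unitInterval, E)).IsInvertible := by
    refine ⟨ContinuousLinearEquiv.refl ℝ _, ?_⟩
    have h1 : HasFDerivAt (fun z : C(unitInterval, E) => Ψ ((0, y₀), z))
        (fderiv ℝ Ψ u ∘L .inr ℝ (ℝ × ℝ) C(unitInterval, E)) (ContinuousMap.const _ z₀) :=
      ((hΨ.differentiable (by simp) u).hasFDerivAt).comp _ (hasFDerivAt_prodMk_right _ _)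
    have h2 : HasFDerivAt (fun z : C(unitInterval, E) => Ψ ((0, y₀), z))
        (ContinuousLinearMap.id ℝ C(unitInterval, E)) (ContinuousMap.const _ z₀) := by
      have : (fun z : C(unitInterval, E) => Ψ ((0, y₀), z))
          = fun z => z - ContinuousMap.const _ z₀ := by
        ext1 z; simp [Ψ]
      rw [this]
      exact (hasFDerivAt_id _).sub_const _
    exact h2.unique h1
  set ψ := (hΨ.contDiffAt (x := u)).implicitFunction (by simp) hu with hψ
  have hsmooth : ∀ᶠ p in 𝓝 u.1, ContDiffAt ℝ ∞ ψ p :=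
    ContDiffAt.eventually_contDiffAt_implicitFunction hΨ hu
  have hψu : ψ u.1 = u.2 := (hΨ.contDiffAt (x := u)).implicitFunction_apply_self (by simp) hu
  have hsol : ∀ᶠ p in 𝓝 u.1, Ψ (p, ψ p) = 0 := by
    have := (hΨ.contDiffAt (x := u)).eventually_apply_implicitFunction (by simp) hu
    rwa [hΨu] at this
  have huniq : ∀ᶠ q in 𝓝 u, Ψ q = 0 → ψ q.1 = q.2 := by
    have := (hΨ.contDiffAt (x := u)).eventually_apply_eq_iff_implicitFunction (by simp) hu
    rw [hΨu] at this
    exact this.mono fun q hq => hq.1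
  obtain ⟨δ₁, hδ₁, hball₁⟩ := Metric.eventually_nhds_iff.1 huniq
  -- A reparametrised path takes only values of the original one, so it stays as close to the
  -- constant path. This keeps it inside the region where the implicit function theorem gives
  -- uniqueness.
  have hclose : ∀ᶠ p in 𝓝 u.1, dist (ψ p) u.2 < δ₁ := by
    have hc := hsmooth.self_of_nhds.continuousAt
    rw [ContinuousAt, hψu] at hc
    exact hc.eventually (Metric.ball_mem_nhds _ hδ₁)
  obtain ⟨δ₂, hδ₂, hball₂⟩ := Metric.eventually_nhds_iff.1 (hsmooth.and (hsol.and hclose))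
  set δ := min δ₁ δ₂ with hδ
  have hδpos : 0 < δ := lt_min hδ₁ hδ₂
  have hdist : ∀ ε y : ℝ, dist (ε, y) u.1 < δ ↔ |ε| < δ ∧ |y - y₀| < δ := by
    intro ε y
    simp [u, Prod.dist_eq, Real.dist_eq]
  -- the solutions on shorter time intervals are reparametrisations
  have hscale : ∀ ε y : ℝ, |ε| < δ → |y - y₀| < δ → ∀ s : unitInterval,
      ψ (ε * s, y) 1 = ψ (ε, y) s := by
    intro ε y hε hy s
    obtain ⟨-, h0, hcl⟩ := hball₂ (((hdist ε y).2 ⟨hε, hy⟩).trans_le (min_le_right _ _))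
    rw [Ψ_eq] at h0
    let w : C(unitInterval, E) := (ψ (ε, y)).comp ⟨fun σ => s * σ, by fun_prop⟩
    have hw : Ψ ((ε * s, y), w) = 0 := by
      rw [Ψ_eq]
      intro σ
      change ψ (ε, y) (s * σ) = _
      rw [h0, mul_smul]
      congr 2
      have := intervalIntegral.smul_integral_comp_mul_left
        (fun τ => F (IccExtend zero_le_one (ψ (ε, y)) τ, x₀ + ε * τ, y)) (a := 0) (b := σ) (s : ℝ)
      rw [mul_zero] at this
      rw [show ((s * σ : unitInterval) : ℝ) = s * σ from rfl, ← this]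
      congr 1
      refine intervalIntegral.integral_congr fun τ hτ => ?_
      rw [uIcc_of_le σ.2.1] at hτ
      have hτ' : τ ∈ Icc (0 : ℝ) 1 := ⟨hτ.1, hτ.2.trans σ.2.2⟩
      have hsτ : (s : ℝ) * τ ∈ Icc (0 : ℝ) 1 := (s * ⟨τ, hτ'⟩ : unitInterval).2
      simp only [IccExtend_of_mem zero_le_one _ hτ', IccExtend_of_mem zero_le_one _ hsτ, mul_assoc]
      rfl
    have h1 : dist ((ε * s, y), w) u < δ₁ := by
      rw [Prod.dist_eq]
      refine max_lt (((hdist (ε * s) y).2 ⟨?_, hy⟩).trans_le (min_le_left _ _)) ?_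
      · rw [abs_mul, abs_of_nonneg s.2.1]
        exact (mul_le_of_le_one_right (abs_nonneg _) s.2.2).trans_lt hε
      · refine lt_of_le_of_lt ((ContinuousMap.dist_le dist_nonneg).2 fun σ => ?_) hcl
        exact ContinuousMap.dist_apply_le_dist (f := ψ (ε, y)) (g := u.2) (s * σ)
    have h2 := hball₁ h1 hw
    change ψ (ε * s, y) = w at h2
    rw [h2]
    simp [w]
  -- By rescaling, the endpoint `ψ (σ, y) 1` describes the whole trajectory as `σ` varies, and so
  -- satisfies the integral equation in unscaled time.
  have hinteq : ∀ ε y : ℝ, |ε| < δ → |y - y₀| < δ →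
      ψ (ε, y) 1 = z₀ + ∫ σ in (0 : ℝ)..ε, F (ψ (σ, y) 1, x₀ + σ, y) := by
    intro ε y hε hy
    obtain ⟨-, h0, -⟩ := hball₂ (((hdist ε y).2 ⟨hε, hy⟩).trans_le (min_le_right _ _))
    rw [Ψ_eq] at h0
    rw [h0 1]
    have := intervalIntegral.smul_integral_comp_mul_left
      (fun σ => F (ψ (σ, y) 1, x₀ + σ, y)) (a := 0) (b := 1) ε
    rw [mul_zero, mul_one] at this
    rw [← this]
    congr 2
    refine intervalIntegral.integral_congr fun τ hτ => ?_
    rw [Icc.coe_one, uIcc_of_le zero_le_one] at hτ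
    simp only [IccExtend_of_mem zero_le_one _ hτ]
    rw [← hscale ε y hε hy ⟨τ, hτ⟩]
  refine ⟨fun p => ψ (p.1 - x₀, p.2) 1, ?_, ?_⟩
  · have : ψ (0, y₀) = ContinuousMap.const _ z₀ := hψu
    simp [this]
  · rw [Metric.eventually_nhds_iff]
    refine ⟨δ, hδpos, ?_⟩
    rintro ⟨x, y⟩ hp
    rw [Prod.dist_eq, max_lt_iff, Real.dist_eq, Real.dist_eq] at hp
    obtain ⟨hx, hy⟩ := hp
    have hC : ∀ ε : ℝ, |ε| < δ → ContDiffAt ℝ ∞ (fun p : ℝ × ℝ => ψ p 1) (ε, y) := fun ε hε =>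
      (ContinuousMap.contDiff_eval (1 : unitInterval)).contDiffAt.comp _
        (hball₂ (((hdist ε y).2 ⟨hε, hy⟩).trans_le (min_le_right _ _))).1
    refine ⟨?_, ?_⟩
    · exact ContDiffAt.comp (x, y) (f := fun p : ℝ × ℝ => (p.1 - x₀, p.2)) (hC _ hx) (by fun_prop)
    · have hcont : ContinuousOn (fun σ => F (ψ (σ, y) 1, x₀ + σ, y)) (Ioo (-δ) δ) := by
        intro σ hσ
        have h1 : ContinuousAt (fun σ => ψ (σ, y) 1) σ :=
          ContinuousAt.comp (f := fun σ => (σ, y)) (hC σ (abs_lt.2 hσ)).continuousAt (by fun_prop)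
        exact (hF.continuous.continuousAt.comp
          (h1.prodMk (by fun_prop : ContinuousAt (fun σ => (x₀ + σ, y)) σ))).continuousWithinAt
      have hmem : x - x₀ ∈ Ioo (-δ) δ := abs_lt.1 hx
      have hopen : Ioo (-δ) δ ∈ 𝓝 (x - x₀) := isOpen_Ioo.mem_nhds hmem
      have h1 : HasDerivAt (fun ε => ∫ σ in (0 : ℝ)..ε, F (ψ (σ, y) 1, x₀ + σ, y))
          (F (ψ (x - x₀, y) 1, x₀ + (x - x₀), y)) (x - x₀) := by
        refine intervalIntegral.integral_hasDerivAt_right ?_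
          (hcont.stronglyMeasurableAtFilter isOpen_Ioo _ hmem) (hcont.continuousAt hopen)
        refine (hcont.mono ?_).intervalIntegrable
        exact (ordConnected_Ioo).uIcc_subset ⟨by linarith, hδpos⟩ hmem
      have h2 : HasDerivAt (fun ε => ψ (ε, y) 1)
          (F (ψ (x - x₀, y) 1, x₀ + (x - x₀), y)) (x - x₀) := by
        refine (h1.const_add z₀).congr_of_eventuallyEq ?_
        filter_upwards [hopen] with ε hε
        exact hinteq ε y (abs_lt.2 hε) hy
      have h3 := h2.comp_sub_const x x₀
      rwa [add_sub_cancel] at h3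

/-! ### Lie groups in the preferred chart at the identity -/

section Chart

variable {V : Type*} [NormedAddCommGroup V] [NormedSpace ℝ V]
  {G : Type*} [TopologicalSpace G] [ChartedSpace V G] [Group G]

variable (V G) in
/-- The preferred chart of a Lie group at the identity. -/
def oneChart : PartialEquiv G V :=
  extChartAt 𝓘(ℝ, V) (1 : G)

/-- The velocity, in the preferred chart at `1`, of a curve. It is used for curves passing through
`1` at time `s`, and is then an element of the Lie algebra. -/
def velocity (c : ℝ → G) (s : ℝ) : V :=
  deriv (fun τ => oneChart V G (c τ)) s

variable (V G) in
/-- The multiplication of a Lie group read in the preferred chart at `1`. -/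
def chartMul (q : V × V) : V :=
  oneChart V G ((oneChart V G).symm q.1 * (oneChart V G).symm q.2)

variable (V G) in
lemma one_mem_oneChart_source : (1 : G) ∈ (oneChart V G).source :=
  mem_extChartAt_source (I := 𝓘(ℝ, V)) (1 : G)

variable (V G) in
lemma oneChart_source_mem_nhds : (oneChart V G).source ∈ 𝓝 (1 : G) :=
  extChartAt_source_mem_nhds (I := 𝓘(ℝ, V)) (1 : G)

variable (V G) in
lemma oneChart_target_mem_nhds : (oneChart V G).target ∈ 𝓝 (oneChart V G 1) :=
  extChartAt_target_mem_nhds (I := 𝓘(ℝ, V)) (1 : G)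

variable (V G) in
@[simp]
lemma oneChart_symm_one : (oneChart V G).symm (oneChart V G 1) = 1 :=
  (oneChart V G).left_inv (one_mem_oneChart_source V G)

variable (V G) in
lemma isOpen_oneChart_source : IsOpen (oneChart V G).source :=
  isOpen_extChartAt_source (I := 𝓘(ℝ, V)) (1 : G)

variable (V G) in
lemma isOpen_oneChart_target : IsOpen (oneChart V G).target :=
  isOpen_extChartAt_target (I := 𝓘(ℝ, V)) (1 : G)

variable [LieGroup 𝓘(ℝ, V) ∞ G]

lemma contMDiffAt_oneChart {k : G} (hk : k ∈ (oneChart V G).source) :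
    ContMDiffAt 𝓘(ℝ, V) 𝓘(ℝ, V) ∞ (oneChart V G) k :=
  haveI : IsManifold 𝓘(ℝ, V) ∞ G := inferInstance
  contMDiffAt_extChartAt' (by rwa [oneChart, extChartAt_source] at hk)

lemma contMDiffAt_oneChart_symm {z : V} (hz : z ∈ (oneChart V G).target) :
    ContMDiffAt 𝓘(ℝ, V) 𝓘(ℝ, V) ∞ (oneChart V G).symm z :=
  (contMDiffOn_extChartAt_symm (I := 𝓘(ℝ, V)) (1 : G)).contMDiffAt
    ((isOpen_oneChart_target V G).mem_nhds hz)

section NormedParameter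

variable {E : Type*} [NormedAddCommGroup E] [NormedSpace ℝ E]

lemma ContMDiffAt.contDiffAt_oneChart {c : E → G} {p : E}
    (hc : ContMDiffAt 𝓘(ℝ, E) 𝓘(ℝ, V) ∞ c p) (hp : c p ∈ (oneChart V G).source) :
    ContDiffAt ℝ ∞ (fun q => oneChart V G (c q)) p :=
  contMDiffAt_iff_contDiffAt.1 ((contMDiffAt_oneChart hp).comp p hc)

lemma mfderiv_eq_fderiv_oneChart {c : E → G} {p : E}
    (hc : ContMDiffAt 𝓘(ℝ, E) 𝓘(ℝ, V) ∞ c p) (hp : c p = 1) (v : E) :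
    (mfderiv 𝓘(ℝ, E) 𝓘(ℝ, V) c p v : V) = fderiv ℝ (fun q => oneChart V G (c q)) p v := by
  have h := hc.mdifferentiableAt (by simp)
  rw [h.mfderiv]
  simp [writtenInExtChartAt, hp, oneChart, Function.comp_def]
  rfl

end NormedParameter

lemma velocity_comp {U : Type*} [NormedAddCommGroup U] [NormedSpace ℝ U]
    {H : Type*} [TopologicalSpace H] [ChartedSpace U H] [Group H] [LieGroup 𝓘(ℝ, U) ∞ H]
    {ψ : G → H} (hψ : ContMDiffAt 𝓘(ℝ, V) 𝓘(ℝ, U) ∞ ψ 1) (hψ1 : ψ 1 = 1) {c : ℝ → G} {s : ℝ}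
    (hc : ContMDiffAt 𝓘(ℝ, ℝ) 𝓘(ℝ, V) ∞ c s) (hs : c s = 1) :
    velocity (V := U) (fun τ => ψ (c τ)) s
      = (mfderiv 𝓘(ℝ, V) 𝓘(ℝ, U) ψ 1 (velocity (V := V) c s) : U) := by
  have h1 : (mfderiv 𝓘(ℝ, ℝ) 𝓘(ℝ, V) c s (1 : ℝ) : V) = velocity (V := V) c s :=
    mfderiv_eq_fderiv_oneChart hc hs 1
  have hψ' : ContMDiffAt 𝓘(ℝ, V) 𝓘(ℝ, U) ∞ ψ (c s) := by rwa [hs]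
  have h2 : (mfderiv 𝓘(ℝ, ℝ) 𝓘(ℝ, U) (fun τ => ψ (c τ)) s (1 : ℝ) : U)
      = velocity (V := U) (fun τ => ψ (c τ)) s :=
    mfderiv_eq_fderiv_oneChart (hψ'.comp s hc) (by simp [hs, hψ1]) 1
  have h3 : mfderiv 𝓘(ℝ, ℝ) 𝓘(ℝ, U) (fun τ => ψ (c τ)) s
      = (mfderiv 𝓘(ℝ, V) 𝓘(ℝ, U) ψ (c s)).comp (mfderiv 𝓘(ℝ, ℝ) 𝓘(ℝ, V) c s) :=
    mfderiv_comp s (hψ'.mdifferentiableAt (by simp)) (hc.mdifferentiableAt (by simp))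
  -- The tangent spaces depend on the base point, so `c s = 1` is used by substitution for a
  -- variable `k` rather than by rewriting.
  have h4 : ∀ k : G, k = 1 → ∀ w : V, (mfderiv 𝓘(ℝ, V) 𝓘(ℝ, U) ψ k w : U)
      = (mfderiv 𝓘(ℝ, V) 𝓘(ℝ, U) ψ 1 w : U) := by
    rintro _ rfl w
    rfl
  rw [← h2, ← h1, h3]
  exact h4 (c s) hs _

/-- By the chain rule the translation may be applied to the curve before differentiating. The
translated curve passes through `1`, so a single chart suffices for all logarithmic derivatives. -/
lemma rightLogDeriv_eq_velocity {c : ℝ → G} {s : ℝ} (hc : ContMDiffAt 𝓘(ℝ, ℝ) 𝓘(ℝ, V) ∞ c s) :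
    (rightLogDeriv (V := V) c s : V) = velocity (V := V) (fun τ => c τ * (c s)⁻¹) s := by
  have hR : ContMDiffAt 𝓘(ℝ, V) 𝓘(ℝ, V) ∞ (fun k : G => k * (c s)⁻¹) (c s) :=
    contMDiffAt_id.mul contMDiffAt_const
  have h2 : (mfderiv 𝓘(ℝ, ℝ) 𝓘(ℝ, V) (fun τ => c τ * (c s)⁻¹) s (1 : ℝ) : V)
      = velocity (V := V) (fun τ => c τ * (c s)⁻¹) s :=
    mfderiv_eq_fderiv_oneChart (hR.comp s hc) (by simp) 1
  have h3 : mfderiv 𝓘(ℝ, ℝ) 𝓘(ℝ, V) (fun τ => c τ * (c s)⁻¹) s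
      = (mfderiv 𝓘(ℝ, V) 𝓘(ℝ, V) (fun k : G => k * (c s)⁻¹) (c s)).comp
        (mfderiv 𝓘(ℝ, ℝ) 𝓘(ℝ, V) c s) :=
    mfderiv_comp s (hR.mdifferentiableAt (by simp)) (hc.mdifferentiableAt (by simp))
  rw [← h2, h3]
  rfl

lemma leftLogDeriv_eq_velocity {c : ℝ → G} {s : ℝ} (hc : ContMDiffAt 𝓘(ℝ, ℝ) 𝓘(ℝ, V) ∞ c s) :
    (leftLogDeriv (V := V) c s : V) = velocity (V := V) (fun τ => (c s)⁻¹ * c τ) s := by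
  have hR : ContMDiffAt 𝓘(ℝ, V) 𝓘(ℝ, V) ∞ (fun k : G => (c s)⁻¹ * k) (c s) :=
    contMDiffAt_const.mul contMDiffAt_id
  have h2 : (mfderiv 𝓘(ℝ, ℝ) 𝓘(ℝ, V) (fun τ => (c s)⁻¹ * c τ) s (1 : ℝ) : V)
      = velocity (V := V) (fun τ => (c s)⁻¹ * c τ) s :=
    mfderiv_eq_fderiv_oneChart (hR.comp s hc) (by simp) 1
  have h3 : mfderiv 𝓘(ℝ, ℝ) 𝓘(ℝ, V) (fun τ => (c s)⁻¹ * c τ) s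
      = (mfderiv 𝓘(ℝ, V) 𝓘(ℝ, V) (fun k : G => (c s)⁻¹ * k) (c s)).comp
        (mfderiv 𝓘(ℝ, ℝ) 𝓘(ℝ, V) c s) :=
    mfderiv_comp s (hR.mdifferentiableAt (by simp)) (hc.mdifferentiableAt (by simp))
  rw [← h2, h3]
  rfl

end Chart

/-! ### Mixed second partial derivatives -/

section MixedPartial

lemma two_le_infty : minSmoothness ℝ 2 ≤ (∞ : WithTop ℕ∞) := by
  rw [minSmoothness_of_isRCLikeNormedField]
  exact WithTop.coe_le_coe.2 (le_top : (2 : ℕ∞) ≤ ⊤)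

variable {F : Type*} [NormedAddCommGroup F] [NormedSpace ℝ F]

/-- The mixed second partial derivative of a function of two real variables. -/
def mixedPartial (K : ℝ × ℝ → F) (p : ℝ × ℝ) : F :=
  fderiv ℝ (fderiv ℝ K) p (1, 0) (0, 1)

lemma ContDiffAt.hasFDerivAt_fderiv {E : Type*} [NormedAddCommGroup E] [NormedSpace ℝ E]
    {K : E → F} {p : E} (hK : ContDiffAt ℝ ∞ K p) :
    HasFDerivAt (fderiv ℝ K) (fderiv ℝ (fderiv ℝ K) p) p :=
  ((hK.fderiv_right (m := ∞) (by simp)).differentiableAt (by simp)).hasFDerivAt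

lemma ContDiffAt.eventually_differentiableAt {E : Type*} [NormedAddCommGroup E] [NormedSpace ℝ E]
    {K : E → F} {p : E} (hK : ContDiffAt ℝ ∞ K p) : ∀ᶠ q in 𝓝 p, DifferentiableAt ℝ K q := by
  have : ContDiffAt ℝ 1 K p := hK.of_le (by simp)
  exact (this.eventually (by simp)).mono fun q hq => hq.differentiableAt (by simp)

lemma hasDerivAt_mk_left (x y : ℝ) : HasDerivAt (fun ξ : ℝ => (ξ, y)) ((1 : ℝ), (0 : ℝ)) x :=
  (hasDerivAt_id x).prodMk (hasDerivAt_const x y)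

lemma hasDerivAt_mk_right (x y : ℝ) : HasDerivAt (fun η : ℝ => (x, η)) ((0 : ℝ), (1 : ℝ)) y :=
  (hasDerivAt_const y x).prodMk (hasDerivAt_id y)

lemma DifferentiableAt.hasDerivAt_left {K : ℝ × ℝ → F} {x y : ℝ}
    (hK : DifferentiableAt ℝ K (x, y)) :
    HasDerivAt (fun ξ => K (ξ, y)) (fderiv ℝ K (x, y) (1, 0)) x :=
  hK.hasFDerivAt.comp_hasDerivAt x (hasDerivAt_mk_left x y)

lemma DifferentiableAt.hasDerivAt_right {K : ℝ × ℝ → F} {x y : ℝ}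
    (hK : DifferentiableAt ℝ K (x, y)) :
    HasDerivAt (fun η => K (x, η)) (fderiv ℝ K (x, y) (0, 1)) y :=
  hK.hasFDerivAt.comp_hasDerivAt y (hasDerivAt_mk_right x y)

lemma ContDiffAt.hasDerivAt_deriv_right {K : ℝ × ℝ → F} {x y : ℝ}
    (hK : ContDiffAt ℝ ∞ K (x, y)) :
    HasDerivAt (fun ξ => deriv (fun η => K (ξ, η)) y) (mixedPartial K (x, y)) x := by
  have h1 : HasDerivAt (fun ξ => fderiv ℝ K (ξ, y) (0, 1)) (mixedPartial K (x, y)) x := by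
    have h0 : HasDerivAt (fun ξ => fderiv ℝ K (ξ, y)) (fderiv ℝ (fderiv ℝ K) (x, y) (1, 0)) x :=
      hK.hasFDerivAt_fderiv.comp_hasDerivAt x (hasDerivAt_mk_left x y)
    exact (ContinuousLinearMap.apply ℝ F ((0 : ℝ), (1 : ℝ))).hasFDerivAt.comp_hasDerivAt x h0
  refine h1.congr_of_eventuallyEq ?_
  have hc : ContinuousAt (fun ξ : ℝ => (ξ, y)) x := by fun_prop
  filter_upwards [hc.eventually hK.eventually_differentiableAt] with ξ hξ
  exact hξ.hasDerivAt_right.deriv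

/-- Symmetry of the second derivative allows either order of differentiation; this makes the two
expressions for `B_{xy}` agree. -/
lemma ContDiffAt.hasDerivAt_deriv_left {K : ℝ × ℝ → F} {x y : ℝ}
    (hK : ContDiffAt ℝ ∞ K (x, y)) :
    HasDerivAt (fun η => deriv (fun ξ => K (ξ, η)) x) (mixedPartial K (x, y)) y := by
  have hsymm : fderiv ℝ (fderiv ℝ K) (x, y) (1, 0) (0, 1)
      = fderiv ℝ (fderiv ℝ K) (x, y) (0, 1) (1, 0) :=
    (hK.isSymmSndFDerivAt two_le_infty).eq _ _
  have h1 : HasDerivAt (fun η => fderiv ℝ K (x, η) (1, 0)) (mixedPartial K (x, y)) y := by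
    have h0 : HasDerivAt (fun η => fderiv ℝ K (x, η)) (fderiv ℝ (fderiv ℝ K) (x, y) (0, 1)) y :=
      hK.hasFDerivAt_fderiv.comp_hasDerivAt y (hasDerivAt_mk_right x y)
    rw [mixedPartial, hsymm]
    exact (ContinuousLinearMap.apply ℝ F ((1 : ℝ), (0 : ℝ))).hasFDerivAt.comp_hasDerivAt y h0
  refine h1.congr_of_eventuallyEq ?_
  have hc : ContinuousAt (fun η : ℝ => (x, η)) y := by fun_prop
  filter_upwards [hc.eventually hK.eventually_differentiableAt] with η hη
  exact hη.hasDerivAt_left.deriv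

lemma mixedPartial_comp {E : Type*} [NormedAddCommGroup E] [NormedSpace ℝ E] {μ : E → F}
    {κ : ℝ × ℝ → E} {p : ℝ × ℝ} (hμ : ContDiffAt ℝ ∞ μ (κ p)) (hκ : ContDiffAt ℝ ∞ κ p) :
    mixedPartial (fun q => μ (κ q)) p
      = fderiv ℝ (fderiv ℝ μ) (κ p) (fderiv ℝ κ p (1, 0)) (fderiv ℝ κ p (0, 1))
        + fderiv ℝ μ (κ p) (mixedPartial κ p) := by
  have h1 : HasFDerivAt (fun q => (fderiv ℝ μ (κ q)).comp (fderiv ℝ κ q)) _ p :=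
    (hμ.hasFDerivAt_fderiv.comp p (hκ.differentiableAt (by simp)).hasFDerivAt).clm_comp
      hκ.hasFDerivAt_fderiv
  have h2 : fderiv ℝ (fun q => μ (κ q)) =ᶠ[𝓝 p]
      fun q => (fderiv ℝ μ (κ q)).comp (fderiv ℝ κ q) := by
    filter_upwards [hκ.continuousAt.eventually hμ.eventually_differentiableAt,
      hκ.eventually_differentiableAt] with q hq1 hq2
    exact fderiv_comp q hq1 hq2
  rw [mixedPartial, h2.fderiv_eq, h1.fderiv]
  simp [mixedPartial, add_comm]

end MixedPartial

/-! ### The second order expansion of the multiplication -/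

section ChartMul

variable {V : Type*} [NormedAddCommGroup V] [NormedSpace ℝ V]
  {G : Type*} [TopologicalSpace G] [ChartedSpace V G] [Group G]

lemma chartMul_one_left {w : V} (hw : w ∈ (oneChart V G).target) :
    chartMul V G (oneChart V G 1, w) = w := by
  simp [chartMul, (oneChart V G).right_inv hw]

lemma chartMul_one_right {z : V} (hz : z ∈ (oneChart V G).target) :
    chartMul V G (z, oneChart V G 1) = z := by
  simp [chartMul, (oneChart V G).right_inv hz]

lemma oneChart_mul_eq {k l : G} (hk : k ∈ (oneChart V G).source)
    (hl : l ∈ (oneChart V G).source) :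
    oneChart V G (k * l) = chartMul V G (oneChart V G k, oneChart V G l) := by
  simp only [chartMul, (oneChart V G).left_inv hk, (oneChart V G).left_inv hl]

variable [LieGroup 𝓘(ℝ, V) ∞ G]

lemma contDiffAt_chartMul {q : V × V} (h1 : q.1 ∈ (oneChart V G).target)
    (h2 : q.2 ∈ (oneChart V G).target)
    (h : (oneChart V G).symm q.1 * (oneChart V G).symm q.2 ∈ (oneChart V G).source) :
    ContDiffAt ℝ ∞ (chartMul V G) q := by
  have h3 : ContMDiffAt 𝓘(ℝ, V × V) 𝓘(ℝ, V) ∞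
      (fun q : V × V => (oneChart V G).symm q.1) q :=
    (contMDiffAt_oneChart_symm h1).comp q contDiffAt_fst.contMDiffAt
  have h4 : ContMDiffAt 𝓘(ℝ, V × V) 𝓘(ℝ, V) ∞
      (fun q : V × V => (oneChart V G).symm q.2) q :=
    (contMDiffAt_oneChart_symm h2).comp q contDiffAt_snd.contMDiffAt
  exact (h3.mul h4).contDiffAt_oneChart h

lemma contDiffAt_chartMul_left {z : V} (hz : z ∈ (oneChart V G).target) :
    ContDiffAt ℝ ∞ (chartMul V G) (z, oneChart V G 1) :=
  contDiffAt_chartMul hz (mem_of_mem_nhds (oneChart_target_mem_nhds V G))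
    (by simpa using (oneChart V G).map_target hz)

lemma contDiffAt_chartMul_right {w : V} (hw : w ∈ (oneChart V G).target) :
    ContDiffAt ℝ ∞ (chartMul V G) (oneChart V G 1, w) :=
  contDiffAt_chartMul (mem_of_mem_nhds (oneChart_target_mem_nhds V G)) hw
    (by simpa using (oneChart V G).map_target hw)

variable (V G) in
lemma contDiffAt_chartMul_one :
    ContDiffAt ℝ ∞ (chartMul V G) (oneChart V G 1, oneChart V G 1) :=
  contDiffAt_chartMul_left (mem_of_mem_nhds (oneChart_target_mem_nhds V G))

lemma fderiv_chartMul_left {z : V} (hz : z ∈ (oneChart V G).target) (A : V) :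
    fderiv ℝ (chartMul V G) (z, oneChart V G 1) (A, 0) = A := by
  have h1 : HasFDerivAt (fun w => chartMul V G (w, oneChart V G 1))
      ((fderiv ℝ (chartMul V G) (z, oneChart V G 1)).comp (.inl ℝ V V)) z :=
    ((contDiffAt_chartMul_left hz).differentiableAt (by simp)).hasFDerivAt.comp z
      (f := fun w => (w, oneChart V G 1)) (hasFDerivAt_prodMk_left z _)
  have h2 : HasFDerivAt (fun w => chartMul V G (w, oneChart V G 1))
      (ContinuousLinearMap.id ℝ V) z := by
    refine (hasFDerivAt_id z).congr_of_eventuallyEq ?_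
    filter_upwards [(isOpen_oneChart_target V G).mem_nhds hz] with w hw
    exact chartMul_one_right hw
  simpa using congrArg (fun L => L A) (h1.unique h2)

lemma fderiv_chartMul_right {w : V} (hw : w ∈ (oneChart V G).target) (B : V) :
    fderiv ℝ (chartMul V G) (oneChart V G 1, w) (0, B) = B := by
  have h1 : HasFDerivAt (fun z => chartMul V G (oneChart V G 1, z))
      ((fderiv ℝ (chartMul V G) (oneChart V G 1, w)).comp (.inr ℝ V V)) w :=
    ((contDiffAt_chartMul_right hw).differentiableAt (by simp)).hasFDerivAt.comp w
      (hasFDerivAt_prodMk_right _ w)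
  have h2 : HasFDerivAt (fun z => chartMul V G (oneChart V G 1, z))
      (ContinuousLinearMap.id ℝ V) w := by
    refine (hasFDerivAt_id w).congr_of_eventuallyEq ?_
    filter_upwards [(isOpen_oneChart_target V G).mem_nhds hw] with z hz
    exact chartMul_one_left hz
  simpa using congrArg (fun L => L B) (h1.unique h2)

lemma fderiv_chartMul_one (A B : V) :
    fderiv ℝ (chartMul V G) (oneChart V G 1, oneChart V G 1) (A, B) = A + B := by
  have h := mem_of_mem_nhds (oneChart_target_mem_nhds V G)
  have : (A, B) = (A, (0 : V)) + ((0 : V), B) := by simp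
  rw [this, map_add, fderiv_chartMul_left h, fderiv_chartMul_right h]

variable (V G) in
/-- The bilinear part of the multiplication at the identity, in the preferred chart at `1`. -/
def chartMulBilin (A B : V) : V :=
  fderiv ℝ (fderiv ℝ (chartMul V G)) (oneChart V G 1, oneChart V G 1) (A, 0) (0, B)

/-- Multiplication by `1` is the identity in the chart, so along this slice the first derivative is
constant. With the analogous fact for the other factor, only the mixed block `chartMulBilin` of the
second derivative survives. -/
lemma fderiv_fderiv_chartMul_left (A B : V) :
    fderiv ℝ (fderiv ℝ (chartMul V G)) (oneChart V G 1, oneChart V G 1) (A, 0) (B, 0) = 0 := by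
  have h1 : HasFDerivAt (fun z => fderiv ℝ (chartMul V G) (z, oneChart V G 1) (B, 0))
      ((ContinuousLinearMap.apply ℝ V (B, (0 : V))).comp
        ((fderiv ℝ (fderiv ℝ (chartMul V G)) (oneChart V G 1, oneChart V G 1)).comp
          (.inl ℝ V V))) (oneChart V G 1) :=
    (ContinuousLinearMap.apply ℝ V (B, (0 : V))).hasFDerivAt.comp _
      ((contDiffAt_chartMul_one V G).hasFDerivAt_fderiv.comp _
        (f := fun z => (z, oneChart V G 1)) (hasFDerivAt_prodMk_left _ _))
  have h2 : HasFDerivAt (fun z => fderiv ℝ (chartMul V G) (z, oneChart V G 1) (B, 0))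
      (0 : V →L[ℝ] V) (oneChart V G 1) := by
    refine (hasFDerivAt_const B _).congr_of_eventuallyEq ?_
    filter_upwards [oneChart_target_mem_nhds V G] with z hz
    exact fderiv_chartMul_left hz B
  simpa using congrArg (fun L => L A) (h1.unique h2)

lemma fderiv_fderiv_chartMul_right (A B : V) :
    fderiv ℝ (fderiv ℝ (chartMul V G)) (oneChart V G 1, oneChart V G 1) (0, A) (0, B) = 0 := by
  have h1 : HasFDerivAt (fun z => fderiv ℝ (chartMul V G) (oneChart V G 1, z) (0, B))
      ((ContinuousLinearMap.apply ℝ V ((0 : V), B)).comp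
        ((fderiv ℝ (fderiv ℝ (chartMul V G)) (oneChart V G 1, oneChart V G 1)).comp
          (.inr ℝ V V))) (oneChart V G 1) :=
    (ContinuousLinearMap.apply ℝ V ((0 : V), B)).hasFDerivAt.comp _
      ((contDiffAt_chartMul_one V G).hasFDerivAt_fderiv.comp _
        (f := fun z => (oneChart V G 1, z)) (hasFDerivAt_prodMk_right _ _))
  have h2 : HasFDerivAt (fun z => fderiv ℝ (chartMul V G) (oneChart V G 1, z) (0, B))
      (0 : V →L[ℝ] V) (oneChart V G 1) := by
    refine (hasFDerivAt_const B _).congr_of_eventuallyEq ?_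
    filter_upwards [oneChart_target_mem_nhds V G] with z hz
    exact fderiv_chartMul_right hz B
  simpa using congrArg (fun L => L A) (h1.unique h2)

lemma fderiv_fderiv_chartMul (A A' B B' : V) :
    fderiv ℝ (fderiv ℝ (chartMul V G)) (oneChart V G 1, oneChart V G 1) (A, A') (B, B')
      = chartMulBilin V G A B' + chartMulBilin V G B A' := by
  have hsymm : fderiv ℝ (fderiv ℝ (chartMul V G)) (oneChart V G 1, oneChart V G 1) (0, A') (B, 0)
      = chartMulBilin V G B A' :=
    ((contDiffAt_chartMul_one V G).isSymmSndFDerivAt two_le_infty).eq _ _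
  have hA : (A, A') = (A, (0 : V)) + ((0 : V), A') := by simp
  have hB : (B, B') = (B, (0 : V)) + ((0 : V), B') := by simp
  rw [hA, hB]
  simp only [map_add, add_apply, fderiv_fderiv_chartMul_left,
    fderiv_fderiv_chartMul_right, hsymm, zero_add, add_zero]
  exact add_comm _ _

/-- The mixed partial derivative of a product of two maps passing through `1`. -/
lemma mixedPartial_mul {K L : ℝ × ℝ → G} {p : ℝ × ℝ}
    (hK : ContMDiffAt 𝓘(ℝ, ℝ × ℝ) 𝓘(ℝ, V) ∞ K p) (hL : ContMDiffAt 𝓘(ℝ, ℝ × ℝ) 𝓘(ℝ, V) ∞ L p)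
    (hK1 : K p = 1) (hL1 : L p = 1) :
    mixedPartial (fun q => oneChart V G (K q * L q)) p
      = mixedPartial (fun q => oneChart V G (K q)) p + mixedPartial (fun q => oneChart V G (L q)) p
        + (chartMulBilin V G (fderiv ℝ (fun q => oneChart V G (K q)) p (1, 0))
            (fderiv ℝ (fun q => oneChart V G (L q)) p (0, 1))
          + chartMulBilin V G (fderiv ℝ (fun q => oneChart V G (K q)) p (0, 1))
            (fderiv ℝ (fun q => oneChart V G (L q)) p (1, 0))) := by
  have hk : ContDiffAt ℝ ∞ (fun q => oneChart V G (K q)) p :=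
    hK.contDiffAt_oneChart (by rw [hK1]; exact one_mem_oneChart_source V G)
  have hl : ContDiffAt ℝ ∞ (fun q => oneChart V G (L q)) p :=
    hL.contDiffAt_oneChart (by rw [hL1]; exact one_mem_oneChart_source V G)
  have hev : (fun q => oneChart V G (K q * L q)) =ᶠ[𝓝 p]
      fun q => chartMul V G (oneChart V G (K q), oneChart V G (L q)) := by
    have hs := oneChart_source_mem_nhds V G
    filter_upwards [hK.continuousAt.preimage_mem_nhds (by rwa [hK1]),
      hL.continuousAt.preimage_mem_nhds (by rwa [hL1])] with q h1 h2
    exact oneChart_mul_eq h1 h2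
  have hmix : mixedPartial (fun q => oneChart V G (K q * L q)) p
      = mixedPartial (fun q => chartMul V G (oneChart V G (K q), oneChart V G (L q))) p := by
    rw [mixedPartial, mixedPartial, (hev.fderiv).fderiv_eq]
  have hp : (oneChart V G (K p), oneChart V G (L p)) = (oneChart V G 1, oneChart V G 1) := by
    rw [hK1, hL1]
  have hd : ∀ v, fderiv ℝ (fun q => (oneChart V G (K q), oneChart V G (L q))) p v
      = (fderiv ℝ (fun q => oneChart V G (K q)) p v, fderiv ℝ (fun q => oneChart V G (L q)) p v) :=
    fun v => by
      rw [((hk.differentiableAt (by simp)).hasFDerivAt.prodMk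
        (hl.differentiableAt (by simp)).hasFDerivAt).fderiv]
      rfl
  have hm : mixedPartial (fun q => (oneChart V G (K q), oneChart V G (L q))) p
      = (mixedPartial (fun q => oneChart V G (K q)) p,
        mixedPartial (fun q => oneChart V G (L q)) p) := by
    have h1 := (hk.prodMk hl : ContDiffAt ℝ ∞ (fun q => (oneChart V G (K q),
      oneChart V G (L q))) (p.1, p.2)).hasDerivAt_deriv_right
    have hc : ContinuousAt (fun ξ : ℝ => (ξ, p.2)) p.1 := by fun_prop
    have h2 := (hk : ContDiffAt ℝ ∞ _ (p.1, p.2)).hasDerivAt_deriv_right.prodMk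
      (hl : ContDiffAt ℝ ∞ _ (p.1, p.2)).hasDerivAt_deriv_right
    refine h1.unique (h2.congr_of_eventuallyEq ?_)
    filter_upwards [hc.eventually hk.eventually_differentiableAt,
      hc.eventually hl.eventually_differentiableAt] with ξ h3 h4
    rw [(h3.hasDerivAt_right.prodMk h4.hasDerivAt_right).deriv, h3.hasDerivAt_right.deriv,
      h4.hasDerivAt_right.deriv]
  rw [hmix, mixedPartial_comp (by rw [hp]; exact contDiffAt_chartMul_one V G) (hk.prodMk hl), hp,
    hd, hd, hm, fderiv_fderiv_chartMul, fderiv_chartMul_one, add_comm]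

end ChartMul

/-! ### The Lie bracket in the chart -/

section Bracket

variable {V : Type*} [NormedAddCommGroup V] [NormedSpace ℝ V]
  {G : Type*} [TopologicalSpace G] [ChartedSpace V G] [Group G] [LieGroup 𝓘(ℝ, V) ∞ G]

/-- A left invariant vector field read in the preferred chart at `1`. -/
lemma mpullbackWithin_mulInvariantVectorField {z : V} (hz : z ∈ (oneChart V G).target)
    (A : GroupLieAlgebra 𝓘(ℝ, V) G) :
    (VectorField.mpullbackWithin 𝓘(ℝ, V) 𝓘(ℝ, V) (extChartAt 𝓘(ℝ, V) (1 : G)).symm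
      (mulInvariantVectorField A) (range 𝓘(ℝ, V)) z : V)
      = fderiv ℝ (chartMul V G) (z, oneChart V G 1) ((0 : V), (A : V)) := by
  have : IsManifold 𝓘(ℝ, V) 1 G := IsManifold.of_le (n := ∞) (by simp)
  set g : G := (extChartAt 𝓘(ℝ, V) (1 : G)).symm z with hg
  have hgs : g ∈ (oneChart V G).source := (oneChart V G).map_target hz
  -- Pulling back along the inverse chart applies the inverse of its derivative, that is, the
  -- derivative of the chart at `g`.
  have hinv : (mfderivWithin 𝓘(ℝ, V) 𝓘(ℝ, V) (extChartAt 𝓘(ℝ, V) (1 : G)).symm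
      (range 𝓘(ℝ, V)) z).inverse = mfderiv 𝓘(ℝ, V) 𝓘(ℝ, V) (extChartAt 𝓘(ℝ, V) (1 : G)) g :=
    ContinuousLinearMap.inverse_eq
      (mfderivWithin_extChartAt_symm_comp_mfderiv_extChartAt hz)
      (mfderiv_extChartAt_comp_mfderivWithin_extChartAt_symm hz)
  have hmul : ContMDiffAt 𝓘(ℝ, V) 𝓘(ℝ, V) ∞ (fun k : G => g * k) 1 :=
    contMDiffAt_const.mul contMDiffAt_id
  have hg1 : g * 1 ∈ (oneChart V G).source := by rwa [mul_one]
  have hφ : ContMDiffAt 𝓘(ℝ, V) 𝓘(ℝ, V) ∞ (oneChart V G) (g * 1) := contMDiffAt_oneChart hg1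
  have hcomp : mfderiv 𝓘(ℝ, V) 𝓘(ℝ, V) (fun k => oneChart V G (g * k)) (1 : G)
      = (mfderiv 𝓘(ℝ, V) 𝓘(ℝ, V) (oneChart V G) (g * 1)).comp
        (mfderiv 𝓘(ℝ, V) 𝓘(ℝ, V) (fun k : G => g * k) 1) :=
    mfderiv_comp (1 : G) (hφ.mdifferentiableAt (by simp)) (hmul.mdifferentiableAt (by simp))
  have hwritten : (mfderiv 𝓘(ℝ, V) 𝓘(ℝ, V) (fun k => oneChart V G (g * k)) (1 : G) A : V)
      = fderiv ℝ (fun w => chartMul V G (z, w)) (oneChart V G 1) A := by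
    have h := (hφ.comp (1 : G) hmul).mdifferentiableAt (by simp)
    have h' : MDifferentiableAt 𝓘(ℝ, V) 𝓘(ℝ, V) (fun k => oneChart V G (g * k)) (1 : G) := h
    rw [h'.mfderiv]
    simp [writtenInExtChartAt, Function.comp_def]
    rfl
  have hpart : fderiv ℝ (fun w => chartMul V G (z, w)) (oneChart V G 1) A
      = fderiv ℝ (chartMul V G) (z, oneChart V G 1) ((0 : V), (A : V)) := by
    have h1 : HasFDerivAt (fun w => chartMul V G (z, w))
        ((fderiv ℝ (chartMul V G) (z, oneChart V G 1)).comp (.inr ℝ V V)) (oneChart V G 1) :=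
      ((contDiffAt_chartMul_left hz).differentiableAt (by simp)).hasFDerivAt.comp _
        (f := fun w => (z, w)) (hasFDerivAt_prodMk_right z _)
    rw [h1.fderiv]
    rfl
  rw [← hpart, ← hwritten, hcomp]
  change ((mfderivWithin 𝓘(ℝ, V) 𝓘(ℝ, V) (extChartAt 𝓘(ℝ, V) (1 : G)).symm
      (range 𝓘(ℝ, V)) z).inverse (mfderiv 𝓘(ℝ, V) 𝓘(ℝ, V) (fun k : G => g * k) 1 A) : V) = _
  rw [hinv]
  have h4 : ∀ k : G, k = g → ∀ w : V,
      (mfderiv 𝓘(ℝ, V) 𝓘(ℝ, V) (extChartAt 𝓘(ℝ, V) (1 : G)) g w : V)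
      = (mfderiv 𝓘(ℝ, V) 𝓘(ℝ, V) (oneChart V G) k w : V) := by
    rintro _ rfl w
    rfl
  exact h4 (g * 1) (mul_one g) _

/-- The Lie bracket is the antisymmetrisation of the bilinear part of the multiplication. -/
theorem bracket_eq_chartMulBilin (A B : GroupLieAlgebra 𝓘(ℝ, V) G) :
    (⁅A, B⁆ : GroupLieAlgebra 𝓘(ℝ, V) G)
      = (chartMulBilin V G A B - chartMulBilin V G B A : V) := by
  have : IsManifold 𝓘(ℝ, V) 1 G := IsManifold.of_le (n := ∞) (by simp)
  let X : V → V → V := fun A z => fderiv ℝ (chartMul V G) (z, oneChart V G 1) ((0 : V), A)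
  have hX : ∀ A : GroupLieAlgebra 𝓘(ℝ, V) G, (VectorField.mpullbackWithin 𝓘(ℝ, V) 𝓘(ℝ, V)
      (extChartAt 𝓘(ℝ, V) (1 : G)).symm (mulInvariantVectorField A) (range 𝓘(ℝ, V)) : V → V)
      =ᶠ[𝓝 (oneChart V G 1)] X A := by
    intro A
    filter_upwards [oneChart_target_mem_nhds V G] with z hz
    exact mpullbackWithin_mulInvariantVectorField hz A
  have hXe : ∀ A : V, X A (oneChart V G 1) = A := fun A =>
    fderiv_chartMul_right (mem_of_mem_nhds (oneChart_target_mem_nhds V G)) A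
  -- The field `X A` is the derivative of the multiplication in its right factor, so differentiating
  -- in the base point yields the mixed block.
  have hXd : ∀ A C : V, fderiv ℝ (X A) (oneChart V G 1) C = chartMulBilin V G C A := by
    intro A C
    have h1 : HasFDerivAt (X A)
        ((ContinuousLinearMap.apply ℝ V ((0 : V), A)).comp
          ((fderiv ℝ (fderiv ℝ (chartMul V G)) (oneChart V G 1, oneChart V G 1)).comp
            (.inl ℝ V V))) (oneChart V G 1) :=
      (ContinuousLinearMap.apply ℝ V ((0 : V), A)).hasFDerivAt.comp _
        ((contDiffAt_chartMul_one V G).hasFDerivAt_fderiv.comp _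
          (f := fun z => (z, oneChart V G 1)) (hasFDerivAt_prodMk_left _ _))
    rw [h1.fderiv]
    rfl
  have hlie : ∀ (C D : V) (Y Z : V → V), Y =ᶠ[𝓝 (oneChart V G 1)] X C →
      Z =ᶠ[𝓝 (oneChart V G 1)] X D → VectorField.lieBracketWithin ℝ Y Z univ (oneChart V G 1)
        = chartMulBilin V G C D - chartMulBilin V G D C := by
    intro C D Y Z hY hZ
    rw [VectorField.lieBracketWithin_univ, VectorField.lieBracket, hY.fderiv_eq, hZ.fderiv_eq,
      hY.eq_of_nhds, hZ.eq_of_nhds, hXe, hXe, hXd, hXd]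
  have hid : ∀ w : V, (ContinuousLinearMap.inverse
      (mfderiv 𝓘(ℝ, V) 𝓘(ℝ, V) (extChartAt 𝓘(ℝ, V) (1 : G)) 1 : V →L[ℝ] V)) w = w := by
    intro w
    have h : (mfderiv 𝓘(ℝ, V) 𝓘(ℝ, V) (extChartAt 𝓘(ℝ, V) (1 : G)) 1 : V →L[ℝ] V)
      = ContinuousLinearMap.id ℝ V := mfderiv_extChartAt_self
    exact (congrArg (fun L : V →L[ℝ] V => L.inverse w) h).trans (by simp)
  have hset : (extChartAt 𝓘(ℝ, V) (1 : G)).symm ⁻¹' univ ∩ range 𝓘(ℝ, V) = univ := by simp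
  rw [GroupLieAlgebra.bracket_def, VectorField.mlieBracket, VectorField.mlieBracketWithin_apply,
    hset]
  exact (hid _).trans (hlie A B _ _ (hX A) (hX B))

end Bracket

/-! ### Logarithmic derivatives, the adjoint action and uniqueness -/

section Velocity

variable {V : Type*} [NormedAddCommGroup V] [NormedSpace ℝ V]
  {G : Type*} [TopologicalSpace G] [ChartedSpace V G] [Group G]

lemma velocity_congr {c d : ℝ → G} {s : ℝ} (h : c =ᶠ[𝓝 s] d) :
    velocity (V := V) c s = velocity (V := V) d s :=
  (h.fun_comp (oneChart V G)).deriv_eq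

lemma velocity_const (k : G) (s : ℝ) : velocity (V := V) (fun _ => k) s = 0 := by
  simp [velocity]

variable (V) in
/-- The right logarithmic derivative of a curve, as a vector of the model space. -/
def rlog (c : ℝ → G) (s : ℝ) : V :=
  velocity (V := V) (fun τ => c τ * (c s)⁻¹) s

variable (V) in
/-- The left logarithmic derivative of a curve, as a vector of the model space. -/
def llog (c : ℝ → G) (s : ℝ) : V :=
  velocity (V := V) (fun τ => (c s)⁻¹ * c τ) s

lemma rlog_of_eq_one {c : ℝ → G} {s : ℝ} (h : c s = 1) : rlog V c s = velocity (V := V) c s := by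
  simp [rlog, h]

lemma rlog_const (k : G) (s : ℝ) : rlog V (fun _ => k) s = 0 :=
  velocity_const _ _

lemma rlog_mul_const (c : ℝ → G) (k : G) (s : ℝ) : rlog V (fun τ => c τ * k) s = rlog V c s := by
  simp [rlog, mul_assoc]

lemma rlog_congr {c d : ℝ → G} {s : ℝ} (h : c =ᶠ[𝓝 s] d) : rlog V c s = rlog V d s := by
  refine velocity_congr ?_
  rw [h.eq_of_nhds]
  filter_upwards [h] with τ hτ
  rw [hτ]

variable [LieGroup 𝓘(ℝ, V) ∞ G]

lemma hasDerivAt_velocity {c : ℝ → G} {s : ℝ} (hc : ContMDiffAt 𝓘(ℝ, ℝ) 𝓘(ℝ, V) ∞ c s)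
    (hs : c s = 1) : HasDerivAt (fun τ => oneChart V G (c τ)) (velocity (V := V) c s) s :=
  ((hc.contDiffAt_oneChart (by rw [hs]; exact one_mem_oneChart_source V G)).differentiableAt
    (by simp)).hasDerivAt

lemma velocity_mul {c d : ℝ → G} {s : ℝ} (hc : ContMDiffAt 𝓘(ℝ, ℝ) 𝓘(ℝ, V) ∞ c s)
    (hd : ContMDiffAt 𝓘(ℝ, ℝ) 𝓘(ℝ, V) ∞ d s) (hc1 : c s = 1) (hd1 : d s = 1) :
    velocity (V := V) (fun τ => c τ * d τ) s
      = velocity (V := V) c s + velocity (V := V) d s := by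
  have h1 := (hasDerivAt_velocity hc hc1).prodMk (hasDerivAt_velocity hd hd1)
  have h2 : HasFDerivAt (chartMul V G) (fderiv ℝ (chartMul V G) (oneChart V G 1, oneChart V G 1))
      (oneChart V G (c s), oneChart V G (d s)) := by
    rw [hc1, hd1]
    exact ((contDiffAt_chartMul_one V G).differentiableAt (by simp)).hasFDerivAt
  have h3 := h2.comp_hasDerivAt s h1
  rw [fderiv_chartMul_one] at h3
  refine (h3.congr_of_eventuallyEq ?_).deriv
  have hs := oneChart_source_mem_nhds V G
  filter_upwards [hc.continuousAt.preimage_mem_nhds (by rwa [hc1]),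
    hd.continuousAt.preimage_mem_nhds (by rwa [hd1])] with τ h4 h5
  exact oneChart_mul_eq h4 h5

lemma velocity_inv {c : ℝ → G} {s : ℝ} (hc : ContMDiffAt 𝓘(ℝ, ℝ) 𝓘(ℝ, V) ∞ c s)
    (hc1 : c s = 1) : velocity (V := V) (fun τ => (c τ)⁻¹) s = -velocity (V := V) c s := by
  have h := velocity_mul hc hc.inv hc1 (by simp [hc1])
  simp only [mul_inv_cancel, velocity_const] at h
  exact (neg_eq_of_add_eq_zero_right h.symm).symm

variable (V) in
/-- The adjoint action, as an endomorphism of the model space. -/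
def adjoint (k : G) : V →L[ℝ] V :=
  mfderiv 𝓘(ℝ, V) 𝓘(ℝ, V) (fun l : G => k * l * k⁻¹) 1

lemma contMDiff_conj (k : G) :
    ContMDiff 𝓘(ℝ, V) 𝓘(ℝ, V) ∞ (fun l : G => k * l * k⁻¹) :=
  (contMDiff_const.mul contMDiff_id).mul contMDiff_const

lemma velocity_conj (k : G) {c : ℝ → G} {s : ℝ} (hc : ContMDiffAt 𝓘(ℝ, ℝ) 𝓘(ℝ, V) ∞ c s)
    (hc1 : c s = 1) :
    velocity (V := V) (fun τ => k * c τ * k⁻¹) s = adjoint V k (velocity (V := V) c s) :=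
  velocity_comp (contMDiff_conj k).contMDiffAt (by simp) hc hc1

/-- Every vector of the model space is the velocity of a curve through `1`. -/
lemma exists_velocity_eq (A : V) : ∃ c : ℝ → G,
    ContMDiffAt 𝓘(ℝ, ℝ) 𝓘(ℝ, V) ∞ c 0 ∧ c 0 = 1 ∧ velocity (V := V) c 0 = A := by
  let γ : ℝ → V := fun τ => oneChart V G 1 + τ • A
  have hγ : ContDiff ℝ ∞ γ := by fun_prop
  have hγ0 : γ 0 = oneChart V G 1 := by simp [γ]
  have htarget := oneChart_target_mem_nhds V G
  refine ⟨fun τ => (oneChart V G).symm (γ τ), ?_, by simp [hγ0], ?_⟩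
  · refine ContMDiffAt.comp 0 (contMDiffAt_oneChart_symm ?_) hγ.contDiffAt.contMDiffAt
    rw [hγ0]
    exact mem_of_mem_nhds htarget
  · have h1 : HasDerivAt γ A 0 := by
      have := ((hasDerivAt_id (0 : ℝ)).smul_const A).const_add (oneChart V G 1)
      rwa [one_smul] at this
    refine (h1.congr_of_eventuallyEq ?_).deriv
    filter_upwards [hγ.continuous.continuousAt.preimage_mem_nhds (by rwa [hγ0])] with τ hτ
    exact (oneChart V G).right_inv hτ

/-- Every vector is a velocity, so an identity between differentials of homomorphisms can be checked
on curves, where it becomes an identity in the group. The same device serves for `ṁ` and `ṫ`. -/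
lemma adjoint_mul (k l : G) (A : V) : adjoint V (k * l) A = adjoint V k (adjoint V l A) := by
  obtain ⟨c, hc, hc1, rfl⟩ := exists_velocity_eq (G := G) A
  have h : ContMDiffAt 𝓘(ℝ, ℝ) 𝓘(ℝ, V) ∞ (fun τ => l * c τ * l⁻¹) 0 :=
    (contMDiffAt_const.mul hc).mul contMDiffAt_const
  rw [← velocity_conj _ hc hc1, ← velocity_conj _ hc hc1, ← velocity_conj _ h (by simp [hc1])]
  simp [mul_assoc]

@[simp]
lemma adjoint_one (A : V) : adjoint V (1 : G) A = A := by
  obtain ⟨c, hc, hc1, rfl⟩ := exists_velocity_eq (G := G) A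
  rw [← velocity_conj _ hc hc1]
  simp

lemma adjoint_injective (k : G) : Function.Injective (adjoint V k) := by
  intro A B h
  have := congrArg (adjoint V k⁻¹) h
  simpa [← adjoint_mul] using this

/-- After right translation to `1`, the product curve factors as `c τ (c s)⁻¹` times the conjugate
by `c s` of `d τ (d s)⁻¹`, two curves through `1` whose velocities add. -/
lemma rlog_mul {c d : ℝ → G} {s : ℝ} (hc : ContMDiffAt 𝓘(ℝ, ℝ) 𝓘(ℝ, V) ∞ c s)
    (hd : ContMDiffAt 𝓘(ℝ, ℝ) 𝓘(ℝ, V) ∞ d s) :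
    rlog V (fun τ => c τ * d τ) s = rlog V c s + adjoint V (c s) (rlog V d s) := by
  have h1 : ContMDiffAt 𝓘(ℝ, ℝ) 𝓘(ℝ, V) ∞ (fun τ => c τ * (c s)⁻¹) s := hc.mul contMDiffAt_const
  have h2 : ContMDiffAt 𝓘(ℝ, ℝ) 𝓘(ℝ, V) ∞ (fun τ => d τ * (d s)⁻¹) s := hd.mul contMDiffAt_const
  have h3 : ContMDiffAt 𝓘(ℝ, ℝ) 𝓘(ℝ, V) ∞ (fun τ => c s * (d τ * (d s)⁻¹) * (c s)⁻¹) s :=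
    (contMDiffAt_const.mul h2).mul contMDiffAt_const
  rw [rlog, rlog, rlog, ← velocity_conj _ h2 (by simp), ← velocity_mul h1 h3 (by simp) (by simp)]
  congr 1
  ext τ
  group

lemma rlog_inv {c : ℝ → G} {s : ℝ} (hc : ContMDiffAt 𝓘(ℝ, ℝ) 𝓘(ℝ, V) ∞ c s) :
    rlog V (fun τ => (c τ)⁻¹) s = -llog V c s := by
  have h1 : ContMDiffAt 𝓘(ℝ, ℝ) 𝓘(ℝ, V) ∞ (fun τ => (c s)⁻¹ * c τ) s := contMDiffAt_const.mul hc
  rw [llog, ← velocity_inv h1 (by simp), rlog]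
  congr 1
  ext τ
  group

/-- The derivative of a curve in the preferred chart at `1`, in terms of its right logarithmic
derivative. -/
lemma hasDerivAt_oneChart_of_mem {c : ℝ → G} {s : ℝ} (hc : ContMDiffAt 𝓘(ℝ, ℝ) 𝓘(ℝ, V) ∞ c s)
    (hs : c s ∈ (oneChart V G).source) :
    HasDerivAt (fun τ => oneChart V G (c τ))
      (fderiv ℝ (chartMul V G) (oneChart V G 1, oneChart V G (c s)) (rlog V c s, 0)) s := by
  have h1 : ContMDiffAt 𝓘(ℝ, ℝ) 𝓘(ℝ, V) ∞ (fun τ => c τ * (c s)⁻¹) s := hc.mul contMDiffAt_const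
  have h2 := (hasDerivAt_velocity h1 (by simp)).prodMk (hasDerivAt_const s (oneChart V G (c s)))
  have h3 : HasFDerivAt (chartMul V G)
      (fderiv ℝ (chartMul V G) (oneChart V G 1, oneChart V G (c s)))
      (oneChart V G (c s * (c s)⁻¹), oneChart V G (c s)) := by
    rw [mul_inv_cancel]
    exact ((contDiffAt_chartMul_right ((oneChart V G).map_source hs)).differentiableAt
      (by simp)).hasFDerivAt
  refine (h3.comp_hasDerivAt s h2).congr_of_eventuallyEq ?_
  have hsrc : (oneChart V G).source ∈ 𝓝 (c s * (c s)⁻¹) := by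
    rw [mul_inv_cancel]
    exact oneChart_source_mem_nhds V G
  filter_upwards [h1.continuousAt.preimage_mem_nhds hsrc] with τ hτ
  change oneChart V G (c τ) = chartMul V G (oneChart V G (c τ * (c s)⁻¹), oneChart V G (c s))
  rw [← oneChart_mul_eq hτ hs, inv_mul_cancel_right]

/-- Right translation by the group element with coordinate `z` is inverted by translation with its
inverse, whose coordinate expression is `ν`. Injectivity allows a logarithmic derivative to be
recovered from a chart derivative. -/
lemma fderiv_chartMul_injective {z : V} (hz : z ∈ (oneChart V G).target) {A B : V}
    (h : fderiv ℝ (chartMul V G) (oneChart V G 1, z) (A, 0)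
      = fderiv ℝ (chartMul V G) (oneChart V G 1, z) (B, 0)) : A = B := by
  let k : G := (oneChart V G).symm z
  let ν : V → V := fun w => oneChart V G ((oneChart V G).symm w * k⁻¹)
  have hone := one_mem_oneChart_source V G
  have hν : DifferentiableAt ℝ ν z := by
    refine ContDiffAt.differentiableAt (n := ∞) (ContMDiffAt.contDiffAt_oneChart
      ((contMDiffAt_oneChart_symm hz).mul contMDiffAt_const) ?_) (by simp)
    simpa [k] using hone
  have h1 : HasFDerivAt (fun w => chartMul V G (w, z))
      ((fderiv ℝ (chartMul V G) (oneChart V G 1, z)).comp (.inl ℝ V V)) (oneChart V G 1) :=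
    ((contDiffAt_chartMul_right hz).differentiableAt (by simp)).hasFDerivAt.comp _
      (f := fun w => (w, z)) (hasFDerivAt_prodMk_left _ _)
  have h2 : HasFDerivAt (fun w => ν (chartMul V G (w, z)))
      ((fderiv ℝ ν z).comp
        ((fderiv ℝ (chartMul V G) (oneChart V G 1, z)).comp (.inl ℝ V V))) (oneChart V G 1) := by
    refine HasFDerivAt.comp (g := ν) _ ?_ h1
    rw [chartMul_one_left hz]
    exact hν.hasFDerivAt
  have h3 : HasFDerivAt (fun w => ν (chartMul V G (w, z))) (ContinuousLinearMap.id ℝ V)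
      (oneChart V G 1) := by
    refine (hasFDerivAt_id _).congr_of_eventuallyEq ?_
    have hcont : ContinuousAt (fun w => (oneChart V G).symm w * k) (oneChart V G 1) :=
      ((contMDiffAt_oneChart_symm (mem_of_mem_nhds (oneChart_target_mem_nhds V G))).mul
        contMDiffAt_const).continuousAt
    filter_upwards [oneChart_target_mem_nhds V G, hcont.preimage_mem_nhds
      ((isOpen_oneChart_source V G).mem_nhds
        (by simpa [k] using (oneChart V G).map_target hz))] with w hw hw'
    change oneChart V G ((oneChart V G).symm
      (oneChart V G ((oneChart V G).symm w * (oneChart V G).symm z)) * k⁻¹) = w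
    rw [(oneChart V G).left_inv hw', mul_inv_cancel_right, (oneChart V G).right_inv hw]
  have h4 := congrArg (fun L : V →L[ℝ] V => L A) (h2.unique h3)
  have h5 := congrArg (fun L : V →L[ℝ] V => L B) (h2.unique h3)
  simp only [ContinuousLinearMap.comp_apply, ContinuousLinearMap.inl_apply,
    ContinuousLinearMap.id_apply] at h4 h5
  rw [← h4, ← h5, h]

/-- A curve with vanishing logarithmic derivative is locally constant. -/
lemma eventually_eq_of_rlog_eq_zero {c : ℝ → G} {s : ℝ}
    (hc : ∀ᶠ τ in 𝓝 s, ContMDiffAt 𝓘(ℝ, ℝ) 𝓘(ℝ, V) ∞ c τ) (h0 : ∀ᶠ τ in 𝓝 s, rlog V c τ = 0) :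
    ∀ᶠ τ in 𝓝 s, c τ = c s := by
  -- Right translation leaves the logarithmic derivative unchanged and brings the curve into the
  -- chart at `1`.
  let d : ℝ → G := fun τ => c τ * (c s)⁻¹
  have hds : d s = 1 := mul_inv_cancel _
  have hd : ∀ᶠ τ in 𝓝 s, ContMDiffAt 𝓘(ℝ, ℝ) 𝓘(ℝ, V) ∞ d τ :=
    hc.mono fun τ hτ => hτ.mul contMDiffAt_const
  have hsrc : ∀ᶠ τ in 𝓝 s, d τ ∈ (oneChart V G).source :=
    hd.self_of_nhds.continuousAt.preimage_mem_nhds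
      (by rw [hds]; exact oneChart_source_mem_nhds V G)
  obtain ⟨ε, hε, hball⟩ := Metric.eventually_nhds_iff_ball.1 (hd.and (h0.and hsrc))
  have hderiv : ∀ τ ∈ Metric.ball s ε, HasDerivAt (fun σ => oneChart V G (d σ)) 0 τ := by
    intro τ hτ
    obtain ⟨h1, h2, h3⟩ := hball τ hτ
    have h4 := hasDerivAt_oneChart_of_mem h1 h3
    have h5 : rlog V d τ = 0 := by rw [← h2]; exact rlog_mul_const c _ τ
    rwa [h5, Prod.mk_zero_zero, map_zero] at h4
  filter_upwards [Metric.ball_mem_nhds s hε] with τ hτ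
  have hconst : oneChart V G (d τ) = oneChart V G (d s) :=
    Metric.isOpen_ball.is_const_of_deriv_eq_zero (convex_ball s ε).isPreconnected
      (fun σ hσ => (hderiv σ hσ).differentiableAt.differentiableWithinAt)
      (fun σ hσ => (hderiv σ hσ).deriv) hτ (Metric.mem_ball_self hε)
  have h6 : d τ = d s := (oneChart V G).injOn (hball τ hτ).2.2
    (hball s (Metric.mem_ball_self hε)).2.2 hconst
  rw [hds] at h6
  exact mul_inv_eq_one.1 h6

/-- Uniqueness for curves with prescribed right logarithmic derivative. -/
theorem eqOn_of_rlog_eq {c d : ℝ → G} {S : Set ℝ} (hS : IsOpen S) (hS' : IsPreconnected S)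
    (hc : ∀ s ∈ S, ContMDiffAt 𝓘(ℝ, ℝ) 𝓘(ℝ, V) ∞ c s)
    (hd : ∀ s ∈ S, ContMDiffAt 𝓘(ℝ, ℝ) 𝓘(ℝ, V) ∞ d s)
    (h : ∀ s ∈ S, rlog V c s = rlog V d s) {s₀ : ℝ} (hs₀ : s₀ ∈ S) (h₀ : c s₀ = d s₀) :
    EqOn c d S := by
  -- Since `d = c * w`, the product rule forces the adjoint image of `rlog V w` to vanish, so `w` is
  -- locally constant.
  let w : ℝ → G := fun s => (c s)⁻¹ * d s
  have hw : ∀ s ∈ S, ContMDiffAt 𝓘(ℝ, ℝ) 𝓘(ℝ, V) ∞ w s := fun s hs => (hc s hs).inv.mul (hd s hs)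
  have hw0 : ∀ s ∈ S, rlog V w s = 0 := by
    intro s hs
    have h1 := rlog_mul (hc s hs) (hw s hs)
    have h2 : (fun τ => c τ * w τ) = d := by ext τ; simp [w]
    rw [h2, ← h s hs, left_eq_add] at h1
    exact adjoint_injective (c s) (h1.trans (map_zero _).symm)
  have hloc : ∀ s ∈ S, ∀ᶠ τ in 𝓝 s, w τ = w s := fun s hs =>
    eventually_eq_of_rlog_eq_zero (V := V)
      (by filter_upwards [hS.mem_nhds hs] with τ hτ using hw τ hτ)
      (by filter_upwards [hS.mem_nhds hs] with τ hτ using hw0 τ hτ)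
  have hA : IsOpen {s | s ∈ S ∧ w s = 1} := by
    rw [isOpen_iff_mem_nhds]
    rintro s ⟨hs, hs1⟩
    filter_upwards [hS.mem_nhds hs, hloc s hs] with τ h1 h2
    exact ⟨h1, h2.trans hs1⟩
  -- Openness of the complement also follows from local constancy, so no separation axiom on `G` is
  -- needed.
  have hB : IsOpen {s | s ∈ S ∧ w s ≠ 1} := by
    rw [isOpen_iff_mem_nhds]
    rintro s ⟨hs, hs1⟩
    filter_upwards [hS.mem_nhds hs, hloc s hs] with τ h1 h2
    exact ⟨h1, by rwa [h2]⟩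
  have hsub : S ⊆ {s | s ∈ S ∧ w s = 1} := by
    refine hS'.subset_left_of_subset_union hA hB ?_ ?_ ?_
    · exact Set.disjoint_left.2 fun s hs hs' => hs'.2 hs.2
    · intro s hs
      by_cases h1 : w s = 1
      · exact Or.inl ⟨hs, h1⟩
      · exact Or.inr ⟨hs, h1⟩
    · exact ⟨s₀, hs₀, hs₀, by simp [w, h₀]⟩
  intro s hs
  exact (inv_mul_eq_one.1 (hsub hs).2)

theorem eq_of_rlog_eq {c d : ℝ → G} (hc : ContMDiff 𝓘(ℝ, ℝ) 𝓘(ℝ, V) ∞ c)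
    (hd : ContMDiff 𝓘(ℝ, ℝ) 𝓘(ℝ, V) ∞ d) (h : ∀ s, rlog V c s = rlog V d s) {s₀ : ℝ}
    (h₀ : c s₀ = d s₀) : c = d :=
  funext fun s => eqOn_of_rlog_eq isOpen_univ isPreconnected_univ (fun s _ => hc s)
    (fun s _ => hd s) (fun s _ => h s) (mem_univ s₀) h₀ (mem_univ s)

theorem eq_of_llog_eq {c d : ℝ → G} (hc : ContMDiff 𝓘(ℝ, ℝ) 𝓘(ℝ, V) ∞ c)
    (hd : ContMDiff 𝓘(ℝ, ℝ) 𝓘(ℝ, V) ∞ d) (h : ∀ s, llog V c s = llog V d s) {s₀ : ℝ}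
    (h₀ : c s₀ = d s₀) : c = d := by
  have := eq_of_rlog_eq hc.inv hd.inv
    (fun s => by rw [rlog_inv (hc s), rlog_inv (hd s), h s]) (s₀ := s₀) (by rw [h₀])
  funext s
  exact inv_injective (congrFun this s)

/-- Smooth dependence on parameters of the velocity of a family of curves passing through `1`. -/
lemma contDiffAt_velocity {E : Type*} [NormedAddCommGroup E] [NormedSpace ℝ E] {C : ℝ × E → G}
    {σ : E → ℝ} {p : E} (hC : ContMDiffAt 𝓘(ℝ, ℝ × E) 𝓘(ℝ, V) ∞ C (σ p, p))
    (hσ : ContDiffAt ℝ ∞ σ p) (h1 : C (σ p, p) = 1) :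
    ContDiffAt ℝ ∞ (fun q => velocity (V := V) (fun τ => C (τ, q)) (σ q)) p := by
  have hK : ContDiffAt ℝ ∞ (fun r => oneChart V G (C r)) (σ p, p) :=
    hC.contDiffAt_oneChart (by rw [h1]; exact one_mem_oneChart_source V G)
  have hpair : ContDiffAt ℝ ∞ (fun q => (σ q, q)) p := hσ.prodMk contDiffAt_id
  have h2 : ContDiffAt ℝ ∞ (fun q => fderiv ℝ (fun r => oneChart V G (C r)) (σ q, q)) p :=
    ContDiffAt.comp p (hK.fderiv_right (m := ∞) (by simp)) hpair
  have h3 : ContDiffAt ℝ ∞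
      (fun q => fderiv ℝ (fun r => oneChart V G (C r)) (σ q, q) (1, 0)) p :=
    h2.clm_apply contDiffAt_const
  refine h3.congr_of_eventuallyEq ?_
  filter_upwards [hpair.continuousAt.eventually hK.eventually_differentiableAt] with q hq
  exact (hq.hasFDerivAt.comp_hasDerivAt (σ q)
    ((hasDerivAt_id (σ q)).prodMk (hasDerivAt_const (σ q) q))).deriv

end Velocity

/-! ### Solving `∂ₓw w⁻¹ = α` with a parameter -/

section Existence

variable {V : Type*} [NormedAddCommGroup V] [NormedSpace ℝ V]
  {G : Type*} [TopologicalSpace G] [ChartedSpace V G] [Group G] [LieGroup 𝓘(ℝ, V) ∞ G]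

/-- `w` is smooth on `S` and has right logarithmic derivative `α` in the first variable there. -/
def HasRlogOn (α : ℝ × ℝ → V) (w : ℝ × ℝ → G) (S : Set (ℝ × ℝ)) : Prop :=
  ∀ p ∈ S, ContMDiffAt 𝓘(ℝ, ℝ × ℝ) 𝓘(ℝ, V) ∞ w p ∧ rlog V (fun x => w (x, p.2)) p.1 = α p

lemma ContMDiffAt.curve_left {E : Type*} [NormedAddCommGroup E] [NormedSpace ℝ E]
    {w : ℝ × E → G} {x : ℝ} {y : E} (h : ContMDiffAt 𝓘(ℝ, ℝ × E) 𝓘(ℝ, V) ∞ w (x, y)) :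
    ContMDiffAt 𝓘(ℝ, ℝ) 𝓘(ℝ, V) ∞ (fun ξ => w (ξ, y)) x :=
  ContMDiffAt.comp x (f := fun ξ : ℝ => (ξ, y)) h
    (by fun_prop : ContDiffAt ℝ ∞ (fun ξ : ℝ => (ξ, y)) x).contMDiffAt

/-- Local solvability of the equation `∂ₓw w⁻¹ = α` with smooth dependence on the parameter. -/
lemma exists_local_hasRlogOn [FiniteDimensional ℝ V] {α : ℝ × ℝ → V} (hα : ContDiff ℝ ∞ α)
    (p₀ : ℝ × ℝ) :
    ∃ (w : ℝ × ℝ → G), ∃ S, IsOpen S ∧ p₀ ∈ S ∧ HasRlogOn α w S := by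
  have : CompleteSpace V := FiniteDimensional.complete ℝ V
  -- In the chart the equation reads `∂ₓζ = A(ζ) α`, where `A(z)` is the derivative at `1` of right
  -- translation by the element with coordinate `z`.
  let A : V → V →L[ℝ] V := fun z =>
    (fderiv ℝ (chartMul V G) (oneChart V G 1, z)).comp (.inl ℝ V V)
  have hA : ∀ z ∈ (oneChart V G).target, ContDiffAt ℝ ∞ A z := by
    intro z hz
    have h1 : ContDiffAt ℝ ∞ (fun z => fderiv ℝ (chartMul V G) (oneChart V G 1, z)) z :=
      ContDiffAt.comp z (f := fun z : V => (oneChart V G 1, z))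
        ((contDiffAt_chartMul_right hz).fderiv_right (m := ∞) (by simp)) (by fun_prop)
    exact h1.clm_comp contDiffAt_const
  obtain ⟨r, hr, hball⟩ := Metric.nhds_basis_closedBall.mem_iff.1 (oneChart_target_mem_nhds V G)
  -- The support of `χ` lies in the chart target, which makes the right-hand side smooth on all of
  -- `V`. On the ball of radius `r / 2`, where the local solution stays, the equation is unchanged.
  let χ : ContDiffBump (oneChart V G 1) := ⟨r / 2, r, half_pos hr, half_lt_self hr⟩
  have hχA : ContDiff ℝ ∞ (fun z => χ z • A z) := by
    rw [contDiff_iff_contDiffAt]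
    intro z
    by_cases hz : z ∈ (oneChart V G).target
    · exact χ.contDiff.contDiffAt.smul (hA z hz)
    · have hz' : z ∉ tsupport χ := fun h => hz (hball (by rwa [χ.tsupport_eq] at h))
      have h0 : (fun z => χ z • A z) =ᶠ[𝓝 z] fun _ => 0 := by
        filter_upwards [notMem_tsupport_iff_eventuallyEq.1 hz'] with w hw
        simp [hw]
      exact contDiffAt_const.congr_of_eventuallyEq h0
  have hF : ContDiff ℝ ∞ (fun q : V × ℝ × ℝ => (χ q.1 • A q.1) (α q.2)) :=
    (hχA.comp contDiff_fst).clm_apply (hα.comp contDiff_snd)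
  obtain ⟨ζ, hζ0, hζ⟩ := exists_smooth_local_solution hF (oneChart V G 1) p₀.1 p₀.2
  rw [Prod.mk.eta] at hζ0 hζ
  have hnear : ∀ᶠ p in 𝓝 p₀, ζ p ∈ Metric.ball (oneChart V G 1) (r / 2) := by
    refine hζ.self_of_nhds.1.continuousAt.eventually ?_
    rw [hζ0]
    exact Metric.ball_mem_nhds _ (half_pos hr)
  obtain ⟨S, hSsub, hS, hp₀⟩ := eventually_nhds_iff.1 (hζ.and hnear)
  refine ⟨fun p => (oneChart V G).symm (ζ p), S, hS, hp₀, fun p hp => ?_⟩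
  obtain ⟨⟨h1, h2⟩, h3⟩ := hSsub p hp
  have htarget : ∀ q ∈ S, ζ q ∈ (oneChart V G).target := fun q hq =>
    hball (Metric.ball_subset_closedBall
      (Metric.ball_subset_ball (half_le_self hr.le) (hSsub q hq).2))
  have hsmooth : ContMDiffAt 𝓘(ℝ, ℝ × ℝ) 𝓘(ℝ, V) ∞ (fun p => (oneChart V G).symm (ζ p)) p :=
    ContMDiffAt.comp p (contMDiffAt_oneChart_symm (htarget p hp)) h1.contMDiffAt
  refine ⟨hsmooth, ?_⟩
  have h4 := hasDerivAt_oneChart_of_mem (V := V) (c := fun x => (oneChart V G).symm (ζ (x, p.2)))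
    (s := p.1) (ContMDiffAt.curve_left (w := fun p => (oneChart V G).symm (ζ p)) hsmooth)
    ((oneChart V G).map_target (htarget p hp))
  have h5 : (fun x => oneChart V G ((oneChart V G).symm (ζ (x, p.2)))) =ᶠ[𝓝 p.1]
      fun x => ζ (x, p.2) := by
    have hc : ContinuousAt (fun x : ℝ => (x, p.2)) p.1 := by fun_prop
    filter_upwards [hc.preimage_mem_nhds (hS.mem_nhds hp)] with x hx
    exact (oneChart V G).right_inv (htarget _ hx)
  have h6 := h4.unique (h2.congr_of_eventuallyEq h5)
  rw [(oneChart V G).right_inv (htarget _ hp)] at h6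
  refine fderiv_chartMul_injective (htarget p hp) (h6.trans ?_)
  simp only [χ.one_of_mem_closedBall (Metric.ball_subset_closedBall h3), one_smul]
  rfl

/-- A right factor independent of `x` does not affect the equation. This freedom is used to match
solutions when gluing and to impose initial values. -/
lemma HasRlogOn.mul_right {α : ℝ × ℝ → V} {w : ℝ × ℝ → G} {S : Set (ℝ × ℝ)}
    (hw : HasRlogOn α w S) {k : ℝ → G}
    (hk : ∀ p ∈ S, ContMDiffAt 𝓘(ℝ, ℝ) 𝓘(ℝ, V) ∞ k p.2) :
    HasRlogOn α (fun p => w p * k p.2) S := by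
  intro p hp
  refine ⟨(hw p hp).1.mul ((hk p hp).comp p contDiffAt_snd.contMDiffAt), ?_⟩
  exact (rlog_mul_const (fun x => w (x, p.2)) (k p.2) p.1).trans (hw p hp).2

lemma ContMDiffAt.curve_right {w : ℝ × ℝ → G} {x y : ℝ}
    (h : ContMDiffAt 𝓘(ℝ, ℝ × ℝ) 𝓘(ℝ, V) ∞ w (x, y)) :
    ContMDiffAt 𝓘(ℝ, ℝ) 𝓘(ℝ, V) ∞ (fun η => w (x, η)) y :=
  ContMDiffAt.comp y (f := fun η : ℝ => (x, η)) h
    (by fun_prop : ContDiffAt ℝ ∞ (fun η : ℝ => (x, η)) y).contMDiffAt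

lemma HasRlogOn.congr {α : ℝ × ℝ → V} {w w' : ℝ × ℝ → G} {S : Set (ℝ × ℝ)}
    (hw : HasRlogOn α w S) {p : ℝ × ℝ} (hp : p ∈ S) (h : w' =ᶠ[𝓝 p] w) :
    ContMDiffAt 𝓘(ℝ, ℝ × ℝ) 𝓘(ℝ, V) ∞ w' p ∧ rlog V (fun x => w' (x, p.2)) p.1 = α p := by
  refine ⟨(hw p hp).1.congr_of_eventuallyEq h, ?_⟩
  rw [← (hw p hp).2]
  have hc : ContinuousAt (fun x : ℝ => (x, p.2)) p.1 := by fun_prop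
  exact rlog_congr (hc.eventually h)

lemma HasRlogOn.eqOn {α : ℝ × ℝ → V} {w w' : ℝ × ℝ → G} {a b y x₀ : ℝ}
    (hw : HasRlogOn α w (Ioo a b ×ˢ {y})) (hw' : HasRlogOn α w' (Ioo a b ×ˢ {y}))
    (hx₀ : x₀ ∈ Ioo a b) (h : w (x₀, y) = w' (x₀, y)) {x : ℝ} (hx : x ∈ Ioo a b) :
    w (x, y) = w' (x, y) := by
  have hmem : ∀ s ∈ Ioo a b, (s, y) ∈ Ioo a b ×ˢ ({y} : Set ℝ) := fun s hs => ⟨hs, rfl⟩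
  exact eqOn_of_rlog_eq (V := V) (c := fun x => w (x, y)) (d := fun x => w' (x, y)) isOpen_Ioo
    isPreconnected_Ioo (fun s hs => (hw _ (hmem s hs)).1.curve_left)
    (fun s hs => (hw' _ (hmem s hs)).1.curve_left)
    (fun s hs => (hw _ (hmem s hs)).2.trans (hw' _ (hmem s hs)).2.symm) hx₀ h hx

lemma HasRlogOn.mono {α : ℝ × ℝ → V} {w : ℝ × ℝ → G} {S T : Set (ℝ × ℝ)}
    (hw : HasRlogOn α w T) (h : S ⊆ T) : HasRlogOn α w S :=
  fun p hp => hw p (h hp)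

/-- Solutions over two overlapping intervals can be glued. -/
lemma HasRlogOn.glue {α : ℝ × ℝ → V} {w₁ w₂ : ℝ × ℝ → G} {a b c d x₀ : ℝ} {J : Set ℝ}
    (h₁ : HasRlogOn α w₁ (Ioo a b ×ˢ J)) (h₂ : HasRlogOn α w₂ (Ioo c d ×ˢ J)) (hJ : IsOpen J)
    (hab : x₀ ∈ Ioo a b) (hcd : x₀ ∈ Ioo c d) :
    ∃ w : ℝ × ℝ → G, HasRlogOn α w (Ioo a d ×ˢ J) := by
  -- The second solution, corrected to agree with the first along the line `x = x₀`; uniqueness then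
  -- gives agreement on the overlap.
  let w₃ : ℝ × ℝ → G := fun p => w₂ p * ((w₂ (x₀, p.2))⁻¹ * w₁ (x₀, p.2))
  have h₃ : HasRlogOn α w₃ (Ioo c d ×ˢ J) := by
    refine h₂.mul_right (k := fun y => (w₂ (x₀, y))⁻¹ * w₁ (x₀, y)) fun p hp => ?_
    exact (h₂ (x₀, p.2) ⟨hcd, hp.2⟩).1.curve_right.inv.mul
      (h₁ (x₀, p.2) ⟨hab, hp.2⟩).1.curve_right
  have hagree : ∀ p : ℝ × ℝ, p.2 ∈ J → x₀ ≤ p.1 → p.1 < b → p.1 < d → w₃ p = w₁ p := by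
    intro p hp hx hb hd
    have hsub : ∀ x ∈ Ioo (max a c) (min b d), x ∈ Ioo a b ∧ x ∈ Ioo c d := fun x hx =>
      ⟨⟨(le_max_left _ _).trans_lt hx.1, hx.2.trans_le (min_le_left _ _)⟩,
        ⟨(le_max_right _ _).trans_lt hx.1, hx.2.trans_le (min_le_right _ _)⟩⟩
    refine HasRlogOn.eqOn (a := max a c) (b := min b d) (x₀ := x₀)
      (h₃.mono ?_) (h₁.mono ?_) ⟨max_lt hab.1 hcd.1, lt_min hab.2 hcd.2⟩ (by simp [w₃])
      ⟨(max_lt hab.1 hcd.1).trans_le hx, lt_min hb hd⟩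
    · rintro ⟨x, y⟩ ⟨h1, rfl⟩
      exact ⟨(hsub x h1).2, hp⟩
    · rintro ⟨x, y⟩ ⟨h1, rfl⟩
      exact ⟨(hsub x h1).1, hp⟩
  refine ⟨fun p => if p.1 < x₀ then w₁ p else w₃ p, ?_⟩
  rintro p ⟨⟨hpa, hpd⟩, hpJ⟩
  have hJ' : ∀ᶠ q in 𝓝 p, q.2 ∈ J := continuous_snd.continuousAt.eventually (hJ.mem_nhds hpJ)
  -- The definition switches at `x₀`, but the case distinction is at `b`: up to `b` both branches
  -- agree with `w₁`, so no separate argument is needed at the seam.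
  rcases lt_or_ge p.1 b with hb | hb
  · refine h₁.congr ⟨⟨hpa, hb⟩, hpJ⟩ ?_
    filter_upwards [hJ', continuous_fst.continuousAt.eventually (Iio_mem_nhds hb),
      continuous_fst.continuousAt.eventually (Iio_mem_nhds hpd)] with q hq1 hq2 hq3
    split_ifs with hq
    · rfl
    · exact hagree q hq1 (not_lt.1 hq) hq2 hq3
  · refine h₃.congr ⟨⟨hcd.1.trans (hab.2.trans_le hb), hpd⟩, hpJ⟩ ?_
    filter_upwards [continuous_fst.continuousAt.eventually
      (Ioi_mem_nhds (hab.2.trans_le hb))] with q hq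
    exact if_neg (not_lt.2 (le_of_lt hq))

/-- Compactness of `[-R, R] × {y₀}` yields a Lebesgue number `δ`, hence local solutions on squares
of one size over the same interval `J` of parameters. These are glued one after the other. -/
lemma exists_hasRlogOn_strip [FiniteDimensional ℝ V] {α : ℝ × ℝ → V} (hα : ContDiff ℝ ∞ α)
    (y₀ : ℝ) {R : ℝ} (hR : 0 < R) :
    ∃ (w : ℝ × ℝ → G), ∃ J, IsOpen J ∧ y₀ ∈ J ∧ HasRlogOn α w (Ioo (-R) R ×ˢ J) := by
  choose w S hS hpS hw using exists_local_hasRlogOn (G := G) hα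
  obtain ⟨δ, hδ, hleb⟩ := lebesgue_number_lemma_of_metric
    (isCompact_Icc.prod isCompact_singleton : IsCompact (Icc (-R) R ×ˢ {y₀})) hS
    (fun p _ => mem_iUnion.2 ⟨p, hpS p⟩)
  let J := Metric.ball y₀ δ
  have hloc : ∀ x ∈ Icc (-R) R, ∃ w : ℝ × ℝ → G, HasRlogOn α w (Ioo (x - δ) (x + δ) ×ˢ J) := by
    intro x hx
    obtain ⟨p, hp⟩ := hleb (x, y₀) ⟨hx, rfl⟩
    refine ⟨w p, (hw p).mono (Subset.trans ?_ hp)⟩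
    rw [← Real.ball_eq_Ioo, ← ball_prod_same]
  -- The centres advance by `δ / 2`, so that neighbouring intervals of radius `δ` overlap; the cap
  -- keeps them inside `[-R, R]`.
  let b : ℕ → ℝ := fun n => min (-R + n * (δ / 2)) R
  have hb : ∀ n, b n ∈ Icc (-R) R := fun n =>
    ⟨le_min (by have : 0 ≤ (n : ℝ) * (δ / 2) := by positivity
                linarith) (by linarith), min_le_right _ _⟩
  have hind : ∀ n, ∃ w : ℝ × ℝ → G, HasRlogOn α w (Ioo (-R - δ) (b n + δ) ×ˢ J) := by
    intro n
    induction n with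
    | zero =>
      have : b 0 = -R := by simp [b]; linarith
      rw [this]
      exact hloc (-R) ⟨le_rfl, by linarith⟩
    | succ n ih =>
      obtain ⟨w₁, h₁⟩ := ih
      obtain ⟨w₂, h₂⟩ := hloc (b (n + 1)) (hb (n + 1))
      have hlt : b (n + 1) < b n + δ := by
        have h1 : b (n + 1) ≤ -R + n * (δ / 2) + δ / 2 :=
          (min_le_left _ _).trans (by push_cast; linarith)
        have h2 : b (n + 1) ≤ R := min_le_right _ _
        rw [← sub_lt_iff_lt_add]
        exact lt_min (by linarith) (by linarith)
      exact h₁.glue h₂ Metric.isOpen_ball ⟨by linarith [(hb (n + 1)).1], hlt⟩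
        ⟨by linarith, by linarith⟩
  obtain ⟨n, hn⟩ := exists_nat_ge (2 * R / (δ / 2))
  obtain ⟨w', hw'⟩ := hind n
  refine ⟨w', J, Metric.isOpen_ball, Metric.mem_ball_self hδ, hw'.mono ?_⟩
  have hbn : b n = R := by
    rw [div_le_iff₀ (by positivity)] at hn
    exact min_eq_right (by linarith)
  rw [hbn]
  exact prod_mono (Ioo_subset_Ioo (by linarith) (by linarith)) subset_rfl

/-- Global solvability of the equation `∂ₓu u⁻¹ = α`, `u(0, y) = 1`, with smooth dependence on the
parameter. -/
theorem exists_rlog_eq [FiniteDimensional ℝ V] {α : ℝ × ℝ → V} (hα : ContDiff ℝ ∞ α) :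
    ∃ u : ℝ × ℝ → G, ContMDiff 𝓘(ℝ, ℝ × ℝ) 𝓘(ℝ, V) ∞ u ∧
      (∀ x y, rlog V (fun ξ => u (ξ, y)) x = α (x, y)) ∧ ∀ y, u (0, y) = 1 := by
  choose w J hJ hyJ hw using fun y₀ (R : {R : ℝ // 0 < R}) =>
    exists_hasRlogOn_strip (G := G) hα y₀ R.2
  let rad : ℝ → {R : ℝ // 0 < R} := fun x => ⟨|x| + 1, by positivity⟩
  have hrad : ∀ x, x ∈ Ioo (-(rad x : ℝ)) (rad x) := fun x =>
    ⟨by have := neg_abs_le x; change -(|x| + 1) < x; linarith,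
      by have := le_abs_self x; change x < |x| + 1; linarith⟩
  have hzero : ∀ R : {R : ℝ // 0 < R}, (0 : ℝ) ∈ Ioo (-(R : ℝ)) R := fun R =>
    ⟨neg_lt_zero.2 R.2, R.2⟩
  let v : ℝ → {R : ℝ // 0 < R} → ℝ × ℝ → G := fun y₀ R p => w y₀ R p * (w y₀ R (0, p.2))⁻¹
  have hv : ∀ y₀ R, HasRlogOn α (v y₀ R) (Ioo (-(R : ℝ)) R ×ˢ J y₀ R) := fun y₀ R =>
    (hw y₀ R).mul_right (k := fun y => (w y₀ R (0, y))⁻¹) fun p hp =>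
      (hw y₀ R (0, p.2) ⟨hzero R, hp.2⟩).1.curve_right.inv
  -- Each point is evaluated with the strip solution centred at its own `y`, of radius `|x| + 1`.
  -- Because all strip solutions equal `1` at `x = 0`, uniqueness along horizontal lines makes `u`
  -- coincide with each of them on its whole strip, and smoothness follows.
  let u : ℝ × ℝ → G := fun p => v p.2 (rad p.1) p
  have hu : ∀ (y₀ : ℝ) (R : {R : ℝ // 0 < R}), ∀ p ∈ Ioo (-(R : ℝ)) R ×ˢ J y₀ R,
      u p = v y₀ R p := by
    rintro y₀ R ⟨x, y⟩ ⟨hx, hy⟩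
    have hin : ∀ s ∈ Ioo (-(min (rad x : ℝ) R)) (min (rad x : ℝ) R),
        s ∈ Ioo (-(rad x : ℝ)) (rad x) ∧ s ∈ Ioo (-(R : ℝ)) R := fun s hs =>
      ⟨⟨by linarith [hs.1, min_le_left (rad x : ℝ) R], hs.2.trans_le (min_le_left _ _)⟩,
        ⟨by linarith [hs.1, min_le_right (rad x : ℝ) R], hs.2.trans_le (min_le_right _ _)⟩⟩
    have hmin : 0 < min (rad x : ℝ) R := lt_min (rad x).2 R.2
    refine HasRlogOn.eqOn (x₀ := 0) (a := -(min (rad x : ℝ) R)) (b := min (rad x : ℝ) R)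
      ((hv y (rad x)).mono ?_) ((hv y₀ R).mono ?_) ⟨neg_lt_zero.2 hmin, hmin⟩ (by simp [v]) ?_
    · rintro ⟨s, t⟩ ⟨h1, rfl⟩
      exact ⟨(hin s h1).1, hyJ _ _⟩
    · rintro ⟨s, t⟩ ⟨h1, rfl⟩
      exact ⟨(hin s h1).2, hy⟩
    · refine ⟨?_, lt_min (hrad x).2 hx.2⟩
      rw [neg_lt]
      exact lt_min (neg_lt.1 (hrad x).1) (neg_lt.1 hx.1)
  have hsol : HasRlogOn α u univ := by
    intro p _
    have hopen : IsOpen (Ioo (-(rad p.1 : ℝ)) (rad p.1) ×ˢ J p.2 (rad p.1)) :=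
      isOpen_Ioo.prod (hJ _ _)
    have hp : p ∈ Ioo (-(rad p.1 : ℝ)) (rad p.1) ×ˢ J p.2 (rad p.1) := ⟨hrad p.1, hyJ _ _⟩
    refine (hv p.2 (rad p.1)).congr hp ?_
    filter_upwards [hopen.mem_nhds hp] with q hq
    exact hu _ _ q hq
  exact ⟨u, fun p => (hsol p trivial).1, fun x y => (hsol (x, y) trivial).2,
    fun y => by simp [u, v]⟩

end Existence

/-! ### One- and two-forms on the plane -/

section Forms

variable {F : Type*} [NormedAddCommGroup F] [NormedSpace ℝ F]

/-- The product of a fixed scalar form with a varying vector. -/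
def ContinuousAlternatingMap.smulVector {E : Type*} [NormedAddCommGroup E] [NormedSpace ℝ E]
    {n : ℕ} (θ : E [⋀^Fin n]→L[ℝ] ℝ) (F : Type*) [NormedAddCommGroup F] [NormedSpace ℝ F] :
    F →L[ℝ] E [⋀^Fin n]→L[ℝ] F :=
  LinearMap.mkContinuous
    { toFun := fun Z => (ContinuousLinearMap.toSpanSingleton ℝ Z).compContinuousAlternatingMap θ
      map_add' := fun Z Z' => by ext v; simp
      map_smul' := fun r Z => by ext v; exact smul_comm _ _ _ } ‖θ‖
    (fun Z => by
      refine (ContinuousLinearMap.norm_compContinuousAlternatingMap_le _ _).trans ?_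
      rw [ContinuousLinearMap.norm_toSpanSingleton, mul_comm])

@[simp]
lemma ContinuousAlternatingMap.smulVector_apply {E : Type*} [NormedAddCommGroup E]
    [NormedSpace ℝ E] {n : ℕ} (θ : E [⋀^Fin n]→L[ℝ] ℝ) (Z : F) (v : Fin n → E) :
    θ.smulVector F Z v = θ v • Z :=
  rfl

/-- The area form `dx ∧ dy` on `ℝ²`. -/
def areaForm : (ℝ × ℝ) [⋀^Fin 2]→L[ℝ] ℝ where
  toFun v := (v 0).1 * (v 1).2 - (v 0).2 * (v 1).1
  map_update_add' v i z w := by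
    fin_cases i <;> simp <;> ring
  map_update_smul' v i r z := by
    fin_cases i <;> simp <;> ring
  map_eq_zero_of_eq' v i j h hij := by
    fin_cases i <;> fin_cases j <;> simp_all <;> ring
  cont := by fun_prop

lemma areaForm_apply (v w : ℝ × ℝ) : areaForm ![v, w] = v.1 * w.2 - v.2 * w.1 :=
  rfl

lemma oneForm_apply (a : (ℝ × ℝ) [⋀^Fin 1]→L[ℝ] F) (v : ℝ × ℝ) :
    a ![v] = v.1 • a ![(1, 0)] + v.2 • a ![(0, 1)] := by
  have hv : v = v.1 • ((1 : ℝ), (0 : ℝ)) + v.2 • ((0 : ℝ), (1 : ℝ)) := by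
    ext <;> simp
  conv_lhs => rw [hv]
  rw [a.vecCons_add, a.vecCons_smul, a.vecCons_smul]

lemma twoForm_apply (B : (ℝ × ℝ) [⋀^Fin 2]→L[ℝ] F) (v w : ℝ × ℝ) :
    B ![v, w] = (v.1 * w.2 - v.2 * w.1) • B ![(1, 0), (0, 1)] := by
  have hsplit : ∀ v : ℝ × ℝ, v = v.1 • ((1 : ℝ), (0 : ℝ)) + v.2 • ((0 : ℝ), (1 : ℝ)) := by
    intro v; ext <;> simp
  have hswap : ∀ v w : ℝ × ℝ, B ![v, w] = -B ![w, v] := by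
    intro v w
    have h : B (![w, v] ∘ Equiv.swap 0 1) = -B ![w, v] :=
      B.map_swap ![w, v] (i := 0) (j := 1) (by simp)
    have e : ![w, v] ∘ Equiv.swap (0 : Fin 2) 1 = ![v, w] := by
      ext i <;> fin_cases i <;> simp
    rw [← h, e]
  have hself : ∀ v : ℝ × ℝ, B ![v, v] = 0 := fun v =>
    B.map_eq_zero_of_eq ![v, v] (i := 0) (j := 1) rfl (by simp)
  have hleft : ∀ v w : ℝ × ℝ, B ![v, w] = v.1 • B ![(1, 0), w] + v.2 • B ![(0, 1), w] := by
    intro v w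
    conv_lhs => rw [hsplit v]
    rw [B.vecCons_add, B.vecCons_smul, B.vecCons_smul]
  rw [hleft v w, hswap (1, 0) w, hswap (0, 1) w, hleft w (1, 0), hleft w (0, 1), hself, hself,
    hswap (0, 1) (1, 0)]
  module

lemma oneForm_ext {a a' : (ℝ × ℝ) [⋀^Fin 1]→L[ℝ] F} (h1 : a ![(1, 0)] = a' ![(1, 0)])
    (h2 : a ![(0, 1)] = a' ![(0, 1)]) : a = a' := by
  ext v
  have hv : v = ![v 0] := by ext i <;> fin_cases i <;> rfl
  rw [hv, oneForm_apply, oneForm_apply a', h1, h2]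

lemma twoForm_ext {B B' : (ℝ × ℝ) [⋀^Fin 2]→L[ℝ] F}
    (h : B ![(1, 0), (0, 1)] = B' ![(1, 0), (0, 1)]) : B = B' := by
  ext v
  have hv : v = ![v 0, v 1] := by ext i <;> fin_cases i <;> rfl
  rw [hv, twoForm_apply, twoForm_apply B', h]

lemma fderiv_form_apply {n : ℕ} {a : ℝ × ℝ → (ℝ × ℝ) [⋀^Fin n]→L[ℝ] F} {p : ℝ × ℝ}
    (ha : DifferentiableAt ℝ a p) (w : Fin n → ℝ × ℝ) (v : ℝ × ℝ) :
    fderiv ℝ a p v w = fderiv ℝ (fun q => a q w) p v := by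
  have h := (ContinuousAlternatingMap.apply ℝ (ℝ × ℝ) F w).hasFDerivAt.comp p ha.hasFDerivAt
  have h' : HasFDerivAt (fun q => a q w) _ p := h
  rw [h'.fderiv]
  rfl

lemma extDeriv_oneForm_apply {a : ℝ × ℝ → (ℝ × ℝ) [⋀^Fin 1]→L[ℝ] F} {p : ℝ × ℝ}
    (ha : DifferentiableAt ℝ a p) (v w : ℝ × ℝ) :
    extDeriv a p ![v, w]
      = fderiv ℝ (fun q => a q ![w]) p v - fderiv ℝ (fun q => a q ![v]) p w := by
  rw [extDeriv, ContinuousAlternatingMap.alternatizeUncurryFin_apply, Fin.sum_univ_two]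
  have h0 : Fin.removeNth (0 : Fin 2) ![v, w] = ![w] := by
    ext i <;> fin_cases i <;> rfl
  have h1 : Fin.removeNth (1 : Fin 2) ![v, w] = ![v] := by
    ext i <;> fin_cases i <;> rfl
  rw [h0, h1, fderiv_form_apply ha, fderiv_form_apply ha]
  simp [sub_eq_add_neg]

end Forms

/-! ### The infinitesimal holonomy of a rectangle -/

section GroupCommutator

variable {V : Type*} [NormedAddCommGroup V] [NormedSpace ℝ V]
  {G : Type*} [TopologicalSpace G] [ChartedSpace V G] [Group G]

variable (V G) in
lemma chartMulBilin_zero_left (B : V) : chartMulBilin V G 0 B = 0 := by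
  rw [chartMulBilin, Prod.mk_zero_zero, map_zero, zero_apply]

variable (V G) in
lemma chartMulBilin_zero_right (A : V) : chartMulBilin V G A 0 = 0 := by
  rw [chartMulBilin, Prod.mk_zero_zero, map_zero]

variable (V G) in
lemma chartMulBilin_add_left (A A' B : V) :
    chartMulBilin V G (A + A') B = chartMulBilin V G A B + chartMulBilin V G A' B := by
  have : (A + A', (0 : V)) = (A, 0) + (A', 0) := by simp
  simp only [chartMulBilin, this, map_add, add_apply]

variable (V G) in
lemma chartMulBilin_add_right (A B B' : V) :
    chartMulBilin V G A (B + B') = chartMulBilin V G A B + chartMulBilin V G A B' := by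
  have : ((0 : V), B + B') = (0, B) + (0, B') := by simp
  simp only [chartMulBilin, this, map_add]

variable (V G) in
lemma chartMulBilin_smul_left (r : ℝ) (A B : V) :
    chartMulBilin V G (r • A) B = r • chartMulBilin V G A B := by
  have : (r • A, (0 : V)) = r • (A, (0 : V)) := by simp
  simp only [chartMulBilin, this, map_smul, smul_apply]

variable (V G) in
lemma chartMulBilin_smul_right (r : ℝ) (A B : V) :
    chartMulBilin V G A (r • B) = r • chartMulBilin V G A B := by
  have : ((0 : V), r • B) = r • ((0 : V), B) := by simp
  simp only [chartMulBilin, this, map_smul]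

variable [LieGroup 𝓘(ℝ, V) ∞ G]

lemma fderiv_oneChart_left {L : ℝ × ℝ → G} {x y : ℝ}
    (hL : ContMDiffAt 𝓘(ℝ, ℝ × ℝ) 𝓘(ℝ, V) ∞ L (x, y)) (h1 : L (x, y) = 1) :
    fderiv ℝ (fun q => oneChart V G (L q)) (x, y) (1, 0)
      = velocity (V := V) (fun ξ => L (ξ, y)) x :=
  ((hL.contDiffAt_oneChart (by rw [h1]; exact one_mem_oneChart_source V G)).differentiableAt
    (by simp)).hasDerivAt_left.deriv.symm

lemma fderiv_oneChart_right {L : ℝ × ℝ → G} {x y : ℝ}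
    (hL : ContMDiffAt 𝓘(ℝ, ℝ × ℝ) 𝓘(ℝ, V) ∞ L (x, y)) (h1 : L (x, y) = 1) :
    fderiv ℝ (fun q => oneChart V G (L q)) (x, y) (0, 1)
      = velocity (V := V) (fun η => L (x, η)) y :=
  ((hL.contDiffAt_oneChart (by rw [h1]; exact one_mem_oneChart_source V G)).differentiableAt
    (by simp)).hasDerivAt_right.deriv.symm

lemma hasDerivAt_velocity_right {L : ℝ × ℝ → G} {x y : ℝ}
    (hL : ContMDiffAt 𝓘(ℝ, ℝ × ℝ) 𝓘(ℝ, V) ∞ L (x, y)) (h1 : L (x, y) = 1) :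
    HasDerivAt (fun ξ => velocity (V := V) (fun η => L (ξ, η)) y)
      (mixedPartial (fun q => oneChart V G (L q)) (x, y)) x :=
  (hL.contDiffAt_oneChart
    (by rw [h1]; exact one_mem_oneChart_source V G)).hasDerivAt_deriv_right

lemma hasDerivAt_velocity_left {L : ℝ × ℝ → G} {x y : ℝ}
    (hL : ContMDiffAt 𝓘(ℝ, ℝ × ℝ) 𝓘(ℝ, V) ∞ L (x, y)) (h1 : L (x, y) = 1) :
    HasDerivAt (fun η => velocity (V := V) (fun ξ => L (ξ, η)) x)
      (mixedPartial (fun q => oneChart V G (L q)) (x, y)) y :=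
  (hL.contDiffAt_oneChart
    (by rw [h1]; exact one_mem_oneChart_source V G)).hasDerivAt_deriv_left

/-- The mixed partial derivative of the holonomy around a rectangle, at the degenerate rectangle. -/
theorem mixedPartial_commutator {F K : ℝ × ℝ → G} (hF : ContMDiff 𝓘(ℝ, ℝ × ℝ) 𝓘(ℝ, V) ∞ F)
    (hK : ContMDiff 𝓘(ℝ, ℝ × ℝ) 𝓘(ℝ, V) ∞ K) {x y : ℝ} (hF1 : ∀ η, F (x, η) = 1)
    (hK1 : ∀ ξ, K (ξ, y) = 1) :
    mixedPartial (fun q => oneChart V G ((K (x, q.2))⁻¹ * (F q)⁻¹ * K q * F (q.1, y))) (x, y)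
      = mixedPartial (fun q => oneChart V G (K q)) (x, y)
        - mixedPartial (fun q => oneChart V G (F q)) (x, y)
        + (chartMulBilin V G (velocity (V := V) (fun η => K (x, η)) y)
            (velocity (V := V) (fun ξ => F (ξ, y)) x)
          - chartMulBilin V G (velocity (V := V) (fun ξ => F (ξ, y)) x)
            (velocity (V := V) (fun η => K (x, η)) y)) := by
  set A := velocity (V := V) (fun ξ => F (ξ, y)) x with hA
  set C := velocity (V := V) (fun η => K (x, η)) y with hC
  let F₁ : ℝ × ℝ → G := fun q => F (q.1, y)
  let K₁ : ℝ × ℝ → G := fun q => K (x, q.2)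
  let S : ℝ × ℝ → G := fun q => (K₁ q)⁻¹ * (F q)⁻¹ * K q * F₁ q
  let T : ℝ × ℝ → G := fun q => K₁ q * S q
  have hF₁ : ContMDiff 𝓘(ℝ, ℝ × ℝ) 𝓘(ℝ, V) ∞ F₁ :=
    hF.comp (by fun_prop : ContDiff ℝ ∞ (fun q : ℝ × ℝ => (q.1, y))).contMDiff
  have hK₁ : ContMDiff 𝓘(ℝ, ℝ × ℝ) 𝓘(ℝ, V) ∞ K₁ :=
    hK.comp (by fun_prop : ContDiff ℝ ∞ (fun q : ℝ × ℝ => (x, q.2))).contMDiff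
  have hS : ContMDiff 𝓘(ℝ, ℝ × ℝ) 𝓘(ℝ, V) ∞ S := ((hK₁.inv.mul hF.inv).mul hK).mul hF₁
  have hT : ContMDiff 𝓘(ℝ, ℝ × ℝ) 𝓘(ℝ, V) ∞ T := hK₁.mul hS
  have hSx : ∀ η, S (x, η) = 1 := fun η => by simp [S, K₁, F₁, hF1]
  have hSy : ∀ ξ, S (ξ, y) = 1 := fun ξ => by simp [S, K₁, F₁, hK1]
  have hTx : ∀ η, T (x, η) = K (x, η) := fun η => by simp [T, hSx, K₁]
  have hTy : ∀ ξ, T (ξ, y) = 1 := fun ξ => by simp [T, hSy, K₁, hK1]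
  -- Expanding the mixed partial of both sides avoids inverses and fourfold products. The functions
  -- `F₁` and `K₁` depend on one variable only, so their mixed partials vanish; the two orders of
  -- multiplication leave the antisymmetrised bilinear term.
  have hprod : (fun q => F q * T q) = fun q => K q * F₁ q := by
    ext q; simp [T, S, mul_assoc]
  have hMF₁ : mixedPartial (fun q => oneChart V G (F₁ q)) (x, y) = 0 := by
    rw [← (hasDerivAt_velocity_right (hF₁ (x, y)) (hF1 y)).deriv]
    simp [F₁, velocity_const]
  have hMK₁ : mixedPartial (fun q => oneChart V G (K₁ q)) (x, y) = 0 := by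
    rw [← (hasDerivAt_velocity_right (hK₁ (x, y)) (hK1 x)).deriv]
    simp [K₁]
  have e1 := mixedPartial_mul (hF (x, y)) (hT (x, y)) (hF1 y) (hTy x)
  have e2 := mixedPartial_mul (hK (x, y)) (hF₁ (x, y)) (hK1 x) (hF1 y)
  have e3 := mixedPartial_mul (hK₁ (x, y)) (hS (x, y)) (hK1 x) (hSy x)
  rw [fderiv_oneChart_left (hF (x, y)) (hF1 y), fderiv_oneChart_right (hF (x, y)) (hF1 y),
    fderiv_oneChart_left (hT (x, y)) (hTy x), fderiv_oneChart_right (hT (x, y)) (hTy x)] at e1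
  rw [fderiv_oneChart_left (hK (x, y)) (hK1 x), fderiv_oneChart_right (hK (x, y)) (hK1 x),
    fderiv_oneChart_left (hF₁ (x, y)) (hF1 y), fderiv_oneChart_right (hF₁ (x, y)) (hF1 y)] at e2
  rw [fderiv_oneChart_left (hS (x, y)) (hSy x), fderiv_oneChart_right (hS (x, y)) (hSy x)] at e3
  simp only [hF1, hTx, hTy, velocity_const, chartMulBilin_zero_left, add_zero] at e1
  simp only [hK1, F₁, velocity_const, chartMulBilin_zero_left, zero_add] at e2
  simp only [hSx, hSy, velocity_const, chartMulBilin_zero_right, add_zero] at e3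
  have e3' : mixedPartial (fun q => oneChart V G (T q)) (x, y)
      = mixedPartial (fun q => oneChart V G (S q)) (x, y) := by
    rw [hMK₁, zero_add] at e3
    exact e3
  have e2' : mixedPartial (fun q => oneChart V G (K q * F₁ q)) (x, y)
      = mixedPartial (fun q => oneChart V G (K q)) (x, y) + chartMulBilin V G C A := by
    have h0 : mixedPartial (fun q => oneChart V G (F (q.1, y))) (x, y) = 0 := hMF₁
    rw [h0, add_zero] at e2
    exact e2
  have e0 : mixedPartial (fun q => oneChart V G (F q * T q)) (x, y)
      = mixedPartial (fun q => oneChart V G (K q * F₁ q)) (x, y) := by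
    have := congrArg (fun L : ℝ × ℝ → G => mixedPartial (fun q => oneChart V G (L q)) (x, y)) hprod
    exact this
  rw [e1, e2', e3'] at e0
  change mixedPartial (fun q => oneChart V G (S q)) (x, y) = _
  rw [← hA, ← hC] at e0
  have := eq_sub_of_add_eq e0
  rw [eq_sub_of_add_eq' this]
  abel

end GroupCommutator

/-! ### Differentials of a crossed module and the infinitesimal data of a cocycle -/

namespace LieCrossedModule

variable {V U : Type*}
  [NormedAddCommGroup V] [NormedSpace ℝ V] [NormedAddCommGroup U] [NormedSpace ℝ U]
  {G H : Type*} [TopologicalSpace G] [ChartedSpace V G] [Group G] [LieGroup 𝓘(ℝ, V) ∞ G]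
  [TopologicalSpace H] [ChartedSpace U H] [Group H] [LieGroup 𝓘(ℝ, U) ∞ H]

/-- `ṫ` as a continuous linear map between the model spaces. -/
def tDotL (X : LieCrossedModule V U G H) : U →L[ℝ] V :=
  mfderiv 𝓘(ℝ, U) 𝓘(ℝ, V) X.t (1 : H)

/-- `ṁ(a)` as a continuous linear endomorphism of the model space. -/
def mDotL (X : LieCrossedModule V U G H) (a : G) : U →L[ℝ] U :=
  mfderiv 𝓘(ℝ, U) 𝓘(ℝ, U) (X.m a) (1 : H)

variable (X : LieCrossedModule V U G H)

lemma contMDiffAt_m {E : Type*} [NormedAddCommGroup E] [NormedSpace ℝ E] {a : E → G} {A : E → H}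
    {p : E} (ha : ContMDiffAt 𝓘(ℝ, E) 𝓘(ℝ, V) ∞ a p) (hA : ContMDiffAt 𝓘(ℝ, E) 𝓘(ℝ, U) ∞ A p) :
    ContMDiffAt 𝓘(ℝ, E) 𝓘(ℝ, U) ∞ (fun q => X.m (a q) (A q)) p :=
  ContMDiffAt.comp p (f := fun q => (a q, A q)) (X.contMDiff_m.contMDiffAt) (ha.prodMk hA)

lemma contMDiff_m_const (a : G) : ContMDiff 𝓘(ℝ, U) 𝓘(ℝ, U) ∞ (X.m a) :=
  X.contMDiff_m.comp (contMDiff_const.prodMk contMDiff_id : ContMDiff 𝓘(ℝ, U)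
    (𝓘(ℝ, V).prod 𝓘(ℝ, U)) ∞ (fun A : H => (a, A)))

lemma velocity_m (a : G) {c : ℝ → H} {s : ℝ} (hc : ContMDiffAt 𝓘(ℝ, ℝ) 𝓘(ℝ, U) ∞ c s)
    (hs : c s = 1) :
    velocity (V := U) (fun τ => X.m a (c τ)) s = X.mDotL a (velocity (V := U) c s) :=
  velocity_comp (X.contMDiff_m_const a).contMDiffAt (map_one _) hc hs

lemma velocity_t {c : ℝ → H} {s : ℝ} (hc : ContMDiffAt 𝓘(ℝ, ℝ) 𝓘(ℝ, U) ∞ c s)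
    (hs : c s = 1) :
    velocity (V := V) (fun τ => X.t (c τ)) s = X.tDotL (velocity (V := U) c s) :=
  velocity_comp X.contMDiff_t.contMDiffAt (map_one _) hc hs

lemma mDotL_mul (a b : G) (Z : U) : X.mDotL (a * b) Z = X.mDotL a (X.mDotL b Z) := by
  obtain ⟨c, hc, hc1, rfl⟩ := exists_velocity_eq (G := H) Z
  have h : ContMDiffAt 𝓘(ℝ, ℝ) 𝓘(ℝ, U) ∞ (fun τ => X.m b (c τ)) 0 :=
    X.contMDiffAt_m contMDiffAt_const hc
  rw [← X.velocity_m _ hc hc1, ← X.velocity_m _ hc hc1, ← X.velocity_m _ h (by simp [hc1])]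
  simp

@[simp]
lemma mDotL_one (Z : U) : X.mDotL 1 Z = Z := by
  obtain ⟨c, hc, hc1, rfl⟩ := exists_velocity_eq (G := H) Z
  rw [← X.velocity_m _ hc hc1]
  simp

lemma tDotL_mDotL (a : G) (Z : U) : X.tDotL (X.mDotL a Z) = adjoint V a (X.tDotL Z) := by
  obtain ⟨c, hc, hc1, rfl⟩ := exists_velocity_eq (G := H) Z
  have h : ContMDiffAt 𝓘(ℝ, ℝ) 𝓘(ℝ, U) ∞ (fun τ => X.m a (c τ)) 0 :=
    X.contMDiffAt_m contMDiffAt_const hc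
  have h' : ContMDiffAt 𝓘(ℝ, ℝ) 𝓘(ℝ, V) ∞ (fun τ => X.t (c τ)) 0 :=
    X.contMDiff_t.contMDiffAt.comp 0 hc
  rw [← X.velocity_m _ hc hc1, ← X.velocity_t h (by simp [hc1]), ← X.velocity_t hc hc1,
    ← velocity_conj _ h' (by simp [hc1])]
  simp [X.t_m]

lemma rlog_t {c : ℝ → H} {s : ℝ} (hc : ContMDiffAt 𝓘(ℝ, ℝ) 𝓘(ℝ, U) ∞ c s) :
    rlog V (fun τ => X.t (c τ)) s = X.tDotL (rlog U c s) := by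
  rw [rlog, rlog, ← X.velocity_t (c := fun τ => c τ * (c s)⁻¹) (hc.mul contMDiffAt_const)
    (by simp)]
  simp

/-- Smooth dependence of `ṁ(a)(Z)` on a parameter. -/
lemma contDiff_mDotL {E : Type*} [NormedAddCommGroup E] [NormedSpace ℝ E] {a : E → G} {Z : E → U}
    (ha : ContMDiff 𝓘(ℝ, E) 𝓘(ℝ, V) ∞ a) (hZ : ContDiff ℝ ∞ Z) :
    ContDiff ℝ ∞ (fun p => X.mDotL (a p) (Z p)) := by
  rw [contDiff_iff_contDiffAt]
  intro p
  -- Coordinate lines in direction `Z q` form a smooth family of curves with velocity `Z q`, so that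
  -- `ṁ(a q)(Z q)` is the velocity of a smooth family.
  let γ : ℝ × E → U := fun q => oneChart U H 1 + q.1 • Z q.2
  have hγ : ContDiff ℝ ∞ γ :=
    contDiff_const.add (contDiff_fst.smul (hZ.comp contDiff_snd))
  have hγ0 : ∀ q : E, γ (0, q) = oneChart U H 1 := fun q => by simp [γ]
  have htarget : ∀ q : E, γ (0, q) ∈ (oneChart U H).target := fun q => by
    rw [hγ0]
    exact mem_of_mem_nhds (oneChart_target_mem_nhds U H)
  have hc : ∀ q : E, ContMDiffAt 𝓘(ℝ, ℝ × E) 𝓘(ℝ, U) ∞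
      (fun r : ℝ × E => (oneChart U H).symm (γ r)) (0, q) := fun q =>
    ContMDiffAt.comp (0, q) (contMDiffAt_oneChart_symm (htarget q)) hγ.contDiffAt.contMDiffAt
  have hvel : ∀ q : E, velocity (V := U) (fun τ => (oneChart U H).symm (γ (τ, q))) 0 = Z q := by
    intro q
    have h1 : HasDerivAt (fun τ => γ (τ, q)) (Z q) 0 := by
      have := ((hasDerivAt_id (0 : ℝ)).smul_const (Z q)).const_add (oneChart U H 1)
      rwa [one_smul] at this
    refine (h1.congr_of_eventuallyEq ?_).deriv
    have hcont : ContinuousAt (fun τ => γ (τ, q)) 0 :=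
      (hγ.continuous.comp (by fun_prop : Continuous fun τ : ℝ => (τ, q))).continuousAt
    filter_upwards [hcont.preimage_mem_nhds
      ((isOpen_oneChart_target U H).mem_nhds (htarget q))] with τ hτ
    exact (oneChart U H).right_inv hτ
  have hm : ContMDiffAt 𝓘(ℝ, ℝ × E) 𝓘(ℝ, U) ∞
      (fun r : ℝ × E => X.m (a r.2) ((oneChart U H).symm (γ r))) (0, p) :=
    X.contMDiffAt_m ((ha p).comp (0, p) contDiffAt_snd.contMDiffAt) (hc p)
  have hmain := contDiffAt_velocity (σ := fun _ : E => (0 : ℝ)) hm contDiffAt_const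
    (by simp [hγ0])
  have heq : (fun q => velocity (V := U)
      (fun τ => X.m (a q) ((oneChart U H).symm (γ (τ, q)))) 0) = fun q => X.mDotL (a q) (Z q) := by
    funext q
    rw [X.velocity_m (a q) (hc q).curve_left (by simp [hγ0]), hvel]
  rw [← heq]
  exact hmain

namespace Cocycle

variable {X} (c : X.Cocycle)

lemma f_self (x y : ℝ) : c.f x x y = 1 := by
  have h := c.f_comp x x x y
  rwa [left_eq_mul] at h

lemma g_self (x y : ℝ) : c.g x y y = 1 := by
  have h := c.g_comp x y y y
  rwa [left_eq_mul] at h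

lemma W_self_x (x y' y : ℝ) : c.W x x y' y = 1 := by
  have h := c.W_comp_x x x x y' y
  rw [f_self, inv_one, map_one, MulAut.one_apply, left_eq_mul] at h
  exact h

lemma W_self_y (x' x y : ℝ) : c.W x' x y y = 1 := by
  have h := c.W_comp_y x' x y y y
  rw [g_self, inv_one, map_one, MulAut.one_apply, left_eq_mul] at h
  exact h

section Smooth

variable {E : Type*} [NormedAddCommGroup E] [NormedSpace ℝ E] {α β γ δ : E → ℝ}

lemma contMDiff_f_comp (hα : ContDiff ℝ ∞ α) (hβ : ContDiff ℝ ∞ β) (hγ : ContDiff ℝ ∞ γ) :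
    ContMDiff 𝓘(ℝ, E) 𝓘(ℝ, V) ∞ (fun p => c.f (α p) (β p) (γ p)) :=
  c.contMDiff_f.comp (hα.prodMk (hβ.prodMk hγ)).contMDiff

lemma contMDiff_g_comp (hα : ContDiff ℝ ∞ α) (hβ : ContDiff ℝ ∞ β) (hγ : ContDiff ℝ ∞ γ) :
    ContMDiff 𝓘(ℝ, E) 𝓘(ℝ, V) ∞ (fun p => c.g (α p) (β p) (γ p)) :=
  c.contMDiff_g.comp (hα.prodMk (hβ.prodMk hγ)).contMDiff

lemma contMDiff_W_comp (hα : ContDiff ℝ ∞ α) (hβ : ContDiff ℝ ∞ β) (hγ : ContDiff ℝ ∞ γ)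
    (hδ : ContDiff ℝ ∞ δ) :
    ContMDiff 𝓘(ℝ, E) 𝓘(ℝ, U) ∞ (fun p => c.W (α p) (β p) (γ p) (δ p)) :=
  c.contMDiff_W.comp (hα.prodMk (hβ.prodMk (hγ.prodMk hδ))).contMDiff

end Smooth

/-- The component `a_x` of the doublet of a cocycle. -/
def ax (p : ℝ × ℝ) : V :=
  -velocity (V := V) (fun x' => c.f x' p.1 p.2) p.1

/-- The component `a_y` of the doublet of a cocycle. -/
def ay (p : ℝ × ℝ) : V :=
  -velocity (V := V) (fun y' => c.g p.1 y' p.2) p.2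

/-- The component `B_{xy}` of the doublet of a cocycle. -/
def Bxy (p : ℝ × ℝ) : U :=
  -mixedPartial (fun q : ℝ × ℝ => oneChart U H (c.W q.1 p.1 q.2 p.2)) p

lemma contDiff_ax : ContDiff ℝ ∞ c.ax := by
  rw [contDiff_iff_contDiffAt]
  intro p
  have h : ContMDiff 𝓘(ℝ, ℝ × ℝ × ℝ) 𝓘(ℝ, V) ∞
      (fun r : ℝ × ℝ × ℝ => c.f r.1 r.2.1 r.2.2) := c.contMDiff_f
  exact (contDiffAt_velocity (E := ℝ × ℝ) (σ := Prod.fst) (h (p.1, p)) contDiffAt_fst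
    (c.f_self _ _)).neg

lemma contDiff_ay : ContDiff ℝ ∞ c.ay := by
  rw [contDiff_iff_contDiffAt]
  intro p
  have h : ContMDiff 𝓘(ℝ, ℝ × ℝ × ℝ) 𝓘(ℝ, V) ∞
      (fun r : ℝ × ℝ × ℝ => c.g r.2.1 r.1 r.2.2) :=
    c.contMDiff_g_comp (by fun_prop) (by fun_prop) (by fun_prop)
  exact (contDiffAt_velocity (E := ℝ × ℝ) (σ := Prod.snd) (h (p.2, p)) contDiffAt_snd
    (c.g_self _ _)).neg

lemma contMDiff_W_plaquette (x y : ℝ) :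
    ContMDiff 𝓘(ℝ, ℝ × ℝ) 𝓘(ℝ, U) ∞ (fun q : ℝ × ℝ => c.W q.1 x q.2 y) :=
  c.contMDiff_W_comp (by fun_prop) (by fun_prop) (by fun_prop) (by fun_prop)

lemma hasDerivAt_velocity_W_right (x y : ℝ) :
    HasDerivAt (fun ξ => velocity (V := U) (fun η => c.W ξ x η y) y) (-c.Bxy (x, y)) x := by
  rw [Bxy, neg_neg]
  exact hasDerivAt_velocity_right (c.contMDiff_W_plaquette x y (x, y)) (c.W_self_x x y y)

lemma hasDerivAt_velocity_W_left (x y : ℝ) :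
    HasDerivAt (fun η => velocity (V := U) (fun ξ => c.W ξ x η y) x) (-c.Bxy (x, y)) y := by
  rw [Bxy, neg_neg]
  exact hasDerivAt_velocity_left (c.contMDiff_W_plaquette x y (x, y)) (c.W_self_x x y y)

lemma contDiff_Bxy : ContDiff ℝ ∞ c.Bxy := by
  -- In `Bxy` the base point of the plaquette moves with the argument. Separating the moving corner
  -- `ξ` from the base point exhibits `-Bxy` as a partial derivative of a smooth function,
  -- restricted to the diagonal.
  let ν : ℝ × ℝ × ℝ → U := fun r => velocity (V := U) (fun η => c.W r.1 r.2.1 η r.2.2) r.2.2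
  have hν : ContDiff ℝ ∞ ν := by
    rw [contDiff_iff_contDiffAt]
    intro r
    have h : ContMDiff 𝓘(ℝ, ℝ × ℝ × ℝ × ℝ) 𝓘(ℝ, U) ∞
        (fun s : ℝ × ℝ × ℝ × ℝ => c.W s.2.1 s.2.2.1 s.1 s.2.2.2) :=
      c.contMDiff_W_comp (by fun_prop) (by fun_prop) (by fun_prop) (by fun_prop)
    exact contDiffAt_velocity (E := ℝ × ℝ × ℝ) (σ := fun r => r.2.2) (h (r.2.2, r))
      (by fun_prop) (c.W_self_y _ _ _)
  have h1 : ∀ p, c.Bxy p = -fderiv ℝ ν (p.1, p) (1, 0) := by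
    intro p
    have h2 : HasDerivAt (fun ξ : ℝ => ν (ξ, p)) (fderiv ℝ ν (p.1, p) (1, 0)) p.1 :=
      HasFDerivAt.comp_hasDerivAt p.1 (f := fun ξ : ℝ => (ξ, p))
        (hν.differentiable (by simp) (p.1, p)).hasFDerivAt
        ((hasDerivAt_id p.1).prodMk (hasDerivAt_const p.1 p))
    rw [← (c.hasDerivAt_velocity_W_right p.1 p.2).unique h2, neg_neg]
  have h3 : ContDiff ℝ ∞ (fun p : ℝ × ℝ => -fderiv ℝ ν (p.1, p) (1, 0)) := by
    have h4 : ContDiff ℝ ∞ (fun p : ℝ × ℝ => fderiv ℝ ν (p.1, p)) :=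
      (hν.fderiv_right (m := ∞) (by simp)).comp (contDiff_fst.prodMk contDiff_id)
    exact (h4.clm_apply contDiff_const).neg
  rwa [← funext h1] at h3

/-- The curvature equation for the components of the doublet of a cocycle. -/
theorem tDotL_Bxy (x y : ℝ) :
    X.tDotL (c.Bxy (x, y)) = fderiv ℝ c.ay (x, y) (1, 0) - fderiv ℝ c.ax (x, y) (0, 1)
      + (chartMulBilin V G (c.ax (x, y)) (c.ay (x, y))
        - chartMulBilin V G (c.ay (x, y)) (c.ax (x, y))) := by
  let F : ℝ × ℝ → G := fun q => c.f q.1 x q.2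
  let K : ℝ × ℝ → G := fun q => c.g q.1 q.2 y
  have hF : ContMDiff 𝓘(ℝ, ℝ × ℝ) 𝓘(ℝ, V) ∞ F :=
    c.contMDiff_f_comp (by fun_prop) (by fun_prop) (by fun_prop)
  have hK : ContMDiff 𝓘(ℝ, ℝ × ℝ) 𝓘(ℝ, V) ∞ K :=
    c.contMDiff_g_comp (by fun_prop) (by fun_prop) (by fun_prop)
  have hF1 : ∀ η, F (x, η) = 1 := fun η => c.f_self x η
  have hK1 : ∀ ξ, K (ξ, y) = 1 := fun ξ => c.g_self ξ y
  -- By the target law this rectangle holonomy is `t(W)`, whose mixed partial is `-ṫ(B_{xy})`. The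
  -- minus signs in `a_x` and `a_y` cancel in the bilinear terms.
  have hcomm := mixedPartial_commutator hF hK hF1 hK1
  have htW : ∀ q : ℝ × ℝ, (K (x, q.2))⁻¹ * (F q)⁻¹ * K q * F (q.1, y) = X.t (c.W q.1 x q.2 y) :=
    fun q => (c.target q.1 x q.2 y).symm
  simp only [htW] at hcomm
  have hW := c.contMDiff_W_plaquette x y
  have h1 : mixedPartial (fun q : ℝ × ℝ => oneChart V G (X.t (c.W q.1 x q.2 y))) (x, y)
      = -X.tDotL (c.Bxy (x, y)) := by
    have h2 := hasDerivAt_velocity_right (L := fun q : ℝ × ℝ => X.t (c.W q.1 x q.2 y))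
      ((X.contMDiff_t.comp hW) (x, y)) (by simp [c.W_self_x])
    have h3 := X.tDotL.hasFDerivAt.comp_hasDerivAt x (c.hasDerivAt_velocity_W_right x y)
    rw [← map_neg]
    refine h2.unique (h3.congr_of_eventuallyEq (Eventually.of_forall fun ξ => ?_))
    exact X.velocity_t (hW (ξ, y)).curve_right (c.W_self_y _ _ _)
  have h4 : mixedPartial (fun q => oneChart V G (K q)) (x, y) = -fderiv ℝ c.ay (x, y) (1, 0) := by
    have h5 := hasDerivAt_velocity_right (hK (x, y)) (hK1 x)
    have h6 := (c.contDiff_ay.differentiable (by simp) (x, y)).hasDerivAt_left.neg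
    refine h5.unique (h6.congr_of_eventuallyEq (Eventually.of_forall fun ξ => ?_))
    simp [ay, K]
  have h7 : mixedPartial (fun q => oneChart V G (F q)) (x, y) = -fderiv ℝ c.ax (x, y) (0, 1) := by
    have h5 := hasDerivAt_velocity_left (hF (x, y)) (hF1 y)
    have h6 := (c.contDiff_ax.differentiable (by simp) (x, y)).hasDerivAt_right.neg
    refine h5.unique (h6.congr_of_eventuallyEq (Eventually.of_forall fun η => ?_))
    simp [ax, F]
  have h8 : velocity (V := V) (fun ξ => F (ξ, y)) x = (-1 : ℝ) • c.ax (x, y) := by simp [ax, F]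
  have h9 : velocity (V := V) (fun η => K (x, η)) y = (-1 : ℝ) • c.ay (x, y) := by simp [ay, K]
  rw [h1, h4, h7, h8, h9, chartMulBilin_smul_left, chartMulBilin_smul_right,
    chartMulBilin_smul_left, chartMulBilin_smul_right] at hcomm
  rw [← neg_inj, hcomm]
  module

end Cocycle

end LieCrossedModule

/-! ### Logarithmic derivatives of two-parameter families -/

lemma eq_of_hasDerivAt_eq {F : Type*} [NormedAddCommGroup F] [NormedSpace ℝ F] {h k h' : ℝ → F}
    (hh : ∀ x, HasDerivAt h (h' x) x) (hk : ∀ x, HasDerivAt k (h' x) x) {x₀ : ℝ}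
    (h₀ : h x₀ = k x₀) : h = k := by
  have hd : ∀ x, HasDerivAt (fun x => h x - k x) 0 x := fun x => by
    have := (hh x).sub (hk x)
    rwa [sub_self] at this
  funext x
  have := is_const_of_deriv_eq_zero (fun x => (hd x).differentiableAt) (fun x => (hd x).deriv) x x₀
  rwa [h₀, sub_self, sub_eq_zero] at this

section LogDeriv

variable {V : Type*} [NormedAddCommGroup V] [NormedSpace ℝ V]
  {G : Type*} [TopologicalSpace G] [ChartedSpace V G] [Group G] [LieGroup 𝓘(ℝ, V) ∞ G]

lemma contDiff_rlog_right {w : ℝ × ℝ → G} (hw : ContMDiff 𝓘(ℝ, ℝ × ℝ) 𝓘(ℝ, V) ∞ w) :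
    ContDiff ℝ ∞ (fun p : ℝ × ℝ => rlog V (fun η => w (p.1, η)) p.2) := by
  rw [contDiff_iff_contDiffAt]
  intro p
  have h1 : ContMDiff 𝓘(ℝ, ℝ × ℝ × ℝ) 𝓘(ℝ, V) ∞
      (fun r : ℝ × ℝ × ℝ => w (r.2.1, r.1) * (w r.2)⁻¹) :=
    (hw.comp (by fun_prop : ContDiff ℝ ∞
      (fun r : ℝ × ℝ × ℝ => (r.2.1, r.1))).contMDiff).mul (hw.comp contDiff_snd.contMDiff).inv
  exact contDiffAt_velocity (E := ℝ × ℝ) (σ := Prod.snd) (h1 (p.2, p)) contDiffAt_snd (by simp)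

lemma contDiff_llog_left {w : ℝ × ℝ → G} (hw : ContMDiff 𝓘(ℝ, ℝ × ℝ) 𝓘(ℝ, V) ∞ w) :
    ContDiff ℝ ∞ (fun p : ℝ × ℝ => llog V (fun ξ => w (ξ, p.2)) p.1) := by
  rw [contDiff_iff_contDiffAt]
  intro p
  have h1 : ContMDiff 𝓘(ℝ, ℝ × ℝ × ℝ) 𝓘(ℝ, V) ∞
      (fun r : ℝ × ℝ × ℝ => (w r.2)⁻¹ * w (r.1, r.2.2)) :=
    (hw.comp contDiff_snd.contMDiff).inv.mul (hw.comp (by fun_prop : ContDiff ℝ ∞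
      (fun r : ℝ × ℝ × ℝ => (r.1, r.2.2))).contMDiff)
  exact contDiffAt_velocity (E := ℝ × ℝ) (σ := Prod.fst) (h1 (p.1, p)) contDiffAt_fst (by simp)

lemma differentiable_rlog_right {w : ℝ × ℝ → G} (hw : ContMDiff 𝓘(ℝ, ℝ × ℝ) 𝓘(ℝ, V) ∞ w)
    (y : ℝ) : Differentiable ℝ (fun ξ => rlog V (fun η => w (ξ, η)) y) := fun x =>
  ((contDiff_rlog_right hw).differentiable (by simp) (x, y)).hasDerivAt_left.differentiableAt

lemma differentiable_llog_left {w : ℝ × ℝ → G} (hw : ContMDiff 𝓘(ℝ, ℝ × ℝ) 𝓘(ℝ, V) ∞ w)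
    (x : ℝ) : Differentiable ℝ (fun η => llog V (fun ξ => w (ξ, η)) x) := fun y =>
  ((contDiff_llog_left hw).differentiable (by simp) (x, y)).hasDerivAt_right.differentiableAt

lemma deriv_rightLogDeriv_eq {E : ℝ → ℝ → G}
    (hE : ContMDiff 𝓘(ℝ, ℝ × ℝ) 𝓘(ℝ, V) ∞ (fun p : ℝ × ℝ => E p.1 p.2)) (x y : ℝ) :
    (deriv (fun ξ => rightLogDeriv (V := V) (fun η => E ξ η) y) x : V)
      = deriv (fun ξ => rlog V (fun η => E ξ η) y) x := by
  have h : ((fun ξ => rightLogDeriv (V := V) (fun η => E ξ η) y) : ℝ → V)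
      = fun ξ => rlog V (fun η => E ξ η) y :=
    funext fun ξ => rightLogDeriv_eq_velocity (hE (ξ, y)).curve_right
  exact congrArg (fun k : ℝ → V => deriv k x) h

lemma deriv_leftLogDeriv_eq {E : ℝ → ℝ → G}
    (hE : ContMDiff 𝓘(ℝ, ℝ × ℝ) 𝓘(ℝ, V) ∞ (fun p : ℝ × ℝ => E p.1 p.2)) (x y : ℝ) :
    (deriv (fun η => leftLogDeriv (V := V) (fun ξ => E ξ η) x) y : V)
      = deriv (fun η => llog V (fun ξ => E ξ η) x) y := by
  have h : ((fun η => leftLogDeriv (V := V) (fun ξ => E ξ η) x) : ℝ → V)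
      = fun η => llog V (fun ξ => E ξ η) x :=
    funext fun η => leftLogDeriv_eq_velocity (hE (x, η)).curve_left
  exact congrArg (fun k : ℝ → V => deriv k y) h

end LogDeriv

/-! ### The doublet of a cocycle and its differential equations -/

namespace LieCrossedModule

variable {V U : Type*}
  [NormedAddCommGroup V] [NormedSpace ℝ V] [NormedAddCommGroup U] [NormedSpace ℝ U]
  {G H : Type*} [TopologicalSpace G] [ChartedSpace V G] [Group G] [LieGroup 𝓘(ℝ, V) ∞ G]
  [TopologicalSpace H] [ChartedSpace U H] [Group H] [LieGroup 𝓘(ℝ, U) ∞ H]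
  {X : LieCrossedModule V U G H}

/-- The vanishing of the fake curvature, in components. -/
lemma fake_flat_iff {a : ℝ × ℝ → (ℝ × ℝ) [⋀^Fin 1]→L[ℝ] V}
    {B : ℝ × ℝ → (ℝ × ℝ) [⋀^Fin 2]→L[ℝ] U} {p : ℝ × ℝ} (ha : DifferentiableAt ℝ a p) :
    (∀ v w : ℝ × ℝ, toLieAlgebra G (extDeriv a p ![v, w])
      + (1 / 2 : ℝ) • (⁅toLieAlgebra G (a p ![v]), toLieAlgebra G (a p ![w])⁆
        - ⁅toLieAlgebra G (a p ![w]), toLieAlgebra G (a p ![v])⁆)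
      - X.tDot (toLieAlgebra H (B p ![v, w])) = 0) ↔
    X.tDotL (B p ![(1, 0), (0, 1)])
      = fderiv ℝ (fun q => a q ![(0, 1)]) p (1, 0) - fderiv ℝ (fun q => a q ![(1, 0)]) p (0, 1)
        + (chartMulBilin V G (a p ![(1, 0)]) (a p ![(0, 1)])
          - chartMulBilin V G (a p ![(0, 1)]) (a p ![(1, 0)])) := by
  set R : V := fderiv ℝ (fun q => a q ![(0, 1)]) p (1, 0)
    - fderiv ℝ (fun q => a q ![(1, 0)]) p (0, 1)
        + (chartMulBilin V G (a p ![(1, 0)]) (a p ![(0, 1)])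
          - chartMulBilin V G (a p ![(0, 1)]) (a p ![(1, 0)])) with hR
  have hb : ∀ Z Z' : V, (⁅toLieAlgebra G Z, toLieAlgebra G Z'⁆ : GroupLieAlgebra 𝓘(ℝ, V) G)
      = (chartMulBilin V G Z Z' - chartMulBilin V G Z' Z : V) := fun Z Z' =>
    bracket_eq_chartMulBilin _ _
  -- The expression is alternating in `v, w`, hence a multiple of the area form. The factor `1 / 2`
  -- compensates the doubling in `[a, a]`.
  have hexpr : ∀ v w : ℝ × ℝ, (toLieAlgebra G (extDeriv a p ![v, w])
      + (1 / 2 : ℝ) • (⁅toLieAlgebra G (a p ![v]), toLieAlgebra G (a p ![w])⁆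
        - ⁅toLieAlgebra G (a p ![w]), toLieAlgebra G (a p ![v])⁆)
      - X.tDot (toLieAlgebra H (B p ![v, w])) : GroupLieAlgebra 𝓘(ℝ, V) G)
      = ((v.1 * w.2 - v.2 * w.1) • (R - X.tDotL (B p ![(1, 0), (0, 1)])) : V) := by
    intro v w
    rw [hb, hb]
    change (extDeriv a p ![v, w] + (1 / 2 : ℝ) •
      ((chartMulBilin V G (a p ![v]) (a p ![w]) - chartMulBilin V G (a p ![w]) (a p ![v]))
      - (chartMulBilin V G (a p ![w]) (a p ![v]) - chartMulBilin V G (a p ![v]) (a p ![w])))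
      - X.tDotL (B p ![v, w]) : V) = _
    rw [twoForm_apply (extDeriv a p), twoForm_apply (B p) v w, extDeriv_oneForm_apply ha,
      oneForm_apply (a p) v, oneForm_apply (a p) w, map_smul, hR]
    simp only [chartMulBilin_add_left, chartMulBilin_add_right, chartMulBilin_smul_left,
      chartMulBilin_smul_right]
    module
  constructor
  · intro h
    have h1 : ((((1 : ℝ), (0 : ℝ)).1 * ((0 : ℝ), (1 : ℝ)).2
        - ((1 : ℝ), (0 : ℝ)).2 * ((0 : ℝ), (1 : ℝ)).1) •
        (R - X.tDotL (B p ![(1, 0), (0, 1)])) : V) = 0 :=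
      (hexpr (1, 0) (0, 1)).symm.trans (h (1, 0) (0, 1))
    simp only [mul_one, mul_zero, sub_zero, one_smul] at h1
    exact (sub_eq_zero.1 h1).symm
  · intro h v w
    refine (hexpr v w).trans ?_
    rw [h, sub_self, smul_zero]
    rfl

namespace Cocycle

variable (c : X.Cocycle)

/-- The `1`-form `a_x dx + a_y dy` of a cocycle. -/
def formA (p : ℝ × ℝ) : (ℝ × ℝ) [⋀^Fin 1]→L[ℝ] V :=
  (ContinuousAlternatingMap.ofSubsingleton ℝ (ℝ × ℝ) ℝ (0 : Fin 1)
      (ContinuousLinearMap.fst ℝ ℝ ℝ)).smulVector V (c.ax p)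
    + (ContinuousAlternatingMap.ofSubsingleton ℝ (ℝ × ℝ) ℝ (0 : Fin 1)
      (ContinuousLinearMap.snd ℝ ℝ ℝ)).smulVector V (c.ay p)

/-- The `2`-form `B_{xy} dx ∧ dy` of a cocycle. -/
def formB (p : ℝ × ℝ) : (ℝ × ℝ) [⋀^Fin 2]→L[ℝ] U :=
  areaForm.smulVector U (c.Bxy p)

lemma formA_x (p : ℝ × ℝ) : c.formA p ![(1, 0)] = c.ax p := by
  simp [formA]

lemma formA_y (p : ℝ × ℝ) : c.formA p ![(0, 1)] = c.ay p := by
  simp [formA]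

lemma formB_xy (p : ℝ × ℝ) : c.formB p ![(1, 0), (0, 1)] = c.Bxy p := by
  simp [formB, areaForm_apply]

lemma contDiff_formA : ContDiff ℝ ∞ c.formA :=
  ((ContinuousLinearMap.contDiff _).comp c.contDiff_ax).add
    ((ContinuousLinearMap.contDiff _).comp c.contDiff_ay)

/-- The doublet of a cocycle. -/
def toDoublet : X.ConnectionDoublet where
  a := c.formA
  B := c.formB
  contDiff_a := c.contDiff_formA
  contDiff_B := (ContinuousLinearMap.contDiff _).comp c.contDiff_Bxy
  fake_flat p := by
    refine (fake_flat_iff (c.contDiff_formA.differentiable (by simp) p)).2 ?_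
    simp only [formA_x, formA_y, formB_xy]
    exact c.tDotL_Bxy p.1 p.2

/-- The composition law gives `f(τ, x₀) f(x, x₀)⁻¹ = f(τ, x)`, so the base point `x₀` disappears. -/
lemma rlog_f (x x₀ y : ℝ) : rlog V (fun ξ => c.f ξ x₀ y) x = -c.ax (x, y) := by
  rw [rlog, ax, neg_neg]
  congr 1
  funext τ
  rw [c.f_comp τ x x₀ y, mul_inv_cancel_right]

lemma rlog_g (x y y₀ : ℝ) : rlog V (fun η => c.g x η y₀) y = -c.ay (x, y) := by
  rw [rlog, ay, neg_neg]
  congr 1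
  funext τ
  rw [c.g_comp x τ y y₀, mul_inv_cancel_right]

/-- The law in `y` replaces `y₀` by `y` at the cost of `ṁ(g⁻¹)`. The law in `x` replaces `x₀` by `x`
at the cost of `ṁ(f⁻¹)` and of a summand independent of `ξ`, which the derivative removes. -/
lemma hasDerivAt_rlog_W (x x₀ y y₀ : ℝ) :
    HasDerivAt (fun ξ => rlog U (fun η => c.W ξ x₀ η y₀) y)
      (-X.mDotL ((c.g x₀ y y₀)⁻¹ * (c.f x x₀ y)⁻¹) (c.Bxy (x, y))) x := by
  have hW : ∀ ξ x₀ : ℝ, ContMDiffAt 𝓘(ℝ, ℝ) 𝓘(ℝ, U) ∞ (fun η => c.W ξ x₀ η y) y := fun ξ x₀ =>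
    c.contMDiff_W_comp (E := ℝ) contDiff_const contDiff_const contDiff_id contDiff_const y
  have h1 : ∀ ξ, rlog U (fun η => c.W ξ x₀ η y₀) y
      = X.mDotL (c.g x₀ y y₀)⁻¹ (velocity (V := U) (fun η => c.W ξ x₀ η y) y) := by
    intro ξ
    rw [← X.velocity_m _ (hW ξ x₀) (c.W_self_y _ _ _), rlog]
    congr 1
    funext τ
    rw [c.W_comp_y ξ x₀ τ y y₀, mul_inv_cancel_right]
  have h2 : ∀ ξ, velocity (V := U) (fun η => c.W ξ x₀ η y) y
      = velocity (V := U) (fun η => c.W x x₀ η y) y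
        + X.mDotL (c.f x x₀ y)⁻¹ (velocity (V := U) (fun η => c.W ξ x η y) y) := by
    intro ξ
    rw [← X.velocity_m _ (hW ξ x) (c.W_self_y _ _ _),
      ← velocity_mul (hW x x₀) (X.contMDiffAt_m contMDiffAt_const (hW ξ x)) (c.W_self_y _ _ _)
        (by simp [c.W_self_y])]
    congr 1
    funext τ
    exact c.W_comp_x ξ x x₀ τ y
  have h3 := (X.mDotL (c.g x₀ y y₀)⁻¹).hasFDerivAt.comp_hasDerivAt x
    (((X.mDotL (c.f x x₀ y)⁻¹).hasFDerivAt.comp_hasDerivAt x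
      (c.hasDerivAt_velocity_W_right x y)).const_add
        (velocity (V := U) (fun η => c.W x x₀ η y) y))
  rw [map_neg, map_neg, ← X.mDotL_mul] at h3
  refine h3.congr_of_eventuallyEq (Eventually.of_forall fun ξ => ?_)
  simp only [h1, h2 ξ, Function.comp_apply]

/-- The two composition laws exchange roles: the law in `x` has its base factor on the left and so
suits the left logarithmic derivative, and the law in `y` contributes the summand independent of
`η`. -/
lemma hasDerivAt_llog_W (x x₀ y y₀ : ℝ) :
    HasDerivAt (fun η => llog U (fun ξ => c.W ξ x₀ η y₀) x)
      (-X.mDotL ((c.f x x₀ y₀)⁻¹ * (c.g x y y₀)⁻¹) (c.Bxy (x, y))) y := by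
  have hW : ∀ η y₀ : ℝ, ContMDiffAt 𝓘(ℝ, ℝ) 𝓘(ℝ, U) ∞ (fun ξ => c.W ξ x η y₀) x := fun η y₀ =>
    c.contMDiff_W_comp (E := ℝ) contDiff_id contDiff_const contDiff_const contDiff_const x
  have h1 : ∀ η, llog U (fun ξ => c.W ξ x₀ η y₀) x
      = X.mDotL (c.f x x₀ y₀)⁻¹ (velocity (V := U) (fun ξ => c.W ξ x η y₀) x) := by
    intro η
    rw [← X.velocity_m _ (hW η y₀) (c.W_self_x _ _ _), llog]
    congr 1
    funext τ
    rw [c.W_comp_x τ x x₀ η y₀, inv_mul_cancel_left]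
  have h2 : ∀ η, velocity (V := U) (fun ξ => c.W ξ x η y₀) x
      = X.mDotL (c.g x y y₀)⁻¹ (velocity (V := U) (fun ξ => c.W ξ x η y) x)
        + velocity (V := U) (fun ξ => c.W ξ x y y₀) x := by
    intro η
    rw [← X.velocity_m _ (hW η y) (c.W_self_x _ _ _),
      ← velocity_mul (X.contMDiffAt_m contMDiffAt_const (hW η y)) (hW y y₀)
        (by simp [c.W_self_x]) (c.W_self_x _ _ _)]
    congr 1
    funext τ
    exact c.W_comp_y τ x η y y₀
  have h3 := (X.mDotL (c.f x x₀ y₀)⁻¹).hasFDerivAt.comp_hasDerivAt y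
    (((X.mDotL (c.g x y y₀)⁻¹).hasFDerivAt.comp_hasDerivAt y
      (c.hasDerivAt_velocity_W_left x y)).add_const
        (velocity (V := U) (fun ξ => c.W ξ x y y₀) x))
  rw [map_neg, map_neg, ← X.mDotL_mul] at h3
  refine h3.congr_of_eventuallyEq (Eventually.of_forall fun η => ?_)
  simp only [h1, h2 η, Function.comp_apply]

end Cocycle

end LieCrossedModule

/-! ### Uniqueness of solutions and injectivity -/

namespace LieCrossedModule

variable {V U : Type*}
  [NormedAddCommGroup V] [NormedSpace ℝ V] [NormedAddCommGroup U] [NormedSpace ℝ U]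
  {G H : Type*} [TopologicalSpace G] [ChartedSpace V G] [Group G] [LieGroup 𝓘(ℝ, V) ∞ G]
  [TopologicalSpace H] [ChartedSpace U H] [Group H] [LieGroup 𝓘(ℝ, U) ∞ H]
  {X : LieCrossedModule V U G H}

namespace ConnectionDoublet

variable {D : X.ConnectionDoublet} {x₀ y₀ : ℝ} {u v u' v' : ℝ → ℝ → G} {E E' : ℝ → ℝ → H}

lemma IsSolutionU.rlog_eq (h : D.IsSolutionU x₀ u) (y x : ℝ) :
    rlog V (u y) x = -D.a (x, y) ![(1, 0)] :=
  (rightLogDeriv_eq_velocity (h.smooth (y, x)).curve_right).symm.trans (h.ode y x)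

lemma IsSolutionV.rlog_eq (h : D.IsSolutionV y₀ v) (x y : ℝ) :
    rlog V (v x) y = -D.a (x, y) ![(0, 1)] :=
  (rightLogDeriv_eq_velocity (h.smooth (x, y)).curve_right).symm.trans (h.ode x y)

lemma IsSolutionE₁.hasDerivAt_rlog (h : D.IsSolutionE₁ x₀ y₀ u v E) (x y : ℝ) :
    HasDerivAt (fun ξ => rlog U (fun η => E ξ η) y)
      (-X.mDotL ((v x₀ y)⁻¹ * (u y x)⁻¹) (D.B (x, y) ![(1, 0), (0, 1)])) x := by
  have h1 := (differentiable_rlog_right h.smooth y x).hasDerivAt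
  have h2 : deriv (fun ξ => rlog U (fun η => E ξ η) y) x
      = -X.mDotL ((v x₀ y)⁻¹ * (u y x)⁻¹) (D.B (x, y) ![(1, 0), (0, 1)]) :=
    (deriv_rightLogDeriv_eq h.smooth x y).symm.trans (h.ode x y)
  rwa [h2] at h1

lemma IsSolutionE₂.hasDerivAt_llog (h : D.IsSolutionE₂ x₀ y₀ u v E) (x y : ℝ) :
    HasDerivAt (fun η => llog U (fun ξ => E ξ η) x)
      (-X.mDotL ((u y₀ x)⁻¹ * (v x y)⁻¹) (D.B (x, y) ![(1, 0), (0, 1)])) y := by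
  have h1 := (differentiable_llog_left h.smooth x y).hasDerivAt
  have h2 : deriv (fun η => llog U (fun ξ => E ξ η) x) y
      = -X.mDotL ((u y₀ x)⁻¹ * (v x y)⁻¹) (D.B (x, y) ![(1, 0), (0, 1)]) :=
    (deriv_leftLogDeriv_eq h.smooth x y).symm.trans (h.ode x y)
  rwa [h2] at h1

theorem IsSolutionU.unique (h : D.IsSolutionU x₀ u) (h' : D.IsSolutionU x₀ u') : u = u' :=
  funext fun y => eq_of_rlog_eq (V := V) (fun x => (h.smooth (y, x)).curve_right)
    (fun x => (h'.smooth (y, x)).curve_right)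
    (fun x => (h.rlog_eq y x).trans (h'.rlog_eq y x).symm) ((h.init y).trans (h'.init y).symm)

theorem IsSolutionV.unique (h : D.IsSolutionV y₀ v) (h' : D.IsSolutionV y₀ v') : v = v' :=
  funext fun x => eq_of_rlog_eq (V := V) (fun y => (h.smooth (x, y)).curve_right)
    (fun y => (h'.smooth (x, y)).curve_right)
    (fun y => (h.rlog_eq x y).trans (h'.rlog_eq x y).symm) ((h.init x).trans (h'.init x).symm)

/-- Two integrations: in `x`, from the line `x = x₀` where the logarithmic derivative in `y`
vanishes, and in `y`, from the line `y = y₀` where the solution is `1`. -/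
theorem IsSolutionE₁.unique (h : D.IsSolutionE₁ x₀ y₀ u v E) (h' : D.IsSolutionE₁ x₀ y₀ u v E') :
    E = E' := by
  have h0 : ∀ y, rlog U (fun η => E x₀ η) y = rlog U (fun η => E' x₀ η) y := fun y => by
    simp only [h.init_x, h'.init_x]
  have h1 : ∀ y, (fun ξ => rlog U (fun η => E ξ η) y) = fun ξ => rlog U (fun η => E' ξ η) y :=
    fun y => eq_of_hasDerivAt_eq (fun x => h.hasDerivAt_rlog x y)
      (fun x => h'.hasDerivAt_rlog x y) (h0 y)
  exact funext fun x => eq_of_rlog_eq (V := U) (fun y => (h.smooth (x, y)).curve_right)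
    (fun y => (h'.smooth (x, y)).curve_right) (fun y => congrFun (h1 y) x)
    ((h.init_y x).trans (h'.init_y x).symm)

theorem IsSolutionE₂.unique (h : D.IsSolutionE₂ x₀ y₀ u v E) (h' : D.IsSolutionE₂ x₀ y₀ u v E') :
    E = E' := by
  have h0 : ∀ x, llog U (fun ξ => E ξ y₀) x = llog U (fun ξ => E' ξ y₀) x := fun x => by
    simp only [h.init_y, h'.init_y]
  have h1 : ∀ x, (fun η => llog U (fun ξ => E ξ η) x) = fun η => llog U (fun ξ => E' ξ η) x :=
    fun x => eq_of_hasDerivAt_eq (fun y => h.hasDerivAt_llog x y)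
      (fun y => h'.hasDerivAt_llog x y) (h0 x)
  funext x y
  exact congrFun (eq_of_llog_eq (V := U) (fun x => (h.smooth (x, y)).curve_left)
    (fun x => (h'.smooth (x, y)).curve_left) (fun x => congrFun (h1 x) y)
    ((h.init_x y).trans (h'.init_x y).symm)) x

end ConnectionDoublet

namespace Cocycle

variable (c : X.Cocycle)

theorem isSolutionU (x₀ : ℝ) : c.toDoublet.IsSolutionU x₀ (fun y x => c.f x x₀ y) where
  smooth := c.contMDiff_f_comp contDiff_snd contDiff_const contDiff_fst
  ode y x := (rightLogDeriv_eq_velocity (c.contMDiff_f_comp (E := ℝ) contDiff_id contDiff_const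
    contDiff_const x)).trans ((c.rlog_f x x₀ y).trans (congrArg Neg.neg (c.formA_x (x, y)).symm))
  init y := c.f_self x₀ y

theorem isSolutionV (y₀ : ℝ) : c.toDoublet.IsSolutionV y₀ (fun x y => c.g x y y₀) where
  smooth := c.contMDiff_g_comp contDiff_fst contDiff_snd contDiff_const
  ode x y := (rightLogDeriv_eq_velocity (c.contMDiff_g_comp (E := ℝ) contDiff_const contDiff_id
    contDiff_const y)).trans ((c.rlog_g x y y₀).trans (congrArg Neg.neg (c.formA_y (x, y)).symm))
  init x := c.g_self x y₀

theorem isSolutionE₁ (x₀ y₀ : ℝ) : c.toDoublet.IsSolutionE₁ x₀ y₀ (fun y x => c.f x x₀ y)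
    (fun x y => c.g x y y₀) (fun x y => c.W x x₀ y y₀) where
  smooth := c.contMDiff_W_plaquette x₀ y₀
  ode x y := by
    have h := (deriv_rightLogDeriv_eq (V := U) (E := fun x y => c.W x x₀ y y₀)
      (c.contMDiff_W_plaquette x₀ y₀) x y).trans (c.hasDerivAt_rlog_W x x₀ y y₀).deriv
    rw [← c.formB_xy] at h
    exact h
  init_x y := c.W_self_x x₀ y y₀
  init_y x := c.W_self_y x x₀ y₀

/-- Together with `isSolutionE₁` and the two uniqueness statements, this is the reason for the
equivalence of the two second order problems. -/
theorem isSolutionE₂ (x₀ y₀ : ℝ) : c.toDoublet.IsSolutionE₂ x₀ y₀ (fun y x => c.f x x₀ y)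
    (fun x y => c.g x y y₀) (fun x y => c.W x x₀ y y₀) where
  smooth := c.contMDiff_W_plaquette x₀ y₀
  ode x y := by
    have h := (deriv_leftLogDeriv_eq (V := U) (E := fun x y => c.W x x₀ y y₀)
      (c.contMDiff_W_plaquette x₀ y₀) x y).trans (c.hasDerivAt_llog_W x x₀ y y₀).deriv
    rw [← c.formB_xy] at h
    exact h
  init_x y := c.W_self_x x₀ y y₀
  init_y x := c.W_self_y x x₀ y₀

theorem toDoublet_injective : Function.Injective (toDoublet : X.Cocycle → X.ConnectionDoublet) := by
  intro c c' h
  have hf : ∀ x₀, (fun y x => c.f x x₀ y) = fun y x => c'.f x x₀ y := fun x₀ =>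
    (c.isSolutionU x₀).unique (h ▸ c'.isSolutionU x₀)
  have hg : ∀ y₀, (fun x y => c.g x y y₀) = fun x y => c'.g x y y₀ := fun y₀ =>
    (c.isSolutionV y₀).unique (h ▸ c'.isSolutionV y₀)
  have hW : ∀ x₀ y₀, (fun x y => c.W x x₀ y y₀) = fun x y => c'.W x x₀ y y₀ := by
    intro x₀ y₀
    have h' := c'.isSolutionE₁ x₀ y₀
    -- The second order problem involves `u` and `v`, so equality of the `f` and `g` parts is needed
    -- before the two `W` can be compared.
    rw [← h, ← hf, ← hg] at h'
    exact (c.isSolutionE₁ x₀ y₀).unique h'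
  apply Cocycle.ext
  · funext x' x y
    exact congrFun (congrFun (hf x) y) x'
  · funext x y' y
    exact congrFun (congrFun (hg y) x) y'
  · funext x' x y' y
    exact congrFun (congrFun (hW x y) x') y'

theorem toDoublet_ax (x y : ℝ) :
    c.toDoublet.ax x y = -rightLogDeriv (V := V) (fun x' => c.f x' x y) x :=
  neg_eq_iff_eq_neg.1 ((c.isSolutionU x).ode y x).symm

theorem toDoublet_ay (x y : ℝ) :
    c.toDoublet.ay x y = -rightLogDeriv (V := V) (fun y' => c.g x y' y) y :=
  neg_eq_iff_eq_neg.1 ((c.isSolutionV y).ode x y).symm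

/-- This is the second order equation at its own base point, where `f` and `g` equal `1` and the
action is trivial. -/
theorem toDoublet_Bxy (x y : ℝ) : c.toDoublet.Bxy x y
    = -deriv (fun x' => rightLogDeriv (V := U) (fun y' => c.W x' x y' y) y) x := by
  refine neg_eq_iff_eq_neg.1 (((c.isSolutionE₁ x y).ode x y).trans ?_).symm
  rw [c.g_self, c.f_self, inv_one, mul_one]
  exact congrArg Neg.neg (X.mDotL_one _)

theorem toDoublet_Bxy' (x y : ℝ) : c.toDoublet.Bxy x y
    = -deriv (fun y' => leftLogDeriv (V := U) (fun x' => c.W x' x y' y) x) y := by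
  refine neg_eq_iff_eq_neg.1 (((c.isSolutionE₂ x y).ode x y).trans ?_).symm
  rw [c.g_self, c.f_self, inv_one, mul_one]
  exact congrArg Neg.neg (X.mDotL_one _)

end Cocycle

end LieCrossedModule

/-! ### The holonomy of a rectangle with a corner at the origin -/

section Plaquette

variable {V : Type*} [NormedAddCommGroup V] [NormedSpace ℝ V]
  {G : Type*} [TopologicalSpace G] [ChartedSpace V G] [Group G] [LieGroup 𝓘(ℝ, V) ∞ G]

/-- The holonomy around a rectangle with a corner at the origin has the curvature as the derivative
of its logarithmic derivative. -/
theorem hasDerivAt_rlog_plaquette {u v : ℝ × ℝ → G} (hu : ContMDiff 𝓘(ℝ, ℝ × ℝ) 𝓘(ℝ, V) ∞ u)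
    (hv : ContMDiff 𝓘(ℝ, ℝ × ℝ) 𝓘(ℝ, V) ∞ v) {α γ : ℝ × ℝ → V} (hα : Differentiable ℝ α)
    (hγ : Differentiable ℝ γ) (hαu : ∀ x y, rlog V (fun ξ => u (ξ, y)) x = α (x, y))
    (hγv : ∀ x y, rlog V (fun η => v (x, η)) y = γ (x, y)) (x y : ℝ) :
    HasDerivAt (fun ξ => rlog V (fun η => (v (0, η))⁻¹ * (u (ξ, η))⁻¹ * v (ξ, η) * u (ξ, 0)) y)
      (adjoint V ((v (0, y))⁻¹ * (u (x, y))⁻¹)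
        (fderiv ℝ γ (x, y) (1, 0) - fderiv ℝ α (x, y) (0, 1)
          + (chartMulBilin V G (γ (x, y)) (α (x, y)) - chartMulBilin V G (α (x, y)) (γ (x, y)))))
      x := by
  have hcomp : ∀ {w : ℝ × ℝ → G}, ContMDiff 𝓘(ℝ, ℝ × ℝ) 𝓘(ℝ, V) ∞ w → ∀ {φ : ℝ × ℝ → ℝ × ℝ},
      ContDiff ℝ ∞ φ → ContMDiff 𝓘(ℝ, ℝ × ℝ) 𝓘(ℝ, V) ∞ (fun q => w (φ q)) :=
    fun hw _ hφ => hw.comp hφ.contMDiff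
  -- `F` and `K` are the transports restarted on the lines through `(x, y)`, `S` is the small
  -- rectangle with a corner there, and `h` carries it back to the origin. The rectangle at the
  -- origin is `h * S` up to a right factor independent of `η`, so `mixedPartial_commutator` applies
  -- to `S` and `h` contributes its adjoint action.
  let F : ℝ × ℝ → G := fun q => u q * (u (x, q.2))⁻¹
  let K : ℝ × ℝ → G := fun q => v q * (v (q.1, y))⁻¹
  let S : ℝ × ℝ → G := fun q => (K (x, q.2))⁻¹ * (F q)⁻¹ * K q * F (q.1, y)
  let h : ℝ → G := fun η => (v (0, η))⁻¹ * (u (x, η))⁻¹ * v (x, η) * (v (x, y))⁻¹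
  have hF : ContMDiff 𝓘(ℝ, ℝ × ℝ) 𝓘(ℝ, V) ∞ F := hu.mul (hcomp hu (by fun_prop)).inv
  have hK : ContMDiff 𝓘(ℝ, ℝ × ℝ) 𝓘(ℝ, V) ∞ K := hv.mul (hcomp hv (by fun_prop)).inv
  have hF1 : ∀ η, F (x, η) = 1 := fun η => mul_inv_cancel _
  have hK1 : ∀ ξ, K (ξ, y) = 1 := fun ξ => mul_inv_cancel _
  have hS : ContMDiff 𝓘(ℝ, ℝ × ℝ) 𝓘(ℝ, V) ∞ S :=
    (((hcomp hK (by fun_prop)).inv.mul hF.inv).mul hK).mul (hcomp hF (by fun_prop))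
  have hS1 : ∀ ξ, S (ξ, y) = 1 := fun ξ => by simp [S, hK1]
  have hh : ContMDiffAt 𝓘(ℝ, ℝ) 𝓘(ℝ, V) ∞ h y :=
    (((hv (0, y)).curve_right.inv.mul (hu (x, y)).curve_right.inv).mul
      (hv (x, y)).curve_right).mul contMDiffAt_const
  have hhy : h y = (v (0, y))⁻¹ * (u (x, y))⁻¹ := by simp [h]
  have hMK : mixedPartial (fun q => oneChart V G (K q)) (x, y) = fderiv ℝ γ (x, y) (1, 0) := by
    refine (hasDerivAt_velocity_right (hK (x, y)) (hK1 x)).unique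
      ((hγ (x, y)).hasDerivAt_left.congr_of_eventuallyEq (Eventually.of_forall fun ξ => ?_))
    exact hγv ξ y
  have hMF : mixedPartial (fun q => oneChart V G (F q)) (x, y) = fderiv ℝ α (x, y) (0, 1) := by
    refine (hasDerivAt_velocity_left (hF (x, y)) (hF1 y)).unique
      ((hα (x, y)).hasDerivAt_right.congr_of_eventuallyEq (Eventually.of_forall fun η => ?_))
    exact hαu x η
  have hvK : velocity (V := V) (fun η => K (x, η)) y = γ (x, y) := hγv x y
  have hvF : velocity (V := V) (fun ξ => F (ξ, y)) x = α (x, y) := hαu x y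
  have hMS := mixedPartial_commutator hF hK hF1 hK1
  rw [hMK, hMF, hvK, hvF] at hMS
  have hdS := hasDerivAt_velocity_right (hS (x, y)) (hS1 x)
  rw [hMS] at hdS
  rw [← hhy]
  refine (((adjoint V (h y)).hasFDerivAt.comp_hasDerivAt x hdS).const_add
    (rlog V h y)).congr_of_eventuallyEq (Eventually.of_forall fun ξ => ?_)
  change _ = rlog V h y + adjoint V (h y) (velocity (V := V) (fun η => S (ξ, η)) y)
  rw [← rlog_of_eq_one (hS1 ξ), ← rlog_mul hh (hS (ξ, y)).curve_right,
    ← rlog_mul_const _ ((F (ξ, y))⁻¹ * v (ξ, y) * u (ξ, 0))]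
  refine congrArg (fun c => rlog V c y) (funext fun η => ?_)
  simp only [h, S, F, K]
  group

end Plaquette

/-! ### From a doublet to a cocycle: surjectivity -/

namespace LieCrossedModule

variable {V U : Type*}
  [NormedAddCommGroup V] [NormedSpace ℝ V] [NormedAddCommGroup U] [NormedSpace ℝ U]
  {G H : Type*} [TopologicalSpace G] [ChartedSpace V G] [Group G] [LieGroup 𝓘(ℝ, V) ∞ G]
  [TopologicalSpace H] [ChartedSpace U H] [Group H] [LieGroup 𝓘(ℝ, U) ∞ H]
  {X : LieCrossedModule V U G H}

namespace ConnectionDoublet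

/-- Parallel transport along horizontal and vertical lines and surface transport over rectangles
with a corner at the origin. -/
structure Transport (D : X.ConnectionDoublet) where
  u : ℝ × ℝ → G
  v : ℝ × ℝ → G
  E : ℝ × ℝ → H
  contMDiff_u : ContMDiff 𝓘(ℝ, ℝ × ℝ) 𝓘(ℝ, V) ∞ u
  contMDiff_v : ContMDiff 𝓘(ℝ, ℝ × ℝ) 𝓘(ℝ, V) ∞ v
  contMDiff_E : ContMDiff 𝓘(ℝ, ℝ × ℝ) 𝓘(ℝ, U) ∞ E
  rlog_u : ∀ x y, rlog V (fun ξ => u (ξ, y)) x = -D.a (x, y) ![(1, 0)]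
  rlog_v : ∀ x y, rlog V (fun η => v (x, η)) y = -D.a (x, y) ![(0, 1)]
  hasDerivAt_rlog_E : ∀ x y, HasDerivAt (fun ξ => rlog U (fun η => E (ξ, η)) y)
    (-X.mDotL ((v (0, y))⁻¹ * (u (x, y))⁻¹) (D.B (x, y) ![(1, 0), (0, 1)])) x
  t_E : ∀ x y, X.t (E (x, y)) = (v (0, y))⁻¹ * (u (x, y))⁻¹ * v (x, y) * u (x, 0)

lemma contDiff_a_apply (D : X.ConnectionDoublet) (w : Fin 1 → ℝ × ℝ) :
    ContDiff ℝ ∞ (fun p => D.a p w) :=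
  (ContinuousAlternatingMap.apply ℝ (ℝ × ℝ) V w).contDiff.comp D.contDiff_a

lemma contDiff_B_apply (D : X.ConnectionDoublet) (w : Fin 2 → ℝ × ℝ) :
    ContDiff ℝ ∞ (fun p => D.B p w) :=
  (ContinuousAlternatingMap.apply ℝ (ℝ × ℝ) U w).contDiff.comp D.contDiff_B

/-- The second order problem splits into an integration in `x`, which gives the logarithmic
derivative of `E` in `y`, and a first order equation in `y`. The formula for `t(E)` follows by the
same two steps of uniqueness. -/
theorem nonempty_transport [FiniteDimensional ℝ V] [FiniteDimensional ℝ U]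
    (D : X.ConnectionDoublet) : Nonempty D.Transport := by
  have : CompleteSpace U := FiniteDimensional.complete ℝ U
  have hswap : ContDiff ℝ ∞ (Prod.swap : ℝ × ℝ → ℝ × ℝ) := contDiff_snd.prodMk contDiff_fst
  obtain ⟨u, hu, hu', hu0⟩ := exists_rlog_eq (G := G) (D.contDiff_a_apply ![(1, 0)]).neg
  obtain ⟨v', hv, hv', hv0⟩ :=
    exists_rlog_eq (G := G) ((D.contDiff_a_apply ![(0, 1)]).neg.comp hswap)
  let v : ℝ × ℝ → G := fun p => v' p.swap
  replace hv : ContMDiff 𝓘(ℝ, ℝ × ℝ) 𝓘(ℝ, V) ∞ v := hv.comp hswap.contMDiff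
  have hγv : ∀ x y, rlog V (fun η => v (x, η)) y = -D.a (x, y) ![(0, 1)] := fun x y => hv' y x
  replace hv0 : ∀ x, v (x, 0) = 1 := hv0
  let β : ℝ × ℝ → U := fun p =>
    -X.mDotL ((v (0, p.2))⁻¹ * (u p)⁻¹) (D.B p ![(1, 0), (0, 1)])
  have hβ : ContDiff ℝ ∞ β := by
    refine (X.contDiff_mDotL (ContMDiff.mul ?_ hu.inv) (D.contDiff_B_apply _)).neg
    exact (hv.comp (by fun_prop : ContDiff ℝ ∞ (fun p : ℝ × ℝ => ((0 : ℝ), p.2))).contMDiff).inv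
  obtain ⟨E', hE, hE', hE0⟩ :=
    exists_rlog_eq (G := H) ((contDiff_integral_parameter hβ).comp hswap)
  let E : ℝ × ℝ → H := fun p => E' p.swap
  replace hE : ContMDiff 𝓘(ℝ, ℝ × ℝ) 𝓘(ℝ, U) ∞ E := hE.comp hswap.contMDiff
  replace hE' : ∀ x y, rlog U (fun η => E (x, η)) y = ∫ ξ in (0 : ℝ)..x, β (ξ, y) :=
    fun x y => hE' y x
  replace hE0 : ∀ x, E (x, 0) = 1 := hE0
  have hEd : ∀ x y, HasDerivAt (fun ξ => rlog U (fun η => E (ξ, η)) y) (β (x, y)) x := by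
    intro x y
    simp only [hE']
    have hc : Continuous (fun ξ => β (ξ, y)) := hβ.continuous.comp (by fun_prop)
    exact intervalIntegral.integral_hasDerivAt_right (hc.intervalIntegrable _ _)
      (hc.stronglyMeasurableAtFilter _ _) hc.continuousAt
  refine ⟨⟨u, v, E, hu, hv, hE, hu', hγv, hEd, fun x y => ?_⟩⟩
  have hP : ContMDiff 𝓘(ℝ, ℝ × ℝ) 𝓘(ℝ, V) ∞
      (fun q : ℝ × ℝ => (v (0, q.2))⁻¹ * (u q)⁻¹ * v q * u (q.1, 0)) :=
    (((hv.comp (by fun_prop : ContDiff ℝ ∞ (fun p : ℝ × ℝ => ((0 : ℝ), p.2))).contMDiff).inv.mul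
      hu.inv).mul hv).mul
      (hu.comp (by fun_prop : ContDiff ℝ ∞ (fun p : ℝ × ℝ => (p.1, (0 : ℝ)))).contMDiff)
  have htE : ContMDiff 𝓘(ℝ, ℝ × ℝ) 𝓘(ℝ, V) ∞ (fun q : ℝ × ℝ => X.t (E q)) := X.contMDiff_t.comp hE
  -- Both sides vanish at `x = 0`. Their `x`-derivatives are `ṫ(β)` and the transported curvature,
  -- which agree by the vanishing of the fake curvature and the equivariance of `ṫ`.
  have hrlog : ∀ y, (fun ξ => rlog V (fun η => X.t (E (ξ, η))) y)
      = fun ξ => rlog V (fun η => (v (0, η))⁻¹ * (u (ξ, η))⁻¹ * v (ξ, η) * u (ξ, 0)) y := by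
    intro y
    refine eq_of_hasDerivAt_eq (x₀ := 0) (h' := fun x => X.tDotL (β (x, y))) (fun x => ?_)
      (fun x => ?_) ?_
    · refine (X.tDotL.hasFDerivAt.comp_hasDerivAt x (hEd x y)).congr_of_eventuallyEq
        (Eventually.of_forall fun ξ => ?_)
      exact X.rlog_t (hE (ξ, y)).curve_right
    · have h := hasDerivAt_rlog_plaquette hu hv
        ((D.contDiff_a_apply ![(1, 0)]).neg.differentiable (by simp))
        ((D.contDiff_a_apply ![(0, 1)]).neg.differentiable (by simp)) hu' hγv x y
      have hflat := (fake_flat_iff (D.contDiff_a.differentiable (by simp) (x, y))).1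
        (D.fake_flat (x, y))
      convert h using 1
      simp only [β]
      rw [map_neg, X.tDotL_mDotL, ← map_neg, hflat]
      congr 1
      simp only [fderiv_fun_neg, ← neg_one_smul ℝ (D.a (x, y) _), chartMulBilin_smul_left,
        chartMulBilin_smul_right, neg_apply]
      module
    · simp only [hu0, X.rlog_t (hE (0, y)).curve_right, hE', intervalIntegral.integral_same,
        map_zero, inv_one, mul_one, inv_mul_cancel, rlog_const]
  exact congrFun (eq_of_rlog_eq (V := V) (s₀ := 0) (c := fun η => X.t (E (x, η)))
    (d := fun η => (v (0, η))⁻¹ * (u (x, η))⁻¹ * v (x, η) * u (x, 0))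
    (fun y => (htE (x, y)).curve_right) (fun y => (hP (x, y)).curve_right)
    (fun y => congrFun (hrlog y) x) (by simp [hE0, hv0])) y

namespace Transport

variable {D : X.ConnectionDoublet} (T : D.Transport)

section Smooth

variable {F : Type*} [NormedAddCommGroup F] [NormedSpace ℝ F] {φ : F → ℝ × ℝ}

lemma contMDiff_u_comp (hφ : ContDiff ℝ ∞ φ) :
    ContMDiff 𝓘(ℝ, F) 𝓘(ℝ, V) ∞ (fun p => T.u (φ p)) :=
  T.contMDiff_u.comp hφ.contMDiff

lemma contMDiff_v_comp (hφ : ContDiff ℝ ∞ φ) :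
    ContMDiff 𝓘(ℝ, F) 𝓘(ℝ, V) ∞ (fun p => T.v (φ p)) :=
  T.contMDiff_v.comp hφ.contMDiff

lemma contMDiff_E_comp (hφ : ContDiff ℝ ∞ φ) :
    ContMDiff 𝓘(ℝ, F) 𝓘(ℝ, U) ∞ (fun p => T.E (φ p)) :=
  T.contMDiff_E.comp hφ.contMDiff

end Smooth

/-- The cocycle of parallel and surface transport. -/
def toCocycle : X.Cocycle where
  f x' x y := T.u (x', y) * (T.u (x, y))⁻¹
  g x y' y := T.v (x, y') * (T.v (x, y))⁻¹
  -- Under `t` the four rectangles at the origin telescope to the holonomy of the rectangle with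
  -- corner `(x, y)`, conjugated by the transport from the origin to that corner along the path up
  -- the axis and then across. The outer action undoes this conjugation.
  W x' x y' y := X.m (T.u (x, y) * T.v (0, y))
    (T.E (x, y) * (T.E (x, y'))⁻¹ * T.E (x', y') * (T.E (x', y))⁻¹)
  contMDiff_f := (T.contMDiff_u_comp (by fun_prop)).mul (T.contMDiff_u_comp (by fun_prop)).inv
  contMDiff_g := (T.contMDiff_v_comp (by fun_prop)).mul (T.contMDiff_v_comp (by fun_prop)).inv
  contMDiff_W := fun p => X.contMDiffAt_m
    (((T.contMDiff_u_comp (by fun_prop)).mul (T.contMDiff_v_comp (by fun_prop))) p)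
    (((((T.contMDiff_E_comp (by fun_prop)).mul (T.contMDiff_E_comp (by fun_prop)).inv).mul
      (T.contMDiff_E_comp (by fun_prop))).mul (T.contMDiff_E_comp (by fun_prop)).inv) p)
  target x' x y' y := by
    rw [X.t_m]
    simp only [map_mul, map_inv, T.t_E]
    group
  f_comp x'' x' x y := by group
  g_comp x y'' y' y := by group
  W_comp_x x'' x' x y' y := by
    rw [← MulAut.mul_apply, ← map_mul,
      show (T.u (x', y) * (T.u (x, y))⁻¹)⁻¹ * (T.u (x', y) * T.v (0, y))
        = T.u (x, y) * T.v (0, y) by group, ← map_mul]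
    congr 1
    group
  W_comp_y x' x y'' y' y := by
    -- The paths to `(x, y)` through the two corners differ by the holonomy of a strip, which is `t`
    -- of a quotient of values of `E`. The Peiffer identity turns its action into a conjugation,
    -- after which the product telescopes.
    rw [← MulAut.mul_apply, ← map_mul,
      show (T.v (x, y') * (T.v (x, y))⁻¹)⁻¹ * (T.u (x, y') * T.v (0, y'))
        = T.u (x, y) * T.v (0, y) * X.t (T.E (x, y) * (T.E (x, y'))⁻¹) by
          simp only [map_mul, map_inv, T.t_E]
          group, map_mul X.m _ (X.t _), MulAut.mul_apply, X.peiffer, ← map_mul]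
    congr 1
    group

/-- Only `B` needs an argument. The velocity of the plaquette in `y` is `ṁ(r)` of a difference of
logarithmic derivatives of `E`, and `r` is the inverse of the group element occurring in the
equation for `E`, so the two actions cancel upon differentiation. -/
theorem toDoublet_toCocycle : T.toCocycle.toDoublet = D := by
  have hB : ∀ x y, T.toCocycle.Bxy (x, y) = D.B (x, y) ![(1, 0), (0, 1)] := by
    intro x y
    let r : G := T.u (x, y) * T.v (0, y)
    have hE : ∀ ξ, ContMDiffAt 𝓘(ℝ, ℝ) 𝓘(ℝ, U) ∞ (fun η => T.E (ξ, η)) y := fun ξ =>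
      (T.contMDiff_E (ξ, y)).curve_right
    have hvel : ∀ ξ, velocity (V := U) (fun η => T.toCocycle.W ξ x η y) y
        = X.mDotL r (-rlog U (fun η => T.E (x, η)) y + rlog U (fun η => T.E (ξ, η)) y) := by
      intro ξ
      have h1 : ∀ ξ, ContMDiffAt 𝓘(ℝ, ℝ) 𝓘(ℝ, U) ∞ (fun η => T.E (ξ, η) * (T.E (ξ, y))⁻¹) y :=
        fun ξ => (hE ξ).mul contMDiffAt_const
      rw [rlog, rlog, ← velocity_inv (h1 x) (mul_inv_cancel _),
        ← velocity_mul (h1 x).inv (h1 ξ) (by simp) (mul_inv_cancel _),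
        ← X.velocity_m r (c := fun η => (T.E (x, η) * (T.E (x, y))⁻¹)⁻¹
          * (T.E (ξ, η) * (T.E (ξ, y))⁻¹)) ((h1 x).inv.mul (h1 ξ)) (by simp)]
      congr 1
      funext η
      simp [toCocycle, r, mul_assoc]
    have h2 := (X.mDotL r).hasFDerivAt.comp_hasDerivAt x
      ((T.hasDerivAt_rlog_E x y).const_add (-rlog U (fun η => T.E (x, η)) y))
    rw [map_neg, ← X.mDotL_mul, show r * ((T.v (0, y))⁻¹ * (T.u (x, y))⁻¹) = 1 by
      simp [r, mul_assoc], X.mDotL_one] at h2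
    exact neg_inj.1 ((T.toCocycle.hasDerivAt_velocity_W_right x y).unique
      (h2.congr_of_eventuallyEq (Eventually.of_forall hvel)))
  apply ConnectionDoublet.ext
  · funext p
    refine oneForm_ext ?_ ?_
    · refine (T.toCocycle.formA_x p).trans ?_
      exact neg_eq_iff_eq_neg.2 (T.rlog_u p.1 p.2)
    · refine (T.toCocycle.formA_y p).trans ?_
      exact neg_eq_iff_eq_neg.2 (T.rlog_v p.1 p.2)
  · funext p
    exact twoForm_ext ((T.toCocycle.formB_xy p).trans (hB p.1 p.2))

end Transport

end ConnectionDoublet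

theorem Cocycle.toDoublet_surjective [FiniteDimensional ℝ V] [FiniteDimensional ℝ U] :
    Function.Surjective (toDoublet : X.Cocycle → X.ConnectionDoublet) := fun D => by
  obtain ⟨T⟩ := D.nonempty_transport
  exact ⟨T.toCocycle, T.toDoublet_toCocycle⟩

end LieCrossedModule

end

/-! ### The bijection -/

theorem mainTheorem1 {V U : Type*}
    [NormedAddCommGroup V] [NormedSpace ℝ V] [FiniteDimensional ℝ V]
    [NormedAddCommGroup U] [NormedSpace ℝ U] [FiniteDimensional ℝ U]
    {G H : Type*} [TopologicalSpace G] [ChartedSpace V G] [Group G] [LieGroup 𝓘(ℝ, V) ∞ G]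
    [TopologicalSpace H] [ChartedSpace U H] [Group H] [LieGroup 𝓘(ℝ, U) ∞ H]
    (X : LieCrossedModule V U G H) :
    ∃ Φ : X.Cocycle ≃ X.ConnectionDoublet,
      -- the doublet of a cocycle
      (∀ (c : X.Cocycle) (x y : ℝ),
        (Φ c).ax x y = -rightLogDeriv (V := V) (fun x' => c.f x' x y) x ∧
        (Φ c).ay x y = -rightLogDeriv (V := V) (fun y' => c.g x y' y) y ∧
        (Φ c).Bxy x y =
          -deriv (fun x' => rightLogDeriv (V := U) (fun y' => c.W x' x y' y) y) x ∧
        (Φ c).Bxy x y =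
          -deriv (fun y' => leftLogDeriv (V := U) (fun x' => c.W x' x y' y) x) y) ∧
      -- the cocycle of a doublet is given by the unique solutions of the differential problems,
      -- the two forms of the second order problem being equivalent
      (∀ D : X.ConnectionDoublet,
        (∀ (x₀ : ℝ) (u : ℝ → ℝ → G),
          D.IsSolutionU x₀ u ↔ u = fun y x => (Φ.symm D).f x x₀ y) ∧
        (∀ (y₀ : ℝ) (v : ℝ → ℝ → G),
          D.IsSolutionV y₀ v ↔ v = fun x y => (Φ.symm D).g x y y₀) ∧
        (∀ (x₀ y₀ : ℝ) (u v : ℝ → ℝ → G), D.IsSolutionU x₀ u → D.IsSolutionV y₀ v →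
          ∀ E : ℝ → ℝ → H,
            (D.IsSolutionE₁ x₀ y₀ u v E ↔ E = fun x y => (Φ.symm D).W x x₀ y y₀) ∧
            (D.IsSolutionE₂ x₀ y₀ u v E ↔ E = fun x y => (Φ.symm D).W x x₀ y y₀) ∧
            (D.IsSolutionE₁ x₀ y₀ u v E ↔ D.IsSolutionE₂ x₀ y₀ u v E))) := by
  refine ⟨Equiv.ofBijective LieCrossedModule.Cocycle.toDoublet
    ⟨LieCrossedModule.Cocycle.toDoublet_injective, LieCrossedModule.Cocycle.toDoublet_surjective⟩,
    fun c x y => ⟨c.toDoublet_ax x y, c.toDoublet_ay x y, c.toDoublet_Bxy x y,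
      c.toDoublet_Bxy' x y⟩, fun D => ?_⟩
  set Φ : X.Cocycle ≃ X.ConnectionDoublet := Equiv.ofBijective LieCrossedModule.Cocycle.toDoublet
    ⟨LieCrossedModule.Cocycle.toDoublet_injective, LieCrossedModule.Cocycle.toDoublet_surjective⟩
  -- Once `D` is the doublet of a cocycle `c`, the components of `c` already solve all the problems,
  -- and only uniqueness remains to be invoked.
  obtain ⟨c, rfl⟩ := Φ.surjective D
  rw [Φ.symm_apply_apply]
  refine ⟨fun x₀ u => ⟨fun h => h.unique (c.isSolutionU x₀), ?_⟩,
    fun y₀ v => ⟨fun h => h.unique (c.isSolutionV y₀), ?_⟩, fun x₀ y₀ u v hu hv E => ?_⟩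
  · rintro rfl
    exact c.isSolutionU x₀
  · rintro rfl
    exact c.isSolutionV y₀
  · obtain rfl := hu.unique (c.isSolutionU x₀)
    obtain rfl := hv.unique (c.isSolutionV y₀)
    have h₁ : (Φ c).IsSolutionE₁ x₀ y₀ (fun y x => c.f x x₀ y) (fun x y => c.g x y y₀) E
        ↔ E = fun x y => c.W x x₀ y y₀ :=
      ⟨fun h => h.unique (c.isSolutionE₁ x₀ y₀), fun h => h ▸ c.isSolutionE₁ x₀ y₀⟩
    have h₂ : (Φ c).IsSolutionE₂ x₀ y₀ (fun y x => c.f x x₀ y) (fun x y => c.g x y y₀) E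
        ↔ E = fun x y => c.W x x₀ y y₀ :=
      ⟨fun h => h.unique (c.isSolutionE₂ x₀ y₀), fun h => h ▸ c.isSolutionE₂ x₀ y₀⟩
    exact ⟨h₁, h₂, h₁.trans h₂.symm⟩
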